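/- Let $n>2$, let $M$ be a connected smooth $n$-manifold (Hausdorff, second countable), let $V$ be an $(n+1)$-dimensional real vector space regarded as a flat affine space with its standard connection $\widehat\nabla$, and let $i:M\to V$ be a smooth immersion that is non-degenerate (its second fundamental form $\Pi(X,Y)=\widehat\nabla_X Ti(Y) \bmod Ti(TM)$ is non-degenerate) and co-oriented (an orientation of the normal line bundle $i^*TV/Ti(TM)$ is fixed; it is arbitrary, so in particular it may be the positive co-orientation). A smooth transverse vector field $\mathsf W$ along $i$ induces on $M$ a torsion-free connection $\nabla$ and a pseudo-Riemannian metric $h$ by $\widehat\nabla_X Ti(Y)=Ti(\nabla_XY)+h(X,Y)\mathsf W$. A torsion-free connection $\nabla$ is aligned with respect to a metric $h$ if $h^{pq}\nabla_ih_{pq}=n\,h^{pq}\nabla_ph_{qi}$. The affine normal bundle is the transverse line bundle $W$ spanned by a $\mathsf W$ for which $\nabla$ is aligned with respect to $h$. The immersed hypersurface is an affine hypersphere if the affine normal lines $i(p)+W_p$, $p\in M$, all pass through one point (proper) or are all parallel (improper). An AH structure on $M$ is a pair $([\nabla],[h])$ of a projective structure (a class of torsion-free connections whose difference tensors are of the form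 $2\alpha_{(i}\delta_{j)}{}^k$) and a pseudo-Riemannian conformal structure such that $\nabla_{[i}H_{j]k}=0$, where $H_{ij}=|\det h|^{-1/n}h_{ij}$ is the density-valued normalized metric and $\nabla$ is the aligned representative of $[\nabla]$. Write $R_{ijk}{}^l$ for the curvature of the aligned representative, with $2\nabla_{[i}\nabla_{j]}X^k=R_{ijp}{}^kX^p$, and, with indices raised and lowered by $H$, put $R_{ij}=R_{pij}{}^p$, $Q_{ij}=R_{ip}{}^p{}_j$, $R=H^{ij}R_{ij}$ and $F_{ij}=\tfrac1nR_{ijp}{}^p$. The AH structure is Einstein if the trace-free symmetric parts of $R_{ij}$ and $Q_{ij}$ vanish and $\nabla_iR+n\nabla^pF_{ip}=0$. It is projectively flat if around every point of $M$ there are coordinates in which a representative of $[\nabla]$ is projectively equivalent to the standard flat connection of $\mathbb R^n$. Then there is exactly one AH structure $([\nabla],[h])$ on $M$ such that $\nabla$ and $h$ are induced by a section of the affine normal bundle that is positive for the co-orientation (the AH structure induced via the affine normal), and the following are equivalent: 1. the immersed hypersurface is an affine hypersphere; 2. the AH structure induced via the affine normal is Einstein; 3. the AH structure induced via the affine normal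 is projectively flat. -/

import Mathlib

open scoped Manifold ContDiff Bundle

noncomputable section

namespace AHGeometry

/-! ### Connections, metrics, projective and conformal structures on a manifold -/

section Structures

/-- The vector field `Y` is differentiable at `p`, as a section of the tangent bundle. -/
def IsDifferentiableAt {n : ℕ} {M : Type*} [TopologicalSpace M]
    [ChartedSpace (EuclideanSpace ℝ (Fin n)) M] [IsManifold (𝓡 n) ∞ M]
    (Y : ∀ p : M, TangentSpace (𝓡 n) p) (p : M) : Prop :=
  MDifferentiableAt (𝓡 n) (𝓡 n).tangent
    (fun q ↦ (⟨q, Y q⟩ : TangentBundle (𝓡 n) M)) p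

/-- A smooth torsion-free affine connection on the `n`-manifold `M`.
The value `conn Y p X` is `(∇_X Y)(p)`. -/
structure TorsionFreeConnection (n : ℕ) (M : Type*) [TopologicalSpace M]
    [ChartedSpace (EuclideanSpace ℝ (Fin n)) M] [IsManifold (𝓡 n) ∞ M] where
  conn : CovariantDerivative (𝓡 n) (EuclideanSpace ℝ (Fin n)) (TangentSpace (𝓡 n) : M → Type _)
  smooth : CovariantDerivative.ContMDiffCovariantDerivative conn ∞
  torsion_eq_zero : conn.torsion = 0

/-- A smooth pseudo-Riemannian metric, of arbitrary signature. -/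
structure PseudoMetric (n : ℕ) (M : Type*) [TopologicalSpace M]
    [ChartedSpace (EuclideanSpace ℝ (Fin n)) M] [IsManifold (𝓡 n) ∞ M] where
  val : ∀ p : M, TangentSpace (𝓡 n) p →L[ℝ] TangentSpace (𝓡 n) p →L[ℝ] ℝ
  symm : ∀ (p : M) (X Y : TangentSpace (𝓡 n) p), val p X Y = val p Y X
  nondegenerate : ∀ (p : M) (X : TangentSpace (𝓡 n) p), (∀ Y, val p X Y = 0) → X = 0
  smooth : ContMDiff (𝓡 n)
    ((𝓡 n).prod 𝓘(ℝ, EuclideanSpace ℝ (Fin n) →L[ℝ] EuclideanSpace ℝ (Fin n) →L[ℝ] ℝ)) ∞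
    (fun p ↦ Bundle.TotalSpace.mk'
      (EuclideanSpace ℝ (Fin n) →L[ℝ] EuclideanSpace ℝ (Fin n) →L[ℝ] ℝ)
      (E := fun p : M ↦ TangentSpace (𝓡 n) p →L[ℝ] TangentSpace (𝓡 n) p →L[ℝ] ℝ) p (val p))

variable {n : ℕ} {M : Type*} [TopologicalSpace M]
  [ChartedSpace (EuclideanSpace ℝ (Fin n)) M] [IsManifold (𝓡 n) ∞ M]

/-- Two torsion-free connections are projectively equivalent if their difference tensor is pure
trace: `∇'_X Y = ∇_X Y + α(X) Y + α(Y) X` for some one-form `α`. -/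
def ProjectivelyEquivalent (D D' : TorsionFreeConnection n M) : Prop :=
  ∃ α : ∀ p : M, TangentSpace (𝓡 n) p →L[ℝ] ℝ,
    ∀ (Y : ∀ p : M, TangentSpace (𝓡 n) p) (p : M), IsDifferentiableAt Y p →
      ∀ X : TangentSpace (𝓡 n) p,
        D'.conn Y p X = D.conn Y p X + (α p X • Y p + α p (Y p) • X)

/-- Two metrics are conformally equivalent if one is a positive multiple of the other. -/
def ConformallyEquivalent (h h' : PseudoMetric n M) : Prop :=
  ∃ f : M → ℝ, (∀ p, 0 < f p) ∧ ∀ p, h'.val p = f p • h.val p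

instance projectiveSetoid (n : ℕ) (M : Type*) [TopologicalSpace M]
    [ChartedSpace (EuclideanSpace ℝ (Fin n)) M] [IsManifold (𝓡 n) ∞ M] :
    Setoid (TorsionFreeConnection n M) where
  r := ProjectivelyEquivalent
  iseqv :=
    { refl := fun D ↦ ⟨fun _ ↦ 0, fun Y p _ X ↦ by simp⟩
      symm := by
        rintro D D' ⟨α, hα⟩
        refine ⟨fun p ↦ -α p, fun Y p hY X ↦ ?_⟩
        rw [hα Y p hY X]
        simp only [neg_apply]
        module
      trans := by
        rintro D D' D'' ⟨α, hα⟩ ⟨β, hβ⟩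
        refine ⟨fun p ↦ α p + β p, fun Y p hY X ↦ ?_⟩
        rw [hβ Y p hY X, hα Y p hY X]
        simp only [add_apply]
        module }

instance conformalSetoid (n : ℕ) (M : Type*) [TopologicalSpace M]
    [ChartedSpace (EuclideanSpace ℝ (Fin n)) M] [IsManifold (𝓡 n) ∞ M] :
    Setoid (PseudoMetric n M) where
  r := ConformallyEquivalent
  iseqv :=
    { refl := fun h ↦ ⟨fun _ ↦ 1, fun _ ↦ one_pos, fun p ↦ by simp⟩
      symm := by
        rintro h h' ⟨f, hf, hh⟩
        refine ⟨fun p ↦ (f p)⁻¹, fun p ↦ inv_pos.2 (hf p), fun p ↦ ?_⟩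
        rw [hh p, smul_smul, inv_mul_cancel₀ (hf p).ne', one_smul]
      trans := by
        rintro h h' h'' ⟨f, hf, hh⟩ ⟨g, hg, hh'⟩
        refine ⟨fun p ↦ g p * f p, fun p ↦ mul_pos (hg p) (hf p), fun p ↦ ?_⟩
        rw [hh' p, hh p, smul_smul] }

/-- A projective structure `[∇]`. -/
def ProjectiveStructure (n : ℕ) (M : Type*) [TopologicalSpace M]
    [ChartedSpace (EuclideanSpace ℝ (Fin n)) M] [IsManifold (𝓡 n) ∞ M] :=
  Quotient (projectiveSetoid n M)

/-- A conformal structure `[h]`. -/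
def ConformalStructure (n : ℕ) (M : Type*) [TopologicalSpace M]
    [ChartedSpace (EuclideanSpace ℝ (Fin n)) M] [IsManifold (𝓡 n) ∞ M] :=
  Quotient (conformalSetoid n M)

/-- The projective structure `[∇]` generated by `∇`. -/
def TorsionFreeConnection.projClass (D : TorsionFreeConnection n M) : ProjectiveStructure n M :=
  Quotient.mk _ D

/-- The conformal structure `[h]` of which `h` is a representative. -/
def PseudoMetric.confClass (h : PseudoMetric n M) : ConformalStructure n M :=
  Quotient.mk _ h

end Structures

/-! ### Components in a chart

In what follows `e` is a chart of `M` with values in `ℝⁿ`, and `x` is a point of the target of `e`.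
-/

section Components

variable {n : ℕ}

/-- The partial derivative `∂ᵢ f` at `x`. -/
def partialDeriv (i : Fin n) (f : EuclideanSpace ℝ (Fin n) → ℝ) (x : EuclideanSpace ℝ (Fin n)) :
    ℝ :=
  fderiv ℝ f x (EuclideanSpace.single i 1)

/-- Covariant derivative `∇ᵢ s = ∂ᵢ s - w Γᵢₚᵖ s` of a density `s` of weight `w`
(a section of the line bundle `|det T*M|ʷ`), where `Γ x i j k` is `Γᵢⱼᵏ(x)`. -/
def covDerivDensity (Γ : EuclideanSpace ℝ (Fin n) → Fin n → Fin n → Fin n → ℝ) (w : ℝ)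
    (s : EuclideanSpace ℝ (Fin n) → ℝ) (x : EuclideanSpace ℝ (Fin n)) (i : Fin n) : ℝ :=
  partialDeriv i s x - w * (∑ p, Γ x i p p) * s x

/-- Covariant derivative `∇ᵢ Tⱼₖ` of a covariant two-tensor `T` with values in densities of
weight `w`. -/
def covDerivTwoTensor (Γ : EuclideanSpace ℝ (Fin n) → Fin n → Fin n → Fin n → ℝ) (w : ℝ)
    (T : EuclideanSpace ℝ (Fin n) → Matrix (Fin n) (Fin n) ℝ) (x : EuclideanSpace ℝ (Fin n))
    (i j k : Fin n) : ℝ :=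
  partialDeriv i (fun y ↦ T y j k) x - ∑ p, Γ x i j p * T x p k - ∑ p, Γ x i k p * T x j p
    - w * (∑ p, Γ x i p p) * T x j k

/-- The curvature `Rᵢⱼₖˡ`, normalized by `2∇_[i ∇_j] Xᵏ = Rᵢⱼₚᵏ Xᵖ`. -/
def curvature (Γ : EuclideanSpace ℝ (Fin n) → Fin n → Fin n → Fin n → ℝ)
    (x : EuclideanSpace ℝ (Fin n)) (i j k l : Fin n) : ℝ :=
  partialDeriv i (fun y ↦ Γ y j k l) x - partialDeriv j (fun y ↦ Γ y i k l) x
    + ∑ p, (Γ x i p l * Γ x j k p - Γ x j p l * Γ x i k p)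

/-- The Ricci curvature `Rᵢⱼ = Rₚᵢⱼᵖ`. -/
def ricci (Γ : EuclideanSpace ℝ (Fin n) → Fin n → Fin n → Fin n → ℝ)
    (x : EuclideanSpace ℝ (Fin n)) : Matrix (Fin n) (Fin n) ℝ :=
  fun i j ↦ ∑ p, curvature Γ x p i j p

/-- The trace `Qᵢⱼ = Hᵖ𐞥 Rᵢₚ𐞥ˡ Hₗⱼ`. -/
def ricciQ (Γ : EuclideanSpace ℝ (Fin n) → Fin n → Fin n → Fin n → ℝ)
    (H : EuclideanSpace ℝ (Fin n) → Matrix (Fin n) (Fin n) ℝ)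
    (x : EuclideanSpace ℝ (Fin n)) : Matrix (Fin n) (Fin n) ℝ :=
  fun i j ↦ ∑ p, ∑ q, ∑ l, (H x)⁻¹ p q * curvature Γ x i p q l * H x l j

/-- The weighted scalar curvature `R = Hⁱʲ Rᵢⱼ`, a density of weight `2/n`. -/
def weightedScalar (Γ : EuclideanSpace ℝ (Fin n) → Fin n → Fin n → Fin n → ℝ)
    (H : EuclideanSpace ℝ (Fin n) → Matrix (Fin n) (Fin n) ℝ)
    (x : EuclideanSpace ℝ (Fin n)) : ℝ :=
  ∑ i, ∑ j, (H x)⁻¹ i j * ricci Γ x i j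

/-- The Faraday two-form `Fᵢⱼ = (1/n) Rᵢⱼₚᵖ`. -/
def faraday (Γ : EuclideanSpace ℝ (Fin n) → Fin n → Fin n → Fin n → ℝ)
    (x : EuclideanSpace ℝ (Fin n)) : Matrix (Fin n) (Fin n) ℝ :=
  fun i j ↦ (1 / (n : ℝ)) * ∑ p, curvature Γ x i j p p

/-- The trace-free symmetric part `Z₍ᵢⱼ₎ - (1/n) Gᵖ𐞥 Zₚ𐞥 Gᵢⱼ` with respect to the metric `G`. -/
def traceFreeSymm (G Z : Matrix (Fin n) (Fin n) ℝ) : Matrix (Fin n) (Fin n) ℝ :=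
  fun i j ↦ (Z i j + Z j i) / 2 - (1 / (n : ℝ)) * (∑ p, ∑ q, G⁻¹ p q * Z p q) * G i j

variable {M : Type*} [TopologicalSpace M]
  [ChartedSpace (EuclideanSpace ℝ (Fin n)) M] [IsManifold (𝓡 n) ∞ M]

/-- The coordinate vector field `∂ᵢ` of the chart `e` (on the source of `e`). -/
def coordField (e : OpenPartialHomeomorph M (EuclideanSpace ℝ (Fin n))) (i : Fin n) :
    ∀ p : M, TangentSpace (𝓡 n) p :=
  VectorField.mpullback (𝓡 n) (𝓡 n) e (fun _ ↦ EuclideanSpace.single i 1)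

/-- The `k`-th component in the chart `e` of a tangent vector at `p`. -/
def coordComponent (e : OpenPartialHomeomorph M (EuclideanSpace ℝ (Fin n))) (p : M)
    (X : TangentSpace (𝓡 n) p) (k : Fin n) : ℝ :=
  EuclideanSpace.proj (𝕜 := ℝ) k (mfderiv (𝓡 n) (𝓡 n) e p X)

/-- The Christoffel symbols `Γᵢⱼᵏ` in the chart `e`: `∇_{∂ᵢ} ∂ⱼ = Γᵢⱼᵏ ∂ₖ`. -/
def TorsionFreeConnection.christoffel (D : TorsionFreeConnection n M)
    (e : OpenPartialHomeomorph M (EuclideanSpace ℝ (Fin n))) (x : EuclideanSpace ℝ (Fin n))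
    (i j k : Fin n) : ℝ :=
  coordComponent e (e.symm x)
    (D.conn (coordField e j) (e.symm x) (coordField e i (e.symm x))) k

/-- The components `hᵢⱼ` in the chart `e`. -/
def PseudoMetric.components (h : PseudoMetric n M)
    (e : OpenPartialHomeomorph M (EuclideanSpace ℝ (Fin n))) (x : EuclideanSpace ℝ (Fin n)) :
    Matrix (Fin n) (Fin n) ℝ :=
  fun i j ↦ h.val (e.symm x) (coordField e i (e.symm x)) (coordField e j (e.symm x))

/-- The components in the chart `e` of the normalized metric `Hᵢⱼ = |det h|^(-1/n) hᵢⱼ`, a tensor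
with values in densities of weight `-2/n`, which depends only on the conformal structure `[h]`. -/
def PseudoMetric.normalized (h : PseudoMetric n M)
    (e : OpenPartialHomeomorph M (EuclideanSpace ℝ (Fin n))) (x : EuclideanSpace ℝ (Fin n)) :
    Matrix (Fin n) (Fin n) ℝ :=
  |(h.components e x).det| ^ (-(1 / (n : ℝ))) • h.components e x

/-- The covariant derivative `∇ᵢ Hⱼₖ` of the normalized metric. -/
def nablaH (D : TorsionFreeConnection n M) (h : PseudoMetric n M)
    (e : OpenPartialHomeomorph M (EuclideanSpace ℝ (Fin n))) (x : EuclideanSpace ℝ (Fin n))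
    (i j k : Fin n) : ℝ :=
  covDerivTwoTensor (D.christoffel e) (-(2 / (n : ℝ))) (h.normalized e) x i j k

/-- `∇` is aligned with respect to `h`: `hᵖ𐞥 ∇ᵢ hₚ𐞥 = n hᵖ𐞥 ∇ₚ h𐞥ᵢ`. -/
def IsAligned (D : TorsionFreeConnection n M) (h : PseudoMetric n M) : Prop :=
  ∀ e ∈ IsManifold.maximalAtlas (𝓡 n) ∞ M, ∀ x ∈ e.target, ∀ i : Fin n,
    ∑ p, ∑ q, (h.components e x)⁻¹ p q *
        covDerivTwoTensor (D.christoffel e) 0 (h.components e) x i p q =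
      n * ∑ p, ∑ q, (h.components e x)⁻¹ p q *
        covDerivTwoTensor (D.christoffel e) 0 (h.components e) x p q i

end Components

/-! ### AH structures -/

section AH

/-- An AH structure `([∇], [h])`: a projective structure and a conformal structure for which the
conformal torsion `(4/3) Hᵏᵖ ∇_[i H_j]p` of the aligned representative `∇` vanishes. -/
@[ext]
structure AHStructure (n : ℕ) (M : Type*) [TopologicalSpace M]
    [ChartedSpace (EuclideanSpace ℝ (Fin n)) M] [IsManifold (𝓡 n) ∞ M] where
  proj : ProjectiveStructure n M
  conf : ConformalStructure n M
  conformalTorsion_eq_zero : ∃ (D : TorsionFreeConnection n M) (h : PseudoMetric n M),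
    D.projClass = proj ∧ h.confClass = conf ∧ IsAligned D h ∧
      ∀ e ∈ IsManifold.maximalAtlas (𝓡 n) ∞ M, ∀ x ∈ e.target, ∀ i j k : Fin n,
        nablaH D h e x i j k = nablaH D h e x j i k

variable {n : ℕ} {M : Type*} [TopologicalSpace M]
  [ChartedSpace (EuclideanSpace ℝ (Fin n)) M] [IsManifold (𝓡 n) ∞ M]

/-- The naive Einstein equations: the trace-free symmetric parts of `Rᵢⱼ` and `Qᵢⱼ` vanish, where
the curvature is that of the aligned representative of `[∇]`. -/
def NaiveEinsteinEquations (D : TorsionFreeConnection n M) (h : PseudoMetric n M) : Prop :=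
  ∀ e ∈ IsManifold.maximalAtlas (𝓡 n) ∞ M, ∀ x ∈ e.target,
    traceFreeSymm (h.normalized e x) (ricci (D.christoffel e) x) = 0 ∧
    traceFreeSymm (h.normalized e x) (ricciQ (D.christoffel e) (h.normalized e) x) = 0

/-- The conservation condition `∇ᵢ R + n ∇ᵖ Fᵢₚ = 0`. -/
def ConservationEquation (D : TorsionFreeConnection n M) (h : PseudoMetric n M) : Prop :=
  ∀ e ∈ IsManifold.maximalAtlas (𝓡 n) ∞ M, ∀ x ∈ e.target, ∀ i : Fin n,
    covDerivDensity (D.christoffel e) (2 / (n : ℝ))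
        (weightedScalar (D.christoffel e) (h.normalized e)) x i
      + n * ∑ p, ∑ q, (h.normalized e x)⁻¹ p q *
          covDerivTwoTensor (D.christoffel e) 0 (faraday (D.christoffel e)) x q i p = 0

/-- The AH structure is Einstein: its aligned representative satisfies the naive Einstein equations
and the conservation condition. -/
def AHStructure.IsEinstein (A : AHStructure n M) : Prop :=
  ∃ (D : TorsionFreeConnection n M) (h : PseudoMetric n M),
    D.projClass = A.proj ∧ h.confClass = A.conf ∧ IsAligned D h ∧
      NaiveEinsteinEquations D h ∧ ConservationEquation D h

/-- The AH structure is projectively flat: around every point there is a chart in which `∇ ∈ [∇]`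
is projectively equivalent to the standard flat connection of `ℝⁿ`, that is
`Γᵢⱼᵏ = σᵢ δⱼᵏ + σⱼ δᵢᵏ` for some one-form `σ`. -/
def AHStructure.IsProjectivelyFlat (A : AHStructure n M) : Prop :=
  ∃ D : TorsionFreeConnection n M, D.projClass = A.proj ∧
    ∀ p : M, ∃ e ∈ IsManifold.maximalAtlas (𝓡 n) ∞ M, p ∈ e.source ∧
      ∃ σ : EuclideanSpace ℝ (Fin n) → Fin n → ℝ, ∀ x ∈ e.target, ∀ i j k : Fin n,
        D.christoffel e x i j k = (if j = k then σ x i else 0) + (if i = k then σ x j else 0)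

end AH

/-! ### Hypersurface immersions in flat affine space

The flat affine space is a finite dimensional real vector space `V` with its standard connection;
the norm of `V` serves only to make sense of differentiation. -/

section Hypersurfaces

variable {n : ℕ} {M : Type*} [TopologicalSpace M]
  [ChartedSpace (EuclideanSpace ℝ (Fin n)) M]
  {V : Type*} [NormedAddCommGroup V] [NormedSpace ℝ V]

/-- The image `Ti(Y)` of a vector field `Y`, as a function with values in `V`. -/
def pushField (i : M → V) (Y : ∀ p : M, TangentSpace (𝓡 n) p) : M → V :=
  fun p ↦ mfderiv (𝓡 n) 𝓘(ℝ, V) i p (Y p)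

/-- The subspace `Ti(T_p M)` of `V`. -/
def tangentImage (n : ℕ) {M : Type*} [TopologicalSpace M]
    [ChartedSpace (EuclideanSpace ℝ (Fin n)) M]
    {V : Type*} [NormedAddCommGroup V] [NormedSpace ℝ V] (i : M → V) (p : M) : Submodule ℝ V :=
  LinearMap.range (mfderiv (𝓡 n) 𝓘(ℝ, V) i p).toLinearMap

/-- The derivative in the flat space `V`, in the direction of `X ∈ T_p M`, of a function on `M`
with values in `V`. -/
def flatDeriv (u : M → V) (p : M) (X : TangentSpace (𝓡 n) p) : V :=
  mfderiv (𝓡 n) 𝓘(ℝ, V) u p X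

/-- A smooth immersion of the `n`-manifold `M` as a hypersurface in the flat affine space `V`. -/
structure IsHypersurfaceImmersion (n : ℕ) {M : Type*} [TopologicalSpace M]
    [ChartedSpace (EuclideanSpace ℝ (Fin n)) M]
    {V : Type*} [NormedAddCommGroup V] [NormedSpace ℝ V] (i : M → V) : Prop where
  finrank_eq : Module.finrank ℝ V = n + 1
  smooth : ContMDiff (𝓡 n) 𝓘(ℝ, V) ∞ i
  injective : ∀ p : M, Function.Injective (mfderiv (𝓡 n) 𝓘(ℝ, V) i p)

/-- The second fundamental form `Π(X, Y)`, the class of the derivative of `Ti(Y)` in the direction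
of `X` in the normal space `V / Ti(T_p M)`. -/
def secondFundamentalForm (i : M → V) (p : M) (X : TangentSpace (𝓡 n) p)
    (Y : ∀ p : M, TangentSpace (𝓡 n) p) : V ⧸ tangentImage n i p :=
  Submodule.Quotient.mk (flatDeriv (pushField i Y) p X)

/-- The immersion is non-degenerate: its second fundamental form is non-degenerate. -/
def IsNondegenerate (n : ℕ) {M : Type*} [TopologicalSpace M]
    [ChartedSpace (EuclideanSpace ℝ (Fin n)) M] [IsManifold (𝓡 n) ∞ M]
    {V : Type*} [NormedAddCommGroup V] [NormedSpace ℝ V] (i : M → V) : Prop :=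
  ∀ (p : M) (X : TangentSpace (𝓡 n) p),
    (∀ Y : ∀ p : M, TangentSpace (𝓡 n) p, IsDifferentiableAt Y p →
      secondFundamentalForm i p X Y = 0) → X = 0

/-- A co-orientation of a hypersurface immersion, that is an orientation of its normal line bundle
`V / Ti(TM)`, given by a smooth field of linear forms vanishing exactly on the tangent spaces.
The positive normal directions are those on which the form is positive. -/
structure Coorientation (n : ℕ) {M : Type*} [TopologicalSpace M]
    [ChartedSpace (EuclideanSpace ℝ (Fin n)) M]
    {V : Type*} [NormedAddCommGroup V] [NormedSpace ℝ V] (i : M → V) where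
  conormal : M → V →L[ℝ] ℝ
  smooth : ContMDiff (𝓡 n) 𝓘(ℝ, V →L[ℝ] ℝ) ∞ conormal
  ker_eq : ∀ p : M, LinearMap.ker (conormal p).toLinearMap = tangentImage n i p

/-- A smooth transverse vector field along the immersion. -/
def IsTransversal (n : ℕ) {M : Type*} [TopologicalSpace M]
    [ChartedSpace (EuclideanSpace ℝ (Fin n)) M]
    {V : Type*} [NormedAddCommGroup V] [NormedSpace ℝ V] (i ξ : M → V) : Prop :=
  ContMDiff (𝓡 n) 𝓘(ℝ, V) ∞ ξ ∧ ∀ p : M, ξ p ∉ tangentImage n i p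

variable [IsManifold (𝓡 n) ∞ M]

/-- The transversal `ξ` induces the connection `∇` and the metric `h` on `M`: the derivative of
`Ti(Y)` in the direction of `X` is `Ti(∇_X Y) + h(X, Y) ξ`. -/
def Induces (i ξ : M → V) (D : TorsionFreeConnection n M) (h : PseudoMetric n M) : Prop :=
  IsTransversal n i ξ ∧
    ∀ (Y : ∀ p : M, TangentSpace (𝓡 n) p) (p : M), IsDifferentiableAt Y p →
      ∀ X : TangentSpace (𝓡 n) p,
        flatDeriv (pushField i Y) p X =
          flatDeriv i p (D.conn Y p X) + h.val p X (Y p) • ξ p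

/-- `W` is the affine normal bundle of the (co-orientable) immersion `i`: the transverse line
bundle spanned by a transversal for which the induced connection is aligned with respect to the
induced metric. -/
def IsAffineNormalBundle (n : ℕ) {M : Type*} [TopologicalSpace M]
    [ChartedSpace (EuclideanSpace ℝ (Fin n)) M] [IsManifold (𝓡 n) ∞ M]
    {V : Type*} [NormedAddCommGroup V] [NormedSpace ℝ V]
    (i : M → V) (W : M → Submodule ℝ V) : Prop :=
  ∃ (ξ : M → V) (D : TorsionFreeConnection n M) (h : PseudoMetric n M),
    Induces i ξ D h ∧ IsAligned D h ∧ ∀ p, W p = Submodule.span ℝ {ξ p}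

/-- The hypersurface is an affine hypersphere: its affine normal lines `i(p) + W_p` all pass
through a common point (proper), or they are all parallel (improper). -/
def IsAffineHypersphere (n : ℕ) {M : Type*} [TopologicalSpace M]
    [ChartedSpace (EuclideanSpace ℝ (Fin n)) M] [IsManifold (𝓡 n) ∞ M]
    {V : Type*} [NormedAddCommGroup V] [NormedSpace ℝ V] (i : M → V) : Prop :=
  ∃ W : M → Submodule ℝ V, IsAffineNormalBundle n i W ∧
    ((∃ c : V, ∀ p, c ∈ AffineSubspace.mk' (i p) (W p)) ∨ ∀ p q, W p = W q)

/-- `A` is the AH structure `([∇], [h])` induced via the affine normal: `∇` is the connection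
induced by the affine normal bundle, and `[h]` is the conformal class of the second fundamental
form determined by the co-orientation. -/
def IsInducedAHStructure (i : M → V) (ν : Coorientation n i) (A : AHStructure n M) : Prop :=
  ∃ (ξ : M → V) (D : TorsionFreeConnection n M) (h : PseudoMetric n M),
    Induces i ξ D h ∧ (∀ p, 0 < ν.conormal p (ξ p)) ∧ IsAligned D h ∧
      D.projClass = A.proj ∧ h.confClass = A.conf

end Hypersurfaces

end AHGeometry

end

/-!
The argument is organized around a conormal field `ϑ` of the hypersurface: a smooth family of linear
forms on `V` with kernel the tangent space, positive for the co-orientation. A transversal `ξ` with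
`ϑ(ξ) = 1` induces the metric `h(X, Y) = -(d_X ϑ)(Ti(Y))`, which does not depend on `ξ`. Within its
co-orientation `ϑ` can be rescaled, by a unique positive function, so that
`det(∂₁f, …, ∂ₙf, v)⁴ = (det h)²` whenever `ϑ(v) = 1`
(`Coorientation.exists_isNormalized`); this says that the volume induced from `V` is the volume of
`h`. Taking logarithmic derivatives, and using the trace of the Codazzi equation, one finds that for
such a `ϑ` the structures induced by a transversal `ξ` are aligned if and only if `(dϑ)(ξ) = 0`
(`isAligned_iff_mvfderiv_conormal`). Non-degeneracy makes the linear system `ϑ(ζ) = 1`,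
`(dϑ)(ζ) = 0` uniquely solvable, so the affine normal bundle exists and is spanned by `ζ`
(`exists_isAffineNormalData`, `eq_smul_of_isAligned`). Since proportional transversals induce the
same connection and proportional metrics, and the Codazzi equation is the vanishing of
`∇_[i H_j]k`, there is exactly one induced AH structure.

The transversal `ζ` is equiaffine, `dζ = -S di`, and each of the three conditions is equivalent to
the shape operator `S` being a multiple of the identity at every point (`IsUmbilic`).

* If all affine normal lines pass through one point or are parallel, then `a - ε i = g ζ` with
  constants `a` and `ε`, and differentiation gives `g S = ε`. Conversely, if `S = s • 1`, then `s`
  is constant by the Codazzi equation and connectedness, hence so is `ζ + s i`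
  (`IsAffineNormalData.exists_eq_const_of_isUmbilic`), and the affine normals are concurrent or
  parallel according to whether `s ≠ 0` or `s = 0`.
* The aligned representative of a projective structure is unique (`christoffel_eq_of_isAligned`),
  so the Einstein condition concerns the induced connection. By the Gauss equation
  `Ric = (tr S) h - S h` and `Q = (n - 1) S h`, with `S h` symmetric, and the Faraday form is zero.
  So the trace-free conditions say that `S = s • 1`, and the conservation law then says that `s` is
  constant.
* If the induced connection is projectively flat, two traces of the Gauss equation yield
  `n (n - 2) S = c • 1`, and this is where `n > 2` enters
  (`GaussWeingarten.exists_shape_eq_of_projectivelyFlat`). Conversely, if `ζ + s i` is constant,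
  then the projection along the affine normals to the tangent space at `p₀`, which is central or
  parallel, namely `T(i - i(p₀)) / ϑ_{p₀}(ζ)` with `T` the linear projection along `ζ(p₀)`,
  is a chart near `p₀` in which the induced connection is projectively flat
  (`IsAffineNormalData.isProjectivelyFlat_of_eq_const`).

The local computations are made for the structure equations in coordinates, `GaussWeingarten`.
-/

noncomputable section

namespace AHGeometry

/-! ### Determinants depending on a parameter -/

section Determinant

variable {ι : Type*} [Fintype ι] [DecidableEq ι]
  {E : Type*} [NormedAddCommGroup E] [NormedSpace ℝ E]

/-- Jacobi's formula for the derivative of a determinant. -/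
theorem hasFDerivAt_det {A : E → Matrix ι ι ℝ} {A' : ι → ι → E →L[ℝ] ℝ} {x : E}
    (hA : ∀ p q, HasFDerivAt (fun y ↦ A y p q) (A' p q) x) :
    HasFDerivAt (fun y ↦ (A y).det) (∑ p, ∑ q, (A x).adjugate p q • A' q p) x := by
  have h1 : HasFDerivAt (fun y ↦ ∑ σ : Equiv.Perm ι, (Equiv.Perm.sign σ : ℝ) *
      ∏ k, A y (σ k) k)
      (∑ σ : Equiv.Perm ι, (Equiv.Perm.sign σ : ℝ) •
        ∑ j, (∏ k ∈ Finset.univ.erase j, A x (σ k) k) • A' (σ j) j) x := by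
    refine HasFDerivAt.fun_sum fun σ _ ↦ HasFDerivAt.const_mul ?_ _
    exact HasFDerivAt.finsetProd fun k _ ↦ hA (σ k) k
  have h2 : (fun y ↦ (A y).det) = fun y ↦ ∑ σ : Equiv.Perm ι, (Equiv.Perm.sign σ : ℝ) *
      ∏ k, A y (σ k) k := by
    funext y
    rw [Matrix.det_apply']
  rw [h2]
  refine h1.congr_fderiv ?_
  ext v
  have h3 : ∀ j, ∑ q, (A x).adjugate j q * A' q j v =
      ∑ σ : Equiv.Perm ι, (Equiv.Perm.sign σ : ℝ) *
        ((∏ k ∈ Finset.univ.erase j, A x (σ k) k) * A' (σ j) j v) := by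
    intro j
    have : ∑ q, (A x).adjugate j q * A' q j v = ((A x).updateCol j fun q ↦ A' q j v).det := by
      rw [← Matrix.cramer_apply, Matrix.cramer_eq_adjugate_mulVec]
      rfl
    rw [this, Matrix.det_apply']
    refine Finset.sum_congr rfl fun σ _ ↦ ?_
    rw [← Finset.prod_erase_mul _ _ (Finset.mem_univ j)]
    simp only [Matrix.updateCol_self]
    congr 2
    refine Finset.prod_congr rfl fun k hk ↦ ?_
    rw [Matrix.updateCol_ne (Finset.ne_of_mem_erase hk)]
  simp only [sum_apply, smul_apply, smul_eq_mul,
    Finset.mul_sum, h3]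
  exact Finset.sum_comm

/-- Jacobi's formula, divided by the determinant. -/
theorem fderiv_det_apply {A : E → Matrix ι ι ℝ} {x : E}
    (hA : ∀ p q, DifferentiableAt ℝ (fun y ↦ A y p q) x) (hdet : (A x).det ≠ 0) (v : E) :
    fderiv ℝ (fun y ↦ (A y).det) x v =
      (A x).det * ∑ p, ∑ q, (A x)⁻¹ p q * fderiv ℝ (fun y ↦ A y q p) x v := by
  rw [(hasFDerivAt_det fun p q ↦ (hA p q).hasFDerivAt).fderiv]
  have : ∀ p q, (A x).adjugate p q = (A x).det * (A x)⁻¹ p q := by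
    intro p q
    rw [Matrix.inv_def, Matrix.smul_apply, Ring.inverse_eq_inv', smul_eq_mul,
      mul_inv_cancel_left₀ hdet]
  simp [this, Finset.mul_sum, mul_assoc]

theorem contDiffOn_det {A : E → Matrix ι ι ℝ} {U : Set E} {m : ℕ∞ω}
    (hA : ∀ p q, ContDiffOn ℝ m (fun y ↦ A y p q) U) :
    ContDiffOn ℝ m (fun y ↦ (A y).det) U := by
  simp only [Matrix.det_apply']
  exact ContDiffOn.sum fun σ _ ↦ contDiffOn_const.mul (contDiffOn_prod fun k _ ↦ hA (σ k) k)

/-- By Cramer's rule, the entries of the inverse of a smooth matrix are smooth. -/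
theorem contDiffOn_matrix_inv {A : E → Matrix ι ι ℝ} {U : Set E} {m : ℕ∞ω}
    (hA : ∀ p q, ContDiffOn ℝ m (fun y ↦ A y p q) U) (hdet : ∀ x ∈ U, (A x).det ≠ 0) (p q : ι) :
    ContDiffOn ℝ m (fun y ↦ (A y)⁻¹ p q) U := by
  have h : ∀ y, (A y)⁻¹ p q = (A y).det⁻¹ * ((A y).updateRow q (Pi.single p 1)).det := by
    intro y
    rw [Matrix.inv_def, Matrix.smul_apply, Ring.inverse_eq_inv', smul_eq_mul,
      Matrix.adjugate_apply]
  simp only [h]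
  refine ((contDiffOn_det hA).inv hdet).mul (contDiffOn_det fun a b ↦ ?_)
  by_cases haq : a = q
  · subst haq
    simpa using contDiffOn_const
  · simpa [Matrix.updateRow_ne haq] using hA a b

end Determinant

/-! ### Directional derivatives along the coordinate axes -/

section PartialDerivatives

variable {n : ℕ} {F : Type*} [NormedAddCommGroup F] [NormedSpace ℝ F]

/-- The partial derivative `∂ᵢ f` at `x` of a function with values in a normed space. -/
def pd (i : Fin n) (f : EuclideanSpace ℝ (Fin n) → F) (x : EuclideanSpace ℝ (Fin n)) : F :=
  fderiv ℝ f x (EuclideanSpace.single i 1)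

theorem partialDeriv_eq_pd (i : Fin n) (f : EuclideanSpace ℝ (Fin n) → ℝ) :
    partialDeriv i f = pd i f := rfl

theorem fderiv_apply_eq_sum_pd (f : EuclideanSpace ℝ (Fin n) → F) (x v : EuclideanSpace ℝ (Fin n)) :
    fderiv ℝ f x v = ∑ k, v k • pd k f x := by
  conv_lhs => rw [← (EuclideanSpace.basisFun (Fin n) ℝ).sum_repr v]
  simp [pd, map_sum, map_smul]

variable {U : Set (EuclideanSpace ℝ (Fin n))} {f g : EuclideanSpace ℝ (Fin n) → F}
  {x : EuclideanSpace ℝ (Fin n)}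

theorem pd_congr (hU : IsOpen U) (h : ∀ y ∈ U, f y = g y) (hx : x ∈ U) (i : Fin n) :
    pd i f x = pd i g x := by
  have : f =ᶠ[nhds x] g := Filter.eventually_of_mem (hU.mem_nhds hx) h
  rw [pd, pd, this.fderiv_eq]

theorem pd_add (hf : DifferentiableAt ℝ f x) (hg : DifferentiableAt ℝ g x) (i : Fin n) :
    pd i (fun y ↦ f y + g y) x = pd i f x + pd i g x := by
  simp [pd, fderiv_fun_add hf hg]

theorem pd_sub (hf : DifferentiableAt ℝ f x) (hg : DifferentiableAt ℝ g x) (i : Fin n) :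
    pd i (fun y ↦ f y - g y) x = pd i f x - pd i g x := by
  simp [pd, fderiv_fun_sub hf hg]

theorem pd_neg (i : Fin n) : pd i (fun y ↦ -f y) x = -pd i f x := by
  simp [pd, fderiv_fun_neg]

theorem pd_const (i : Fin n) (c : F) : pd i (fun _ ↦ c) x = 0 := by
  simp [pd]

theorem pd_sum {ι : Type*} {s : Finset ι} {f : ι → EuclideanSpace ℝ (Fin n) → F}
    (hf : ∀ a ∈ s, DifferentiableAt ℝ (f a) x) (i : Fin n) :
    pd i (fun y ↦ ∑ a ∈ s, f a y) x = ∑ a ∈ s, pd i (f a) x := by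
  simp [pd, fderiv_fun_sum hf]

theorem pd_smul {c : EuclideanSpace ℝ (Fin n) → ℝ} (hc : DifferentiableAt ℝ c x)
    (hf : DifferentiableAt ℝ f x) (i : Fin n) :
    pd i (fun y ↦ c y • f y) x = c x • pd i f x + pd i c x • f x := by
  simp [pd, fderiv_fun_smul hc hf]

theorem pd_mul {c d : EuclideanSpace ℝ (Fin n) → ℝ} (hc : DifferentiableAt ℝ c x)
    (hd : DifferentiableAt ℝ d x) (i : Fin n) :
    pd i (fun y ↦ c y * d y) x = c x * pd i d x + pd i c x * d x :=
  pd_smul hc hd i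

theorem pd_clm_comp {G : Type*} [NormedAddCommGroup G] [NormedSpace ℝ G] (L : F →L[ℝ] G)
    (hf : DifferentiableAt ℝ f x) (i : Fin n) :
    pd i (fun y ↦ L (f y)) x = L (pd i f x) := by
  have := (L.hasFDerivAt (x := f x)).comp x hf.hasFDerivAt
  rw [pd, show (fun y ↦ L (f y)) = L ∘ f from rfl, this.fderiv]
  rfl

theorem pd_clm_apply {G : Type*} [NormedAddCommGroup G] [NormedSpace ℝ G]
    {c : EuclideanSpace ℝ (Fin n) → F →L[ℝ] G} (hc : DifferentiableAt ℝ c x)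
    (hf : DifferentiableAt ℝ f x) (i : Fin n) :
    pd i (fun y ↦ c y (f y)) x = c x (pd i f x) + pd i c x (f x) := by
  simp [pd, fderiv_clm_apply hc hf]

theorem contDiffOn_pd (hf : ContDiffOn ℝ ∞ f U) (hU : IsOpen U) (i : Fin n) :
    ContDiffOn ℝ ∞ (pd i f) U :=
  (hf.fderiv_of_isOpen hU (by simp)).clm_apply contDiffOn_const

theorem differentiableAt_of_contDiffOn (hf : ContDiffOn ℝ ∞ f U) (hU : IsOpen U) (hx : x ∈ U) :
    DifferentiableAt ℝ f x :=
  (hf.contDiffAt (hU.mem_nhds hx)).differentiableAt (by simp)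

theorem pd_comm (hf : ContDiffOn ℝ ∞ f U) (hU : IsOpen U) (hx : x ∈ U) (i j : Fin n) :
    pd i (pd j f) x = pd j (pd i f) x := by
  have h1 : ContDiffAt ℝ ∞ f x := hf.contDiffAt (hU.mem_nhds hx)
  have h2 : DifferentiableAt ℝ (fderiv ℝ f) x :=
    differentiableAt_of_contDiffOn (hf.fderiv_of_isOpen hU (by simp)) hU hx
  have h3 : ∀ i j : Fin n, pd i (pd j f) x =
      fderiv ℝ (fderiv ℝ f) x (EuclideanSpace.single i 1) (EuclideanSpace.single j 1) := by
    intro i j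
    change fderiv ℝ (fun y ↦ fderiv ℝ f y (EuclideanSpace.single j 1)) x _ = _
    rw [fderiv_clm_apply h2 (differentiableAt_const _)]
    simp
  rw [h3, h3]
  exact (h1.isSymmSndFDerivAt (by
    simp only [minSmoothness_of_isRCLikeNormedField]
    exact WithTop.coe_le_coe.2 (le_top : (2 : ℕ∞) ≤ ⊤))).eq _ _

end PartialDerivatives

/-! ### Frames adapted to a parametrized hypersurface -/

section AdaptedFrame

variable {n : ℕ} {V : Type*} [NormedAddCommGroup V] [NormedSpace ℝ V]

/-- `f` is a smooth parametrization, on the open set `U`, of a hypersurface of `V`, and `ξ` is a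
smooth transversal: the vectors `∂₁f, …, ∂ₙf, ξ` form a frame of `V` at every point of `U`. -/
structure IsAdaptedFrame (U : Set (EuclideanSpace ℝ (Fin n)))
    (f ξ : EuclideanSpace ℝ (Fin n) → V) : Prop where
  isOpen : IsOpen U
  finrank_eq : Module.finrank ℝ V = n + 1
  contDiffOn_map : ContDiffOn ℝ ∞ f U
  contDiffOn_transversal : ContDiffOn ℝ ∞ ξ U
  indep : ∀ x ∈ U, ∀ (c : Fin n → ℝ) (t : ℝ),
    ∑ k, c k • pd k f x + t • ξ x = 0 → c = 0 ∧ t = 0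

/-- The vectors `∂₁f, …, ∂ₙf, ξ` at the point `x`. -/
def frameVec (f ξ : EuclideanSpace ℝ (Fin n) → V) (x : EuclideanSpace ℝ (Fin n)) :
    Fin n ⊕ Unit → V :=
  Sum.elim (fun k ↦ pd k f x) (fun _ ↦ ξ x)

theorem exists_basis_of_finrank_eq (hV : Module.finrank ℝ V = n + 1) :
    Nonempty (Module.Basis (Fin n ⊕ Unit) ℝ V) := by
  have : FiniteDimensional ℝ V := Module.finite_of_finrank_pos (by omega)
  exact ⟨(Module.finBasisOfFinrankEq ℝ V hV).reindex
    (finSumFinEquiv.symm.trans (Equiv.sumCongr (Equiv.refl _) (Equiv.equivPUnit _)))⟩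

theorem det_toMatrix_ne_zero (hV : Module.finrank ℝ V = n + 1)
    (b : Module.Basis (Fin n ⊕ Unit) ℝ V) {v : Fin n → V} {w : V}
    (h : ∀ (c : Fin n → ℝ) (t : ℝ), ∑ k, c k • v k + t • w = 0 → c = 0 ∧ t = 0) :
    (b.toMatrix (Sum.elim v (fun _ ↦ w))).det ≠ 0 := by
  have hli : LinearIndependent ℝ (Sum.elim v (fun _ : Unit ↦ w)) := by
    rw [Fintype.linearIndependent_iff]
    intro g hg
    rw [Fintype.sum_sum_type] at hg
    simp only [Sum.elim_inl, Sum.elim_inr, Finset.univ_unique, Finset.sum_singleton] at hg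
    obtain ⟨h1, h2⟩ := h (fun k ↦ g (Sum.inl k)) _ hg
    rintro (k | k)
    · exact congrFun h1 k
    · exact h2
  have : FiniteDimensional ℝ V := Module.finite_of_finrank_pos (by omega)
  have hspan := hli.span_eq_top_of_card_eq_finrank' (by simp [hV])
  have := (Module.Basis.is_basis_iff_det b).1 ⟨hli, hspan⟩
  rw [Module.Basis.det_apply] at this
  exact this.ne_zero

namespace IsAdaptedFrame

variable {U : Set (EuclideanSpace ℝ (Fin n))} {f ξ : EuclideanSpace ℝ (Fin n) → V}

theorem det_ne_zero (H : IsAdaptedFrame U f ξ) (b : Module.Basis (Fin n ⊕ Unit) ℝ V)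
    {x : EuclideanSpace ℝ (Fin n)} (hx : x ∈ U) : (b.toMatrix (frameVec f ξ x)).det ≠ 0 :=
  det_toMatrix_ne_zero H.finrank_eq b (H.indep x hx)

theorem contDiffOn_toMatrix (H : IsAdaptedFrame U f ξ) (b : Module.Basis (Fin n ⊕ Unit) ℝ V)
    (p q : Fin n ⊕ Unit) : ContDiffOn ℝ ∞ (fun x ↦ b.toMatrix (frameVec f ξ x) p q) U := by
  have : FiniteDimensional ℝ V := b.finiteDimensional_of_finite
  have hL : ContDiff ℝ ∞ (b.coord p) := (LinearMap.toContinuousLinearMap (b.coord p)).contDiff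
  rcases q with k | u
  · exact hL.comp_contDiffOn (contDiffOn_pd H.contDiffOn_map H.isOpen k)
  · exact hL.comp_contDiffOn H.contDiffOn_transversal

theorem coeff_ext (H : IsAdaptedFrame U f ξ) {x : EuclideanSpace ℝ (Fin n)} (hx : x ∈ U)
    {c c' : Fin n → ℝ} {t t' : ℝ}
    (h : ∑ k, c k • pd k f x + t • ξ x = ∑ k, c' k • pd k f x + t' • ξ x) : c = c' ∧ t = t' := by
  obtain ⟨h1, h2⟩ := H.indep x hx (c - c') (t - t') (by
    simp only [Pi.sub_apply, sub_smul, Finset.sum_sub_distrib]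
    rw [← sub_eq_zero] at h
    rw [← h]
    abel)
  exact ⟨sub_eq_zero.1 h1, sub_eq_zero.1 h2⟩

/-- The coefficients of a smooth map with respect to a smooth frame are smooth, by Cramer's rule. -/
theorem exists_coeff (H : IsAdaptedFrame U f ξ) {v : EuclideanSpace ℝ (Fin n) → V}
    (hv : ContDiffOn ℝ ∞ v U) :
    ∃ (c : EuclideanSpace ℝ (Fin n) → Fin n → ℝ) (t : EuclideanSpace ℝ (Fin n) → ℝ),
      (∀ k, ContDiffOn ℝ ∞ (fun x ↦ c x k) U) ∧ ContDiffOn ℝ ∞ t U ∧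
        ∀ x ∈ U, v x = ∑ k, c x k • pd k f x + t x • ξ x := by
  obtain ⟨b⟩ := exists_basis_of_finrank_eq H.finrank_eq
  have : FiniteDimensional ℝ V := b.finiteDimensional_of_finite
  set a : EuclideanSpace ℝ (Fin n) → Fin n ⊕ Unit → ℝ := fun x ↦
    Matrix.mulVec (b.toMatrix (frameVec f ξ x))⁻¹ (fun p ↦ b.coord p (v x)) with ha
  have hsmooth : ∀ p, ContDiffOn ℝ ∞ (fun x ↦ a x p) U := by
    intro p
    change ContDiffOn ℝ ∞ (fun x ↦ ∑ q, (b.toMatrix (frameVec f ξ x))⁻¹ p q * b.coord q (v x)) U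
    refine ContDiffOn.sum fun q _ ↦ ?_
    refine (contDiffOn_matrix_inv (H.contDiffOn_toMatrix b) (fun x hx ↦ H.det_ne_zero b hx)
      p q).mul ?_
    exact (LinearMap.toContinuousLinearMap (b.coord q)).contDiff.comp_contDiffOn hv
  refine ⟨fun x k ↦ a x (Sum.inl k), fun x ↦ a x (Sum.inr ()), fun k ↦ hsmooth _, hsmooth _, ?_⟩
  intro x hx
  have h1 : ∑ p, a x p • frameVec f ξ x p = v x := by
    refine b.ext_elem fun q ↦ ?_
    have h2 : Matrix.mulVec (b.toMatrix (frameVec f ξ x)) (a x) = fun p ↦ b.coord p (v x) := by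
      rw [ha, Matrix.mulVec_mulVec, Matrix.mul_nonsing_inv _ (H.det_ne_zero b hx).isUnit,
        Matrix.one_mulVec]
    have h3 := congrFun h2 q
    rw [map_sum, Finsupp.coe_finsetSum, Finset.sum_apply]
    rw [Module.Basis.coord_apply] at h3
    rw [← h3]
    simp [Matrix.mulVec, dotProduct, Module.Basis.toMatrix_apply, mul_comm]
  rw [← h1, Fintype.sum_sum_type]
  simp [frameVec]

theorem contDiffOn_coeff (H : IsAdaptedFrame U f ξ) {v : EuclideanSpace ℝ (Fin n) → V}
    (hv : ContDiffOn ℝ ∞ v U) {c : EuclideanSpace ℝ (Fin n) → Fin n → ℝ}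
    {t : EuclideanSpace ℝ (Fin n) → ℝ}
    (h : ∀ x ∈ U, v x = ∑ k, c x k • pd k f x + t x • ξ x) :
    (∀ k, ContDiffOn ℝ ∞ (fun x ↦ c x k) U) ∧ ContDiffOn ℝ ∞ t U := by
  obtain ⟨c', t', hc', ht', h'⟩ := H.exists_coeff hv
  have : ∀ x ∈ U, c x = c' x ∧ t x = t' x := fun x hx ↦
    H.coeff_ext hx ((h x hx).symm.trans (h' x hx))
  exact ⟨fun k ↦ (hc' k).congr fun x hx ↦ congrFun (this x hx).1 k,
    ht'.congr fun x hx ↦ (this x hx).2⟩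

end IsAdaptedFrame

/-- The structure equations of a hypersurface with a transversal `ξ`, in coordinates:
`∂ᵢ∂ⱼf = Γᵢⱼᵏ ∂ₖf + hᵢⱼ ξ` and `∂ᵢξ = -Sᵢᵏ ∂ₖf + τᵢ ξ`. -/
structure GaussWeingarten (U : Set (EuclideanSpace ℝ (Fin n)))
    (f ξ : EuclideanSpace ℝ (Fin n) → V)
    (Γ : EuclideanSpace ℝ (Fin n) → Fin n → Fin n → Fin n → ℝ)
    (h S : EuclideanSpace ℝ (Fin n) → Matrix (Fin n) (Fin n) ℝ)
    (τ : EuclideanSpace ℝ (Fin n) → Fin n → ℝ) : Prop extends IsAdaptedFrame U f ξ where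
  gauss : ∀ x ∈ U, ∀ i j,
    pd i (pd j f) x = ∑ k, Γ x i j k • pd k f x + h x i j • ξ x
  weingarten : ∀ x ∈ U, ∀ i, pd i ξ x = ∑ k, (-S x i k) • pd k f x + τ x i • ξ x
  det_ne_zero : ∀ x ∈ U, (h x).det ≠ 0

namespace GaussWeingarten

variable {U : Set (EuclideanSpace ℝ (Fin n))} {f ξ : EuclideanSpace ℝ (Fin n) → V}
  {Γ : EuclideanSpace ℝ (Fin n) → Fin n → Fin n → Fin n → ℝ}
  {h S : EuclideanSpace ℝ (Fin n) → Matrix (Fin n) (Fin n) ℝ}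
  {τ : EuclideanSpace ℝ (Fin n) → Fin n → ℝ} {x : EuclideanSpace ℝ (Fin n)}

theorem contDiffOn_christoffel (H : GaussWeingarten U f ξ Γ h S τ) (i j k : Fin n) :
    ContDiffOn ℝ ∞ (fun x ↦ Γ x i j k) U :=
  (H.contDiffOn_coeff (contDiffOn_pd (contDiffOn_pd H.contDiffOn_map H.isOpen j) H.isOpen i)
    fun x hx ↦ H.gauss x hx i j).1 k

theorem contDiffOn_metric (H : GaussWeingarten U f ξ Γ h S τ) (i j : Fin n) :
    ContDiffOn ℝ ∞ (fun x ↦ h x i j) U :=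
  (H.contDiffOn_coeff (contDiffOn_pd (contDiffOn_pd H.contDiffOn_map H.isOpen j) H.isOpen i)
    fun x hx ↦ H.gauss x hx i j).2

theorem contDiffOn_shape (H : GaussWeingarten U f ξ Γ h S τ) (i k : Fin n) :
    ContDiffOn ℝ ∞ (fun x ↦ S x i k) U := by
  have := (H.contDiffOn_coeff (contDiffOn_pd H.contDiffOn_transversal H.isOpen i)
    fun x hx ↦ H.weingarten x hx i).1 k
  simpa using this.neg

theorem contDiffOn_tau (H : GaussWeingarten U f ξ Γ h S τ) (i : Fin n) :
    ContDiffOn ℝ ∞ (fun x ↦ τ x i) U :=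
  (H.contDiffOn_coeff (contDiffOn_pd H.contDiffOn_transversal H.isOpen i)
    fun x hx ↦ H.weingarten x hx i).2

theorem christoffel_symm (H : GaussWeingarten U f ξ Γ h S τ) (hx : x ∈ U) (i j k : Fin n) :
    Γ x i j k = Γ x j i k := by
  have := pd_comm H.contDiffOn_map H.isOpen hx i j
  rw [H.gauss x hx, H.gauss x hx] at this
  exact congrFun (H.coeff_ext hx this).1 k

theorem metric_symm (H : GaussWeingarten U f ξ Γ h S τ) (hx : x ∈ U) (i j : Fin n) :
    h x i j = h x j i := by
  have := pd_comm H.contDiffOn_map H.isOpen hx i j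
  rw [H.gauss x hx, H.gauss x hx] at this
  exact (H.coeff_ext hx this).2

/-- The derivative of a vector field given by its coefficients in the frame. -/
theorem pd_comb (H : GaussWeingarten U f ξ Γ h S τ) (hx : x ∈ U)
    {c : EuclideanSpace ℝ (Fin n) → Fin n → ℝ} {t : EuclideanSpace ℝ (Fin n) → ℝ}
    (hc : ∀ k, ContDiffOn ℝ ∞ (fun x ↦ c x k) U) (ht : ContDiffOn ℝ ∞ t U) (i : Fin n) :
    pd i (fun y ↦ ∑ l, c y l • pd l f y + t y • ξ y) x =
      ∑ l, (pd i (fun y ↦ c y l) x + ∑ m, c x m * Γ x i m l - t x * S x i l) • pd l f x +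
        (pd i t x + ∑ m, c x m * h x i m + t x * τ x i) • ξ x := by
  have hc' := fun k ↦ differentiableAt_of_contDiffOn (hc k) H.isOpen hx
  have ht' := differentiableAt_of_contDiffOn ht H.isOpen hx
  have hf' := fun k ↦ differentiableAt_of_contDiffOn
    (contDiffOn_pd H.contDiffOn_map H.isOpen k) H.isOpen hx
  have hξ' := differentiableAt_of_contDiffOn H.contDiffOn_transversal H.isOpen hx
  rw [pd_add (DifferentiableAt.fun_sum fun k _ ↦ (hc' k).fun_smul (hf' k)) (ht'.fun_smul hξ'),
    pd_sum (fun k _ ↦ (hc' k).fun_smul (hf' k)), pd_smul ht' hξ', H.weingarten x hx]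
  have h1 : ∀ k, pd i (fun y ↦ c y k • pd k f y) x =
      ∑ l, (c x k * Γ x i k l) • pd l f x + (c x k * h x i k) • ξ x +
        pd i (fun y ↦ c y k) x • pd k f x := by
    intro k
    rw [pd_smul (hc' k) (hf' k), H.gauss x hx]
    simp only [smul_add, Finset.smul_sum, smul_smul]
  simp only [h1, Finset.sum_add_distrib, add_smul, sub_smul, Finset.sum_sub_distrib,
    Finset.sum_smul, smul_add, Finset.smul_sum, smul_smul, smul_neg, neg_smul,
    Finset.sum_neg_distrib]
  rw [Finset.sum_comm]
  abel

/-- Third derivatives of the parametrization commute: the Gauss equation for the curvature. -/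
theorem gauss_equation (H : GaussWeingarten U f ξ Γ h S τ) (hx : x ∈ U) (i j k l : Fin n) :
    curvature Γ x i j k l = h x j k * S x i l - h x i k * S x j l := by
  have key : ∀ i j, pd i (pd j (pd k f)) x = _ := fun i j ↦
    (pd_congr H.isOpen (fun y hy ↦ H.gauss y hy j k) hx i).trans
      (H.pd_comb hx (fun l ↦ H.contDiffOn_christoffel j k l) (H.contDiffOn_metric j k) i)
  have hsymm := pd_comm (contDiffOn_pd H.contDiffOn_map H.isOpen k) H.isOpen hx i j
  rw [key, key] at hsymm
  have := congrFun (H.coeff_ext hx hsymm).1 l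
  simp only [curvature, partialDeriv_eq_pd, Finset.sum_sub_distrib]
  simp only [mul_comm (Γ x i _ l), mul_comm (Γ x j _ l)]
  linarith

/-- Third derivatives of the parametrization commute: the Codazzi equation for the metric. -/
theorem codazzi_metric (H : GaussWeingarten U f ξ Γ h S τ) (hx : x ∈ U) (i j k : Fin n) :
    covDerivTwoTensor Γ 0 h x i j k + τ x i * h x j k =
      covDerivTwoTensor Γ 0 h x j i k + τ x j * h x i k := by
  have key : ∀ i j, pd i (pd j (pd k f)) x = _ := fun i j ↦
    (pd_congr H.isOpen (fun y hy ↦ H.gauss y hy j k) hx i).trans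
      (H.pd_comb hx (fun l ↦ H.contDiffOn_christoffel j k l) (H.contDiffOn_metric j k) i)
  have hsymm := pd_comm (contDiffOn_pd H.contDiffOn_map H.isOpen k) H.isOpen hx i j
  rw [key, key] at hsymm
  have := (H.coeff_ext hx hsymm).2
  simp only [covDerivTwoTensor, partialDeriv_eq_pd, zero_mul, sub_zero]
  simp only [H.christoffel_symm hx j i]
  linarith

/-- Second derivatives of the transversal commute: the Codazzi equation for the shape operator. -/
theorem codazzi_shape (H : GaussWeingarten U f ξ Γ h S τ) (hx : x ∈ U) (i j l : Fin n) :
    pd i (fun y ↦ S y j l) x + ∑ m, S x j m * Γ x i m l + τ x j * S x i l =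
      pd j (fun y ↦ S y i l) x + ∑ m, S x i m * Γ x j m l + τ x i * S x j l := by
  have key : ∀ i j, pd i (pd j ξ) x = _ := fun i j ↦
    (pd_congr H.isOpen (fun y hy ↦ H.weingarten y hy j) hx i).trans
      (H.pd_comb hx (fun l ↦ (H.contDiffOn_shape j l).neg) (H.contDiffOn_tau j) i)
  have hsymm := pd_comm H.contDiffOn_transversal H.isOpen hx i j
  rw [key, key] at hsymm
  have := congrFun (H.coeff_ext hx hsymm).1 l
  simp only [pd_neg, neg_mul, Finset.sum_neg_distrib] at this
  linarith

/-- Second derivatives of the transversal commute: the Ricci equation. -/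
theorem ricci_equation (H : GaussWeingarten U f ξ Γ h S τ) (hx : x ∈ U) (i j : Fin n) :
    pd i (fun y ↦ τ y j) x - ∑ m, S x j m * h x i m =
      pd j (fun y ↦ τ y i) x - ∑ m, S x i m * h x j m := by
  have key : ∀ i j, pd i (pd j ξ) x = _ := fun i j ↦
    (pd_congr H.isOpen (fun y hy ↦ H.weingarten y hy j) hx i).trans
      (H.pd_comb hx (fun l ↦ (H.contDiffOn_shape j l).neg) (H.contDiffOn_tau j) i)
  have hsymm := pd_comm H.contDiffOn_transversal H.isOpen hx i j
  rw [key, key] at hsymm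
  have := (H.coeff_ext hx hsymm).2
  simp only [neg_mul, Finset.sum_neg_distrib, mul_comm (τ x j)] at this
  linarith

end GaussWeingarten

end AdaptedFrame

/-! ### Alignment of the induced connection and metric -/

section LocalTheory

variable {n : ℕ} {V : Type*} [NormedAddCommGroup V] [NormedSpace ℝ V]

theorem pd_log {g : EuclideanSpace ℝ (Fin n) → ℝ} {x : EuclideanSpace ℝ (Fin n)}
    (hg : DifferentiableAt ℝ g x) (h0 : g x ≠ 0) (i : Fin n) :
    pd i (fun y ↦ Real.log (g y)) x = pd i g x / g x := by
  rw [pd, (hg.hasFDerivAt.log h0).fderiv, pd, smul_apply, smul_eq_mul]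
  ring

theorem hasFDerivAt_abs_rpow {g : EuclideanSpace ℝ (Fin n) → ℝ} {x : EuclideanSpace ℝ (Fin n)}
    (hg : DifferentiableAt ℝ g x) (h0 : g x ≠ 0) (a : ℝ) :
    HasFDerivAt (fun y ↦ |g y| ^ a) ((|g x| ^ a * (a / g x)) • fderiv ℝ g x) x := by
  have h1 : (fun y ↦ |g y| ^ a) =ᶠ[nhds x] fun y ↦ Real.exp (Real.log (g y) * a) := by
    filter_upwards [hg.continuousAt.eventually_ne h0] with y hy
    rw [Real.rpow_def_of_pos (abs_pos.2 hy), Real.log_abs]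
  have h2 := ((hg.hasFDerivAt.log h0).mul_const a).exp
  refine (h2.congr_of_eventuallyEq h1).congr_fderiv ?_
  rw [← h1.eq_of_nhds, smul_smul, smul_smul]
  congr 1
  ring

theorem pd_abs_rpow {g : EuclideanSpace ℝ (Fin n) → ℝ} {x : EuclideanSpace ℝ (Fin n)}
    (hg : DifferentiableAt ℝ g x) (h0 : g x ≠ 0) (a : ℝ) (i : Fin n) :
    pd i (fun y ↦ |g y| ^ a) x = |g x| ^ a * (a * (pd i g x / g x)) := by
  rw [pd, (hasFDerivAt_abs_rpow hg h0 a).fderiv, pd, smul_apply, smul_eq_mul]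
  ring

/-- Pointwise form of the alignment condition for Christoffel symbols `Γ` and a metric `h` in
coordinates. -/
def AlignedAt (Γ : EuclideanSpace ℝ (Fin n) → Fin n → Fin n → Fin n → ℝ)
    (h : EuclideanSpace ℝ (Fin n) → Matrix (Fin n) (Fin n) ℝ)
    (x : EuclideanSpace ℝ (Fin n)) : Prop :=
  ∀ i : Fin n,
    ∑ p, ∑ q, (h x)⁻¹ p q * covDerivTwoTensor Γ 0 h x i p q =
      n * ∑ p, ∑ q, (h x)⁻¹ p q * covDerivTwoTensor Γ 0 h x p q i

/-- The determinant of the frame `∂₁f, …, ∂ₙf, ξ` with respect to a fixed basis of `V`. -/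
def frameDet (b : Module.Basis (Fin n ⊕ Unit) ℝ V) (f ξ : EuclideanSpace ℝ (Fin n) → V)
    (x : EuclideanSpace ℝ (Fin n)) : ℝ :=
  (b.toMatrix (frameVec f ξ x)).det

section Matrices

variable {h : Matrix (Fin n) (Fin n) ℝ}

theorem inv_symm_of_symm (hs : ∀ i j, h i j = h j i) (i j : Fin n) : h⁻¹ i j = h⁻¹ j i := by
  have : h.transpose = h := by ext i j; exact hs j i
  conv_rhs => rw [← this, ← Matrix.transpose_nonsing_inv]
  rfl

theorem sum_inv_mul (hd : h.det ≠ 0) (i j : Fin n) :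
    ∑ q, h⁻¹ i q * h q j = if i = j then 1 else 0 := by
  have := congrFun (congrFun (Matrix.nonsing_inv_mul h hd.isUnit) i) j
  rwa [Matrix.mul_apply, Matrix.one_apply] at this

theorem sum_inv_mul_comb (hd : h.det ≠ 0) (c : Fin n → ℝ) (i : Fin n) :
    ∑ q, h⁻¹ i q * ∑ p, c p * h q p = c i := by
  simp only [Finset.mul_sum, mul_left_comm]
  rw [Finset.sum_comm]
  simp only [← Finset.mul_sum, sum_inv_mul hd]
  simp

theorem sum_sum_inv_mul (hd : h.det ≠ 0) (hs : ∀ i j, h i j = h j i)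
    (A : Matrix (Fin n) (Fin n) ℝ) :
    ∑ p, ∑ q, h⁻¹ p q * ∑ r, A p r * h r q = A.trace := by
  refine Finset.sum_congr rfl fun p _ ↦ ?_
  rw [Matrix.diag_apply, ← sum_inv_mul_comb hd (A p) p]
  exact Finset.sum_congr rfl fun q _ ↦ congrArg _ (Finset.sum_congr rfl fun r _ ↦ by rw [hs r q])

theorem sum_sum_inv_self (hd : h.det ≠ 0) (hs : ∀ i j, h i j = h j i) :
    ∑ p, ∑ q, h⁻¹ p q * h p q = n := by
  have := sum_sum_inv_mul hd hs 1
  simpa [Matrix.one_apply] using this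

end Matrices

namespace GaussWeingarten

variable {U : Set (EuclideanSpace ℝ (Fin n))} {f ξ : EuclideanSpace ℝ (Fin n) → V}
  {Γ : EuclideanSpace ℝ (Fin n) → Fin n → Fin n → Fin n → ℝ}
  {h S : EuclideanSpace ℝ (Fin n) → Matrix (Fin n) (Fin n) ℝ}
  {τ : EuclideanSpace ℝ (Fin n) → Fin n → ℝ} {x : EuclideanSpace ℝ (Fin n)}

theorem pd_det_metric (H : GaussWeingarten U f ξ Γ h S τ) (hx : x ∈ U) (i : Fin n) :
    pd i (fun y ↦ (h y).det) x =
      (h x).det * ∑ p, ∑ q, (h x)⁻¹ p q * pd i (fun y ↦ h y p q) x := by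
  rw [pd, fderiv_det_apply (fun p q ↦ differentiableAt_of_contDiffOn (H.contDiffOn_metric p q)
    H.isOpen hx) (H.det_ne_zero x hx)]
  congr 1
  refine Finset.sum_congr rfl fun p _ ↦ Finset.sum_congr rfl fun q _ ↦ ?_
  congr 1
  exact pd_congr H.isOpen (fun y hy ↦ H.metric_symm hy q p) hx i

/-- The logarithmic derivative of the determinant of the frame is the trace of the connection
matrix of the structure equations. -/
theorem pd_frameDet (H : GaussWeingarten U f ξ Γ h S τ) (b : Module.Basis (Fin n ⊕ Unit) ℝ V)
    (hx : x ∈ U) (i : Fin n) :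
    pd i (frameDet b f ξ) x = frameDet b f ξ x * (∑ p, Γ x i p p + τ x i) := by
  have hfd : FiniteDimensional ℝ V := b.finiteDimensional_of_finite
  have hdet := H.toIsAdaptedFrame.det_ne_zero b hx
  have h0 : pd i (frameDet b f ξ) x = _ := fderiv_det_apply (fun p q ↦
    differentiableAt_of_contDiffOn (H.contDiffOn_toMatrix b p q) H.isOpen hx) hdet _
  rw [h0, ← frameDet]
  congr 1
  -- the matrix of the connection in the frame
  set C : Matrix (Fin n ⊕ Unit) (Fin n ⊕ Unit) ℝ := Matrix.fromBlocks
    (Matrix.of fun k p ↦ Γ x i p k) (Matrix.of fun k _ ↦ -S x i k)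
    (Matrix.of fun _ p ↦ h x i p) (Matrix.of fun _ _ ↦ τ x i) with hC
  have h1 : ∀ p q, fderiv ℝ (fun y ↦ b.toMatrix (frameVec f ξ y) q p) x
      (EuclideanSpace.single i 1) = ∑ a, b.toMatrix (frameVec f ξ x) q a * C a p := by
    intro p q
    have hL : ∀ {v : EuclideanSpace ℝ (Fin n) → V}, DifferentiableAt ℝ v x →
        pd i (fun y ↦ b.repr (v y) q) x = b.repr (pd i v x) q := fun hv ↦
      pd_clm_comp (LinearMap.toContinuousLinearMap (b.coord q)) hv i
    rw [Fintype.sum_sum_type]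
    rcases p with p | u
    · have := hL (differentiableAt_of_contDiffOn (contDiffOn_pd H.contDiffOn_map H.isOpen p)
        H.isOpen hx)
      rw [H.gauss x hx] at this
      refine Eq.trans this ?_
      simp [hC, Module.Basis.toMatrix_apply, frameVec, mul_comm]
    · have := hL (differentiableAt_of_contDiffOn H.contDiffOn_transversal H.isOpen hx)
      rw [H.weingarten x hx] at this
      refine Eq.trans this ?_
      simp [hC, Module.Basis.toMatrix_apply, frameVec, mul_comm]
  simp only [h1]
  have h2 : ∀ p, ∑ q, (b.toMatrix (frameVec f ξ x))⁻¹ p q *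
      ∑ a, b.toMatrix (frameVec f ξ x) q a * C a p = C p p := by
    intro p
    have := congrFun (congrFun (Matrix.nonsing_inv_mul_cancel_left
      (b.toMatrix (frameVec f ξ x)) C hdet.isUnit) p) p
    simpa only [Matrix.mul_apply] using this
  rw [Finset.sum_congr rfl fun p _ ↦ h2 p, Fintype.sum_sum_type]
  simp [hC]

/-- The trace of the Codazzi equation turns alignment into a condition on one trace. -/
theorem alignedAt_iff_trace (H : GaussWeingarten U f ξ Γ h S τ) (hn : 1 < n) (hx : x ∈ U) :
    AlignedAt Γ h x ↔ ∀ i, ∑ p, ∑ q, (h x)⁻¹ p q * pd i (fun y ↦ h y p q) x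
      = 2 * ∑ p, Γ x i p p - n * τ x i := by
  have hd := H.det_ne_zero x hx
  have hs : ∀ i j, h x i j = h x j i := fun i j ↦ H.metric_symm hx i j
  refine forall_congr' fun i ↦ ?_
  have e1 : ∑ p, ∑ q, (h x)⁻¹ p q * covDerivTwoTensor Γ 0 h x i p q =
      ∑ p, ∑ q, (h x)⁻¹ p q * pd i (fun y ↦ h y p q) x - 2 * ∑ p, Γ x i p p := by
    have a1 : ∑ p, ∑ q, (h x)⁻¹ p q * ∑ r, Γ x i p r * h x r q = ∑ p, Γ x i p p :=
      sum_sum_inv_mul hd hs (Matrix.of fun p r ↦ Γ x i p r)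
    have a2 : ∑ p, ∑ q, (h x)⁻¹ p q * ∑ r, Γ x i q r * h x p r = ∑ p, Γ x i p p := by
      rw [Finset.sum_comm, ← a1]
      refine Finset.sum_congr rfl fun p _ ↦ Finset.sum_congr rfl fun q _ ↦ ?_
      rw [inv_symm_of_symm hs q p]
      simp only [hs q]
    simp only [covDerivTwoTensor, partialDeriv_eq_pd, zero_mul, sub_zero, mul_sub,
      Finset.sum_sub_distrib]
    rw [a1, a2]
    ring
  have e2 : ∑ p, ∑ q, (h x)⁻¹ p q * covDerivTwoTensor Γ 0 h x p q i =
      ∑ p, ∑ q, (h x)⁻¹ p q * covDerivTwoTensor Γ 0 h x i p q + (n - 1) * τ x i := by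
    have a1 : ∀ p q, covDerivTwoTensor Γ 0 h x p q i =
        covDerivTwoTensor Γ 0 h x i p q + τ x i * h x p q - τ x p * h x i q := by
      intro p q
      have b1 := H.codazzi_metric hx p i q
      have b2 : covDerivTwoTensor Γ 0 h x p q i = covDerivTwoTensor Γ 0 h x p i q := by
        simp only [covDerivTwoTensor, partialDeriv_eq_pd, zero_mul, sub_zero]
        rw [pd_congr H.isOpen (fun y hy ↦ H.metric_symm hy q i) hx]
        simp only [hs _ i, hs _ q]
        ring
      rw [b2]
      linarith
    have a2 : ∑ p, ∑ q, (h x)⁻¹ p q * (τ x p * h x i q) = τ x i := by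
      simp only [mul_left_comm _ (τ x _), ← Finset.mul_sum, hs i, sum_inv_mul hd]
      simp
    have a3 : ∑ p, ∑ q, (h x)⁻¹ p q * (τ x i * h x p q) = n * τ x i := by
      simp only [mul_left_comm _ (τ x _), ← Finset.mul_sum, sum_sum_inv_self hd hs]
      ring
    simp only [a1, mul_sub, mul_add, Finset.sum_sub_distrib, Finset.sum_add_distrib, a2, a3]
    ring
  rw [e2, e1]
  have hn' : (n : ℝ) - 1 ≠ 0 := by
    have : (1 : ℝ) < n := by exact_mod_cast hn
    linarith
  constructor
  · intro h1
    have : ((n : ℝ) - 1) * (∑ p, ∑ q, (h x)⁻¹ p q * pd i (fun y ↦ h y p q) x -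
        2 * ∑ p, Γ x i p p + n * τ x i) = 0 := by linarith
    have := (mul_eq_zero.1 this).resolve_left hn'
    linarith
  · intro h1
    rw [h1]
    ring

/-- Alignment says that `(n + 2) τ` is the differential of `log (W² / |det h|)`, where `W` is the
determinant of the frame. -/
theorem alignedAt_iff_log (H : GaussWeingarten U f ξ Γ h S τ)
    (b : Module.Basis (Fin n ⊕ Unit) ℝ V) (hn : 1 < n) (hx : x ∈ U) :
    AlignedAt Γ h x ↔ ∀ i, (n + 2) * τ x i =
      2 * (pd i (frameDet b f ξ) x / frameDet b f ξ x) -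
        pd i (fun y ↦ (h y).det) x / (h x).det := by
  rw [H.alignedAt_iff_trace hn hx]
  refine forall_congr' fun i ↦ ?_
  have hW : frameDet b f ξ x ≠ 0 := H.toIsAdaptedFrame.det_ne_zero b hx
  rw [H.pd_frameDet b hx, H.pd_det_metric hx, mul_div_cancel_left₀ _ hW,
    mul_div_cancel_left₀ _ (H.det_ne_zero x hx)]
  constructor <;> intro h1 <;> linarith

/-- For an aligned connection the covariant derivative of the normalized metric
`H = |det h|^(-1/n) h`, a density of weight `-2/n`, is `|det h|^(-1/n) (∇h + τ ⊗ h)`: alignment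
computes the derivative of the determinant together with the weight term. -/
theorem covDeriv_normalized (H : GaussWeingarten U f ξ Γ h S τ) (hn : 1 < n) (hx : x ∈ U)
    (ha : AlignedAt Γ h x) (i j k : Fin n) :
    covDerivTwoTensor Γ (-(2 / (n : ℝ))) (fun y ↦ |(h y).det| ^ (-(1 / (n : ℝ))) • h y) x i j k =
      |(h x).det| ^ (-(1 / (n : ℝ))) * (covDerivTwoTensor Γ 0 h x i j k + τ x i * h x j k) := by
  have hd := H.det_ne_zero x hx
  have hdd : DifferentiableAt ℝ (fun y ↦ (h y).det) x := differentiableAt_of_contDiffOn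
    (contDiffOn_det H.contDiffOn_metric) H.isOpen hx
  have hn0 : (n : ℝ) ≠ 0 := by
    have : (1 : ℝ) < n := by exact_mod_cast hn
    linarith
  have ht := (H.alignedAt_iff_trace hn hx).1 ha i
  simp only [covDerivTwoTensor, partialDeriv_eq_pd, Matrix.smul_apply, smul_eq_mul]
  rw [pd_mul (hasFDerivAt_abs_rpow hdd hd _).differentiableAt
    (differentiableAt_of_contDiffOn (H.contDiffOn_metric j k) H.isOpen hx), pd_abs_rpow hdd hd,
    H.pd_det_metric hx, mul_div_cancel_left₀ _ hd, ht]
  simp only [mul_left_comm _ (|(h x).det| ^ (-(1 / (n : ℝ)))), ← Finset.mul_sum]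
  field_simp
  ring

/-- By the Codazzi equation, the conformal torsion `∇_[i H_j]k` of an aligned induced pair
vanishes. -/
theorem covDeriv_normalized_symm (H : GaussWeingarten U f ξ Γ h S τ) (hn : 1 < n) (hx : x ∈ U)
    (ha : AlignedAt Γ h x) (i j k : Fin n) :
    covDerivTwoTensor Γ (-(2 / (n : ℝ))) (fun y ↦ |(h y).det| ^ (-(1 / (n : ℝ))) • h y) x i j k =
      covDerivTwoTensor Γ (-(2 / (n : ℝ)))
        (fun y ↦ |(h y).det| ^ (-(1 / (n : ℝ))) • h y) x j i k := by
  rw [H.covDeriv_normalized hn hx ha, H.covDeriv_normalized hn hx ha, H.codazzi_metric hx]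

end GaussWeingarten

end LocalTheory

/-! ### Curvature traces of an equiaffine hypersurface -/

section CurvatureTraces

variable {n : ℕ}

theorem matrix_inv_smul {c : ℝ} (hc : c ≠ 0) {G : Matrix (Fin n) (Fin n) ℝ} (hG : G.det ≠ 0) :
    (c • G)⁻¹ = c⁻¹ • G⁻¹ :=
  Matrix.inv_eq_right_inv (by
    rw [Matrix.smul_mul, Matrix.mul_smul, smul_smul, mul_inv_cancel₀ hc,
      Matrix.mul_nonsing_inv _ hG.isUnit, one_smul])

theorem traceFreeSymm_smul_left {c : ℝ} (hc : c ≠ 0) {G : Matrix (Fin n) (Fin n) ℝ}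
    (hG : G.det ≠ 0) (Z : Matrix (Fin n) (Fin n) ℝ) :
    traceFreeSymm (c • G) Z = traceFreeSymm G Z := by
  have := matrix_inv_smul hc hG
  ext i j
  simp only [traceFreeSymm, this, Matrix.smul_apply, smul_eq_mul, mul_assoc, ← Finset.mul_sum]
  field_simp

theorem traceFreeSymm_eq {G : Matrix (Fin n) (Fin n) ℝ} {S : Matrix (Fin n) (Fin n) ℝ}
    (hG : G.det ≠ 0) (hs : ∀ i j, G i j = G j i) (hS : ∀ i j, (S * G) i j = (S * G) j i) :
    traceFreeSymm G (S * G) = S * G - ((1 / (n : ℝ)) * S.trace) • G := by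
  ext i j
  have := sum_sum_inv_mul hG hs S
  simp only [← Matrix.mul_apply] at this
  simp only [traceFreeSymm, this, hS j i, Matrix.sub_apply, Matrix.smul_apply, smul_eq_mul]
  ring

theorem traceFreeSymm_smul_self_sub {G : Matrix (Fin n) (Fin n) ℝ} (hn : n ≠ 0)
    (hG : G.det ≠ 0) (hs : ∀ i j, G i j = G j i) (a b : ℝ) (Z : Matrix (Fin n) (Fin n) ℝ) :
    traceFreeSymm G (a • G + b • Z) = b • traceFreeSymm G Z := by
  ext i j
  have := sum_sum_inv_self hG hs
  have hn' : (n : ℝ) ≠ 0 := by exact_mod_cast hn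
  simp only [traceFreeSymm, Matrix.add_apply, Matrix.smul_apply, smul_eq_mul, mul_add,
    Finset.sum_add_distrib, mul_left_comm _ a, mul_left_comm _ b, ← Finset.mul_sum, this, hs j i]
  field_simp
  ring

variable {V : Type*} [NormedAddCommGroup V] [NormedSpace ℝ V]

namespace GaussWeingarten

variable {U : Set (EuclideanSpace ℝ (Fin n))} {f ξ : EuclideanSpace ℝ (Fin n) → V}
  {Γ : EuclideanSpace ℝ (Fin n) → Fin n → Fin n → Fin n → ℝ}
  {h S : EuclideanSpace ℝ (Fin n) → Matrix (Fin n) (Fin n) ℝ}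
  {τ : EuclideanSpace ℝ (Fin n) → Fin n → ℝ}
  {x : EuclideanSpace ℝ (Fin n)}

/-- The Ricci trace of the Gauss equation: `Ric = (tr S) h - S h`. -/
theorem ricci_eq (H : GaussWeingarten U f ξ Γ h S τ) (hx : x ∈ U) :
    ricci Γ x = (S x).trace • h x - S x * h x := by
  ext i j
  simp only [ricci, H.gauss_equation hx, Finset.sum_sub_distrib, ← Finset.mul_sum,
    Matrix.sub_apply, Matrix.smul_apply, smul_eq_mul, Matrix.mul_apply, Matrix.trace,
    Matrix.diag_apply]
  rw [mul_comm]
  congr 1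
  exact Finset.sum_congr rfl fun p _ ↦ mul_comm _ _

/-- The trace of the Gauss equation with a multiple `G` of the induced metric: `Q = (n - 1) S h`. -/
theorem ricciQ_eq (H : GaussWeingarten U f ξ Γ h S τ) (hx : x ∈ U) {c : ℝ} (hc : c ≠ 0)
    {G : EuclideanSpace ℝ (Fin n) → Matrix (Fin n) (Fin n) ℝ} (hG : G x = c • h x) :
    ricciQ Γ G x = ((n : ℝ) - 1) • (S x * h x) := by
  have hd := H.det_ne_zero x hx
  have hs : ∀ i j, h x i j = h x j i := fun i j ↦ H.metric_symm hx i j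
  have hinv := matrix_inv_smul hc hd
  ext i j
  have h1 : ∀ p q l, (G x)⁻¹ p q * curvature Γ x i p q l * G x l j =
      (h x)⁻¹ p q * h x p q * (S x i l * h x l j) -
        (h x)⁻¹ p q * h x q i * (S x p l * h x l j) := by
    intro p q l
    rw [hG, hinv, H.gauss_equation hx, hs i q]
    simp only [Matrix.smul_apply, smul_eq_mul]
    field_simp
  simp only [ricciQ, h1, Finset.sum_sub_distrib, ← Finset.mul_sum, ← Matrix.mul_apply]
  simp only [← Finset.sum_mul, sum_sum_inv_self hd hs, sum_inv_mul hd]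
  simp [sub_mul]

end GaussWeingarten

end CurvatureTraces

section Equiaffine

variable {n : ℕ} {V : Type*} [NormedAddCommGroup V] [NormedSpace ℝ V]
  {U : Set (EuclideanSpace ℝ (Fin n))} {f ξ : EuclideanSpace ℝ (Fin n) → V}
  {Γ : EuclideanSpace ℝ (Fin n) → Fin n → Fin n → Fin n → ℝ}
  {h S : EuclideanSpace ℝ (Fin n) → Matrix (Fin n) (Fin n) ℝ}
  {x : EuclideanSpace ℝ (Fin n)}

namespace GaussWeingarten

/-- By the Ricci equation the shape operator is symmetric when `ξ` is equiaffine, i.e. `τ = 0`. -/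
theorem shape_symm (H : GaussWeingarten U f ξ Γ h S 0) (hx : x ∈ U) (i j : Fin n) :
    (S x * h x) i j = (S x * h x) j i := by
  have := H.ricci_equation hx i j
  simp only [Pi.zero_apply, pd_const, zero_sub, neg_inj] at this
  simp only [Matrix.mul_apply, H.metric_symm hx _ j, H.metric_symm hx _ i]
  exact this.symm

theorem eq_smul_one_of_shape_mul (H : GaussWeingarten U f ξ Γ h S 0) (hx : x ∈ U) {s : ℝ}
    (hS : S x * h x = s • h x) : S x = s • 1 := by
  have hu := (H.det_ne_zero x hx).isUnit
  rw [← Matrix.mul_nonsing_inv_cancel_right (h x) (S x) hu, hS, Matrix.smul_mul,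
    Matrix.mul_nonsing_inv _ hu]

/-- The naive Einstein equations say that the shape operator is a multiple of the identity. -/
theorem exists_shape_eq_of_traceFreeSymm (H : GaussWeingarten U f ξ Γ h S 0) (hn : 1 < n)
    (hx : x ∈ U) {c : ℝ} (hc : c ≠ 0)
    (h0 : traceFreeSymm (c • h x) (ricci Γ x) = 0) : ∃ s : ℝ, S x = s • 1 := by
  have hd := H.det_ne_zero x hx
  have hs : ∀ i j, h x i j = h x j i := fun i j ↦ H.metric_symm hx i j
  refine ⟨(1 / (n : ℝ)) * (S x).trace, H.eq_smul_one_of_shape_mul hx ?_⟩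
  rw [traceFreeSymm_smul_left hc hd, H.ricci_eq hx, sub_eq_add_neg,
    ← neg_one_smul ℝ (S x * h x), traceFreeSymm_smul_self_sub (by omega) hd hs,
    traceFreeSymm_eq hd hs (H.shape_symm hx)] at h0
  simpa [sub_eq_zero, neg_smul, eq_comm] using h0

/-- If the shape operator is a multiple of the identity, then `Ric` and `Q` are multiples of the
metric, hence have no trace-free part. -/
theorem naiveEinstein_of_shape_eq (H : GaussWeingarten U f ξ Γ h S 0) (hn : 1 < n) (hx : x ∈ U)
    {c : ℝ} (hc : c ≠ 0) {G : EuclideanSpace ℝ (Fin n) → Matrix (Fin n) (Fin n) ℝ}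
    (hG : G x = c • h x) {s : ℝ} (hS : S x = s • 1) :
    traceFreeSymm (G x) (ricci Γ x) = 0 ∧ traceFreeSymm (G x) (ricciQ Γ G x) = 0 := by
  have hd := H.det_ne_zero x hx
  have hs : ∀ i j, h x i j = h x j i := fun i j ↦ H.metric_symm hx i j
  have hn0 : (n : ℝ) ≠ 0 := by
    have : n ≠ 0 := by omega
    exact_mod_cast this
  have h0 : traceFreeSymm (h x) (S x * h x) = 0 := by
    rw [traceFreeSymm_eq hd hs (H.shape_symm hx), hS]
    simp [Matrix.trace_smul, hn0, mul_comm s]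
  rw [H.ricciQ_eq hx hc hG, hG, traceFreeSymm_smul_left hc hd, traceFreeSymm_smul_left hc hd,
    H.ricci_eq hx]
  constructor
  · rw [sub_eq_add_neg, ← neg_one_smul ℝ (S x * h x),
      traceFreeSymm_smul_self_sub (by omega) hd hs, h0, smul_zero]
  · have := traceFreeSymm_smul_self_sub (by omega) hd hs 0 ((n : ℝ) - 1) (S x * h x)
    rw [zero_smul, zero_add] at this
    rw [this, h0, smul_zero]

/-- The Codazzi equation forces the factor of an umbilical shape operator to be constant. -/
theorem pd_eq_zero_of_shape_eq (H : GaussWeingarten U f ξ Γ h S 0) (hn : 1 < n)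
    {s : EuclideanSpace ℝ (Fin n) → ℝ} (hS : ∀ y ∈ U, S y = s y • 1) (hx : x ∈ U) (i : Fin n) :
    pd i s x = 0 := by
  have : Nontrivial (Fin n) := Fin.nontrivial_iff_two_le.2 hn
  obtain ⟨j, hj⟩ := exists_ne i
  have h1 := H.codazzi_shape hx i j j
  rw [pd_congr H.isOpen (g := s) (fun y hy ↦ by simp [hS y hy]) hx i,
    pd_congr H.isOpen (g := fun _ ↦ (0 : ℝ)) (fun y hy ↦ by simp [hS y hy, hj.symm]) hx j,
    pd_const, hS x hx] at h1
  simpa [Matrix.one_apply, H.christoffel_symm hx i j] using h1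

/-- The Faraday form of an equiaffine hypersurface vanishes, since it is the skew part of the shape
operator. -/
theorem faraday_eq_zero (H : GaussWeingarten U f ξ Γ h S 0) (hx : x ∈ U) : faraday Γ x = 0 := by
  ext i j
  have := H.shape_symm hx i j
  simp only [Matrix.mul_apply] at this
  simp only [faraday, H.gauss_equation hx, Finset.sum_sub_distrib, H.metric_symm hx j,
    H.metric_symm hx i, mul_comm (h x _ _), this, sub_self, mul_zero, Matrix.zero_apply]

/-- The weighted scalar curvature of a hypersurface with shape operator `s • 1`. -/
theorem weightedScalar_eq (H : GaussWeingarten U f ξ Γ h S 0) (hx : x ∈ U) {s c : ℝ} (hc : c ≠ 0)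
    {G : EuclideanSpace ℝ (Fin n) → Matrix (Fin n) (Fin n) ℝ} (hG : G x = c • h x)
    (hS : S x = s • 1) : weightedScalar Γ G x = c⁻¹ * (n * ((n - 1) * s)) := by
  have hd := H.det_ne_zero x hx
  have hs : ∀ i j, h x i j = h x j i := fun i j ↦ H.metric_symm hx i j
  have hinv := matrix_inv_smul hc hd
  have hr : ricci Γ x = ((n - 1) * s) • h x := by
    rw [H.ricci_eq hx, hS, Matrix.trace_smul, Matrix.trace_one, Matrix.smul_mul, Matrix.one_mul,
      ← sub_smul, Fintype.card_fin]
    congr 1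
    simp
    ring
  have h1 : ∀ i j, (c⁻¹ • (h x)⁻¹) i j * (((n - 1) * s) • h x) i j =
      (c⁻¹ * ((n - 1) * s)) * ((h x)⁻¹ i j * h x i j) := by
    intro i j
    simp only [Matrix.smul_apply, smul_eq_mul]
    ring
  simp only [weightedScalar, hG, hinv, hr, h1, ← Finset.mul_sum, sum_sum_inv_self hd hs]
  ring

/-- The conservation law of an umbilical shape operator: the Faraday form vanishes, and the
weighted scalar curvature is the parallel density `|det h|^(1/n)` times `n (n - 1) s`, where `s` is
constant by the Codazzi equation. -/
theorem conservation_of_shape_eq (H : GaussWeingarten U f ξ Γ h S 0) (hn : 1 < n) (hx : x ∈ U)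
    (ha : AlignedAt Γ h x) {s : EuclideanSpace ℝ (Fin n) → ℝ} (hS : ∀ y ∈ U, S y = s y • 1)
    (i : Fin n) :
    covDerivDensity Γ (2 / (n : ℝ))
        (weightedScalar Γ fun y ↦ |(h y).det| ^ (-(1 / (n : ℝ))) • h y) x i
      + n * ∑ p, ∑ q, (|(h x).det| ^ (-(1 / (n : ℝ))) • h x)⁻¹ p q *
          covDerivTwoTensor Γ 0 (faraday Γ) x q i p = 0 := by
  have hd := H.det_ne_zero x hx
  have hn0 : (n : ℝ) ≠ 0 := by
    have : n ≠ 0 := by omega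
    exact_mod_cast this
  have hdd : DifferentiableAt ℝ (fun y ↦ (h y).det) x := differentiableAt_of_contDiffOn
    (contDiffOn_det H.contDiffOn_metric) H.isOpen hx
  have hF : ∀ q i p, covDerivTwoTensor Γ 0 (faraday Γ) x q i p = 0 := by
    intro q i p
    simp only [covDerivTwoTensor, partialDeriv_eq_pd, H.faraday_eq_zero hx]
    rw [pd_congr H.isOpen (g := fun _ ↦ (0 : ℝ)) (fun y hy ↦ by simp [H.faraday_eq_zero hy]) hx,
      pd_const]
    simp
  have hR : ∀ y ∈ U, weightedScalar Γ (fun y ↦ |(h y).det| ^ (-(1 / (n : ℝ))) • h y) y =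
      (n * (n - 1)) * (s y * |(h y).det| ^ (1 / (n : ℝ))) := by
    intro y hy
    have hpos := abs_pos.2 (H.det_ne_zero y hy)
    rw [H.weightedScalar_eq hy (Real.rpow_pos_of_pos hpos _).ne' rfl (hS y hy),
      Real.rpow_neg hpos.le, inv_inv]
    ring
  have hsd : DifferentiableAt ℝ s x := by
    refine differentiableAt_of_contDiffOn (U := U) ?_ H.isOpen hx
    exact (H.contDiffOn_shape i i).congr fun y hy ↦ by simp [hS y hy]
  have hp := hasFDerivAt_abs_rpow hdd hd (1 / (n : ℝ))
  have ht := (H.alignedAt_iff_trace hn hx).1 ha i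
  simp only [hF, mul_zero, Finset.sum_const_zero, add_zero, covDerivDensity, partialDeriv_eq_pd]
  rw [pd_congr H.isOpen hR hx, hR x hx,
    pd_mul (differentiableAt_const _) (hsd.fun_mul hp.differentiableAt), pd_const,
    pd_mul hsd hp.differentiableAt, pd_abs_rpow hdd hd, H.pd_eq_zero_of_shape_eq hn hS hx,
    H.pd_det_metric hx, mul_div_cancel_left₀ _ hd, ht]
  simp only [Pi.zero_apply]
  field_simp
  ring

/-! ### Projectively flat Christoffel symbols -/

theorem pd_ite {p : Prop} [Decidable p] (g : EuclideanSpace ℝ (Fin n) → ℝ) (i : Fin n)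
    (x : EuclideanSpace ℝ (Fin n)) :
    pd i (fun y ↦ if p then g y else 0) x = if p then pd i g x else 0 := by
  split_ifs
  · rfl
  · exact pd_const i 0

/-- The curvature of a connection which is projectively flat in the given coordinates is
determined by the tensor `Pⱼₖ = σⱼ σₖ - ∂ⱼ σₖ`. -/
theorem curvature_of_projectivelyFlat {Γ : EuclideanSpace ℝ (Fin n) → Fin n → Fin n → Fin n → ℝ}
    {σ : EuclideanSpace ℝ (Fin n) → Fin n → ℝ} (hU : IsOpen U) (hx : x ∈ U)
    (hσ : ∀ i, DifferentiableAt ℝ (fun y ↦ σ y i) x)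
    (hΓ : ∀ y ∈ U, ∀ i j k, Γ y i j k =
      (if j = k then σ y i else 0) + (if i = k then σ y j else 0)) :
    ∃ P : Matrix (Fin n) (Fin n) ℝ, ∀ i j k l, curvature Γ x i j k l =
      (if i = l then P j k else 0) - (if j = l then P i k else 0) +
        if k = l then P j i - P i j else 0 := by
  refine ⟨Matrix.of fun j k ↦ σ x j * σ x k - pd j (fun y ↦ σ y k) x, fun i j k l ↦ ?_⟩
  have hite : ∀ (a : Fin n) (p : Prop) [Decidable p],
      DifferentiableAt ℝ (fun y ↦ if p then σ y a else 0) x := by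
    intro a p _
    split_ifs
    · exact hσ a
    · exact differentiableAt_const _
  have h1 : ∀ i j, pd i (fun y ↦ Γ y j k l) x =
      (if k = l then pd i (fun y ↦ σ y j) x else 0) +
        (if j = l then pd i (fun y ↦ σ y k) x else 0) := by
    intro i j
    rw [pd_congr hU (fun y hy ↦ hΓ y hy j k l) hx, pd_add (hite _ _) (hite _ _), pd_ite, pd_ite]
  simp only [curvature, partialDeriv_eq_pd, h1, hΓ x hx, Matrix.of_apply]
  have h2 : ∀ i j, ∑ p, (((if p = l then σ x i else 0) + (if i = l then σ x p else 0)) *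
      ((if k = p then σ x j else 0) + (if j = p then σ x k else 0))) =
      (if k = l then σ x i * σ x j else 0) + (if j = l then σ x i * σ x k else 0) +
        (if i = l then 2 * (σ x j * σ x k) else 0) := by
    intro i j
    simp only [mul_add, Finset.sum_add_distrib, mul_ite, mul_zero, Finset.sum_ite_eq,
      Finset.mem_univ, if_true]
    split_ifs <;> ring
  rw [Finset.sum_sub_distrib, h2, h2]
  split_ifs <;> ring

/-- For `n > 2` projective flatness forces the shape operator to be a multiple of the identity:
the Ricci trace of the Gauss equation and its trace with the inverse metric both express `P` through
`S`, and eliminating `P` leaves `n (n - 2) S = c • 1`. -/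
theorem exists_shape_eq_of_projectivelyFlat (H : GaussWeingarten U f ξ Γ h S 0) (hn : 2 < n)
    (hx : x ∈ U) {σ : EuclideanSpace ℝ (Fin n) → Fin n → ℝ}
    (hΓ : ∀ y ∈ U, ∀ i j k, Γ y i j k =
      (if j = k then σ y i else 0) + (if i = k then σ y j else 0)) :
    ∃ s : ℝ, S x = s • 1 := by
  have : Nontrivial (Fin n) := Fin.nontrivial_iff_two_le.2 (by omega)
  have hn2 : (2 : ℝ) < n := by exact_mod_cast hn
  have hd := H.det_ne_zero x hx
  have hs : ∀ i j, h x i j = h x j i := fun i j ↦ H.metric_symm hx i j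
  have hσ : ∀ i, DifferentiableAt ℝ (fun y ↦ σ y i) x := by
    intro i
    obtain ⟨j, hj⟩ := exists_ne i
    refine differentiableAt_of_contDiffOn (U := U) ?_ H.isOpen hx
    exact (H.contDiffOn_christoffel i j j).congr fun y hy ↦ by
      rw [hΓ y hy]
      simp [hj.symm]
  obtain ⟨P, hP⟩ := curvature_of_projectivelyFlat H.isOpen hx hσ hΓ
  simp only [H.gauss_equation hx] at hP
  -- the trace over the endomorphism indices
  have hPs : ∀ i j, P i j = P j i := by
    intro i j
    have h1 := Finset.sum_congr rfl fun k (_ : k ∈ Finset.univ) ↦ hP i j k k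
    have h2 := H.shape_symm hx i j
    simp only [Matrix.mul_apply] at h2
    simp only [Finset.sum_add_distrib, Finset.sum_sub_distrib, Finset.sum_ite_eq, if_true,
      Finset.mem_univ, Finset.sum_const, Finset.card_univ, Fintype.card_fin, nsmul_eq_mul,
      hs j, hs i, mul_comm (h x _ _), h2, sub_self] at h1
    have h3 : ((n : ℝ) + 1) * (P j i - P i j) = 0 := by linarith
    have := (mul_eq_zero.1 h3).resolve_left (by linarith)
    linarith
  -- the Ricci trace
  have hPt : (S x).trace • h x - S x * h x = ((n : ℝ) - 1) • P := by
    ext j k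
    have h1 := Finset.sum_congr rfl fun i (_ : i ∈ Finset.univ) ↦ hP i j k i
    simp only [Finset.sum_sub_distrib, Finset.sum_ite_eq, if_true,
      Finset.mem_univ, Finset.sum_const, Finset.card_univ, Fintype.card_fin, nsmul_eq_mul,
      ← Finset.mul_sum, hPs _ j, sub_self, ite_self, add_zero, hs _ k] at h1
    simp only [Matrix.sub_apply, Matrix.smul_apply, smul_eq_mul, Matrix.mul_apply, Matrix.trace,
      Matrix.diag_apply]
    simp only [hs _ k, mul_comm (S x j _)]
    have h2 : ∀ k, P j k = P k j := hPs j
    linarith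
  -- the trace with the inverse metric over the last two lower indices
  set p : ℝ := ∑ j, ∑ k, (h x)⁻¹ j k * P j k with hp
  have hSt : ((n : ℝ) - 1) • S x = p • 1 - P * (h x)⁻¹ := by
    ext i l
    have h1 : ∑ j, ∑ k, (h x)⁻¹ j k * (h x j k * S x i l - h x i k * S x j l) =
        ∑ j, ∑ k, (h x)⁻¹ j k * ((if i = l then P j k else 0) - (if j = l then P i k else 0)) := by
      refine Finset.sum_congr rfl fun j _ ↦ Finset.sum_congr rfl fun k _ ↦ ?_
      rw [hP, hPs j i]
      simp
    have h2 : ∑ j, ∑ k, (h x)⁻¹ j k * (h x j k * S x i l - h x i k * S x j l) =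
        n * S x i l - S x i l := by
      simp only [mul_sub, ← mul_assoc, Finset.sum_sub_distrib, ← Finset.sum_mul,
        sum_sum_inv_self hd hs, hs i, sum_inv_mul hd]
      simp
    have h3 : ∑ j, ∑ k, (h x)⁻¹ j k *
        ((if i = l then P j k else 0) - (if j = l then P i k else 0)) =
        (if i = l then p else 0) - (P * (h x)⁻¹) i l := by
      simp only [mul_sub, Finset.sum_sub_distrib, Matrix.mul_apply]
      congr 1
      · split_ifs
        · rfl
        · simp
      · rw [Finset.sum_comm]
        refine Finset.sum_congr rfl fun k _ ↦ ?_
        simp only [mul_ite, mul_zero, Finset.sum_ite_eq', Finset.mem_univ, if_true]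
        rw [inv_symm_of_symm hs, mul_comm]
    rw [h2, h3] at h1
    simp only [Matrix.smul_apply, Matrix.sub_apply, smul_eq_mul, Matrix.one_apply, mul_ite,
      mul_one, mul_zero]
    linarith
  have hu := hd.isUnit
  have hPh : ((n : ℝ) - 1) • (P * (h x)⁻¹) = (S x).trace • 1 - S x := by
    rw [← Matrix.smul_mul, ← hPt, Matrix.sub_mul, Matrix.smul_mul, Matrix.mul_nonsing_inv _ hu,
      Matrix.mul_nonsing_inv_cancel_right _ _ hu]
  have hne : (n : ℝ) * (n - 2) ≠ 0 := (mul_pos (by linarith) (by linarith)).ne'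
  refine ⟨((n : ℝ) * (n - 2))⁻¹ * ((n - 1) * p - (S x).trace), ?_⟩
  have h4 : ((n : ℝ) * (n - 2)) • S x = ((n - 1) * p - (S x).trace) • 1 := by
    have h5 : ((n : ℝ) - 1) • ((n : ℝ) - 1) • S x =
        (((n : ℝ) - 1) * p) • (1 : Matrix (Fin n) (Fin n) ℝ) - ((S x).trace • 1 - S x) := by
      rw [hSt, smul_sub, hPh, smul_smul]
    have h6 : ((n : ℝ) * (n - 2)) • S x = ((n : ℝ) - 1) • ((n : ℝ) - 1) • S x - S x := by module
    rw [h6, h5]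
    module
  rw [mul_smul, ← h4, inv_smul_smul₀ hne]

end GaussWeingarten

end Equiaffine

/-! ### Coordinates on a manifold -/

section Charts

variable {n : ℕ} {M : Type*} [TopologicalSpace M]
  [ChartedSpace (EuclideanSpace ℝ (Fin n)) M]
  {F : Type*} [NormedAddCommGroup F] [NormedSpace ℝ F]
  {e : OpenPartialHomeomorph M (EuclideanSpace ℝ (Fin n))}

theorem mdifferentiable_of_mem_maximalAtlas (he : e ∈ IsManifold.maximalAtlas (𝓡 n) ∞ M) :
    e.MDifferentiable (𝓡 n) (𝓡 n) :=
  ⟨(contMDiffOn_of_mem_maximalAtlas he).mdifferentiableOn (by simp),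
    (contMDiffOn_symm_of_mem_maximalAtlas he).mdifferentiableOn (by simp)⟩

theorem mfderiv_symm_comp (he : e ∈ IsManifold.maximalAtlas (𝓡 n) ∞ M) {p : M} (hp : p ∈ e.source)
    (X : TangentSpace (𝓡 n) p) :
    mfderiv (𝓡 n) (𝓡 n) e.symm (e p) (mfderiv (𝓡 n) (𝓡 n) e p X) = X :=
  congrArg (fun L ↦ L X) ((mdifferentiable_of_mem_maximalAtlas he).symm_comp_deriv hp)

theorem mfderiv_comp_symm (he : e ∈ IsManifold.maximalAtlas (𝓡 n) ∞ M)
    {x : EuclideanSpace ℝ (Fin n)} (hx : x ∈ e.target) (v : EuclideanSpace ℝ (Fin n)) :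
    mfderiv (𝓡 n) (𝓡 n) e (e.symm x) (mfderiv (𝓡 n) (𝓡 n) e.symm x v) = v :=
  congrArg (fun L ↦ L v) ((mdifferentiable_of_mem_maximalAtlas he).comp_symm_deriv hx)

theorem coordField_eq (he : e ∈ IsManifold.maximalAtlas (𝓡 n) ∞ M) {p : M} (hp : p ∈ e.source)
    (i : Fin n) :
    coordField e i p = mfderiv (𝓡 n) (𝓡 n) e.symm (e p) (EuclideanSpace.single i 1) := by
  change (mfderiv (𝓡 n) (𝓡 n) e p).inverse (EuclideanSpace.single i 1) = _
  have h1 : (mfderiv (𝓡 n) (𝓡 n) e p).IsInvertible :=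
    ⟨(mdifferentiable_of_mem_maximalAtlas he).mfderiv hp, rfl⟩
  apply ((mdifferentiable_of_mem_maximalAtlas he).mfderiv_injective hp)
  have h2 := mfderiv_comp_symm he (e.map_source hp) (EuclideanSpace.single i 1)
  rw [e.left_inv hp] at h2
  refine Eq.trans ?_ h2.symm
  obtain ⟨L, hL⟩ := h1
  rw [← hL, ContinuousLinearMap.inverse_equiv]
  exact L.apply_symm_apply _

theorem coordField_symm_eq (he : e ∈ IsManifold.maximalAtlas (𝓡 n) ∞ M)
    {x : EuclideanSpace ℝ (Fin n)} (hx : x ∈ e.target) (i : Fin n) :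
    coordField e i (e.symm x) = mfderiv (𝓡 n) (𝓡 n) e.symm x (EuclideanSpace.single i 1) := by
  have := coordField_eq he (e.map_target hx) i
  rw [this, e.right_inv hx]

theorem coordComponent_coordField (he : e ∈ IsManifold.maximalAtlas (𝓡 n) ∞ M) {p : M}
    (hp : p ∈ e.source) (i k : Fin n) :
    coordComponent e p (coordField e i p) k = if i = k then 1 else 0 := by
  have h2 := mfderiv_comp_symm he (e.map_source hp) (EuclideanSpace.single i 1)
  rw [e.left_inv hp] at h2
  rw [coordComponent, coordField_eq he hp]
  refine (congrArg (EuclideanSpace.proj (𝕜 := ℝ) k) h2).trans ?_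
  simp [eq_comm]

theorem map_eq_sum_single {G : Type*} [AddCommGroup G] [Module ℝ G] [TopologicalSpace G]
    (L : EuclideanSpace ℝ (Fin n) →L[ℝ] G) (v : EuclideanSpace ℝ (Fin n)) :
    L v = ∑ k, v k • L (EuclideanSpace.single k 1) := by
  conv_lhs => rw [← (EuclideanSpace.basisFun (Fin n) ℝ).sum_repr v]
  simp [map_sum, map_smul]

theorem sum_coordComponent (he : e ∈ IsManifold.maximalAtlas (𝓡 n) ∞ M) {p : M}
    (hp : p ∈ e.source) (X : TangentSpace (𝓡 n) p) :
    ∑ k, coordComponent e p X k • coordField e k p = X := by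
  obtain ⟨x, hx, rfl⟩ : ∃ x ∈ e.target, p = e.symm x := ⟨e p, e.map_source hp, (e.left_inv hp).symm⟩
  simp only [coordField_symm_eq he hx]
  have h1 := map_eq_sum_single (mfderiv (𝓡 n) (𝓡 n) e.symm x)
    (mfderiv (𝓡 n) (𝓡 n) e (e.symm x) X)
  refine h1.symm.trans ?_
  have h2 := mfderiv_symm_comp he hp X
  rw [e.right_inv hx] at h2
  exact h2

/-- The derivative of a map with values in a vector space in the direction of a coordinate field
is the partial derivative of its coordinate expression. -/
theorem mfderiv_coordField (he : e ∈ IsManifold.maximalAtlas (𝓡 n) ∞ M) {u : M → F}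
    {x : EuclideanSpace ℝ (Fin n)} (hx : x ∈ e.target)
    (hu : MDifferentiableAt (𝓡 n) 𝓘(ℝ, F) u (e.symm x)) (i : Fin n) :
    mfderiv (𝓡 n) 𝓘(ℝ, F) u (e.symm x) (coordField e i (e.symm x)) =
      pd i (fun y ↦ u (e.symm y)) x := by
  have h1 := mfderiv_comp x hu ((mdifferentiable_of_mem_maximalAtlas he).mdifferentiableAt_symm hx)
  rw [coordField_symm_eq he hx, pd, ← mfderiv_eq_fderiv]
  exact (congrArg (fun L ↦ L (EuclideanSpace.single i 1)) h1).symm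

theorem contDiffOn_comp_symm (he : e ∈ IsManifold.maximalAtlas (𝓡 n) ∞ M) {u : M → F}
    (hu : ContMDiff (𝓡 n) 𝓘(ℝ, F) ∞ u) : ContDiffOn ℝ ∞ (fun y ↦ u (e.symm y)) e.target := by
  rw [← contMDiffOn_iff_contDiffOn]
  exact hu.comp_contMDiffOn (contMDiffOn_symm_of_mem_maximalAtlas he)

theorem coordComponent_sum (he : e ∈ IsManifold.maximalAtlas (𝓡 n) ∞ M) {p : M}
    (hp : p ∈ e.source) (c : Fin n → ℝ) (k : Fin n) :
    coordComponent e p (∑ j, c j • coordField e j p) k = c k := by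
  set L : TangentSpace (𝓡 n) p →L[ℝ] ℝ :=
    (EuclideanSpace.proj (𝕜 := ℝ) k).comp (mfderiv (𝓡 n) (𝓡 n) e p) with hL
  have h1 : ∀ X, coordComponent e p X k = L X := fun X ↦ rfl
  have h2 : ∀ j, L (coordField e j p) = if j = k then 1 else 0 := fun j ↦
    coordComponent_coordField he hp j k
  simp [h1, map_sum, h2]

theorem flatDeriv_eq_mvfderiv (u : M → F) (p : M) (X : TangentSpace (𝓡 n) p) :
    flatDeriv u p X = mvfderiv (𝓡 n) u p X := rfl

theorem pushField_eq_mvfderiv (u : M → F) (Y : ∀ p : M, TangentSpace (𝓡 n) p) (p : M) :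
    pushField u Y p = mvfderiv (𝓡 n) u p (Y p) := rfl

theorem mvfderiv_coordField (he : e ∈ IsManifold.maximalAtlas (𝓡 n) ∞ M) {u : M → F}
    {x : EuclideanSpace ℝ (Fin n)} (hx : x ∈ e.target)
    (hu : MDifferentiableAt (𝓡 n) 𝓘(ℝ, F) u (e.symm x)) (i : Fin n) :
    mvfderiv (𝓡 n) u (e.symm x) (coordField e i (e.symm x)) = pd i (fun y ↦ u (e.symm y)) x :=
  mfderiv_coordField he hx hu i

variable [IsManifold (𝓡 n) ∞ M]

theorem contMDiff_of_contDiffOn_comp_symm {u : M → F}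
    (hu : ∀ e ∈ IsManifold.maximalAtlas (𝓡 n) ∞ M,
      ContDiffOn ℝ ∞ (fun y ↦ u (e.symm y)) e.target) : ContMDiff (𝓡 n) 𝓘(ℝ, F) ∞ u := by
  intro p
  set e := chartAt (EuclideanSpace ℝ (Fin n)) p with hedef
  have he : e ∈ IsManifold.maximalAtlas (𝓡 n) ∞ M := IsManifold.chart_mem_maximalAtlas p
  have hp : p ∈ e.source := mem_chart_source _ p
  have h1 : ContMDiffOn (𝓡 n) 𝓘(ℝ, F) ∞ (fun q ↦ u (e.symm (e q))) e.source :=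
    ((contMDiffOn_iff_contDiffOn.2 (hu e he)).comp (contMDiffOn_of_mem_maximalAtlas he)
      fun q hq ↦ e.map_source hq)
  exact (h1.congr fun q hq ↦ by rw [e.left_inv hq]).contMDiffAt (e.open_source.mem_nhds hp)

theorem contMDiffAt_coordField (he : e ∈ IsManifold.maximalAtlas (𝓡 n) ∞ M) {p : M}
    (hp : p ∈ e.source) (i : Fin n) :
    ContMDiffAt (𝓡 n) (𝓡 n).tangent ∞
      (fun q ↦ (⟨q, coordField e i q⟩ : TangentBundle (𝓡 n) M)) p := by
  refine ContMDiffAt.mpullback_vectorField_preimage (n := ∞) ?_ ?_ ?_ (by simp)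
  · exact (contMDiffAt_vectorSpace_iff_contDiffAt (V := fun _ ↦ EuclideanSpace.single i 1)).2
      contDiffAt_const
  · exact contMDiffAt_of_mem_maximalAtlas he hp
  · exact ⟨(mdifferentiable_of_mem_maximalAtlas he).mfderiv hp, rfl⟩

theorem isDifferentiableAt_coordField (he : e ∈ IsManifold.maximalAtlas (𝓡 n) ∞ M) {p : M}
    (hp : p ∈ e.source) (i : Fin n) : IsDifferentiableAt (coordField e i) p :=
  (contMDiffAt_coordField he hp i).mdifferentiableAt (by simp)

theorem mlieBracket_eq_lieBracket {E : Type*} [NormedAddCommGroup E] [NormedSpace ℝ E]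
    (X Y : ∀ x : E, TangentSpace 𝓘(ℝ, E) x) :
    VectorField.mlieBracket 𝓘(ℝ, E) X Y = VectorField.lieBracket ℝ (X : E → E) (Y : E → E) := by
  rw [← VectorField.mlieBracketWithin_univ]
  exact VectorField.mlieBracketWithin_eq_lieBracketWithin.trans
    (VectorField.lieBracketWithin_univ (𝕜 := ℝ) (V := (X : E → E)) (W := (Y : E → E)))

theorem mlieBracket_coordField (he : e ∈ IsManifold.maximalAtlas (𝓡 n) ∞ M) {p : M}
    (hp : p ∈ e.source) (i j : Fin n) :
    VectorField.mlieBracket (𝓡 n) (coordField e i) (coordField e j) p = 0 := by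
  have hM : IsManifold (𝓡 n) (minSmoothness ℝ 2) M := by
    rw [minSmoothness_of_isRCLikeNormedField]
    exact IsManifold.of_le (n := ∞) (WithTop.coe_le_coe.2 (le_top : (2 : ℕ∞) ≤ ⊤))
  have hc : ∀ k : Fin n, MDifferentiableAt (𝓡 n) (𝓡 n).tangent
      (fun y : EuclideanSpace ℝ (Fin n) ↦ (⟨y, EuclideanSpace.single k 1⟩ :
        TangentBundle (𝓡 n) (EuclideanSpace ℝ (Fin n)))) (e p) := fun k ↦
    ((contMDiffAt_vectorSpace_iff_contDiffAt (n := ∞)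
      (V := fun _ ↦ EuclideanSpace.single k 1)).2 contDiffAt_const).mdifferentiableAt (by simp)
  have h1 := VectorField.mpullback_mlieBracket (n := ∞) (hc i) (hc j)
    (contMDiffAt_of_mem_maximalAtlas he hp)
    (by
      rw [minSmoothness_of_isRCLikeNormedField]
      exact WithTop.coe_le_coe.2 (le_top : (2 : ℕ∞) ≤ ⊤))
  refine h1.symm.trans ?_
  have h2 : VectorField.mlieBracket (𝓡 n) (fun _ : EuclideanSpace ℝ (Fin n) ↦
      (EuclideanSpace.single i (1 : ℝ) : EuclideanSpace ℝ (Fin n)))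
      (fun _ ↦ EuclideanSpace.single j 1) = 0 := by
    refine (mlieBracket_eq_lieBracket _ _).trans ?_
    ext1 y
    simp [VectorField.lieBracket]
    rfl
  change (mfderiv (𝓡 n) (𝓡 n) e p).inverse (VectorField.mlieBracket (𝓡 n) _ _ (e p)) = 0
  rw [congrFun h2 (e p)]
  exact map_zero _

end Charts

/-! ### The structure equations of an immersed hypersurface in a chart -/

section Structure

variable {n : ℕ} {M : Type*} [TopologicalSpace M]
  [ChartedSpace (EuclideanSpace ℝ (Fin n)) M]
  {V : Type*} [NormedAddCommGroup V] [NormedSpace ℝ V]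
  {F : Type*} [NormedAddCommGroup F] [NormedSpace ℝ F]
  {e : OpenPartialHomeomorph M (EuclideanSpace ℝ (Fin n))} {i ξ : M → V}

theorem mdifferentiableAt_of_comp_symm (he : e ∈ IsManifold.maximalAtlas (𝓡 n) ∞ M) {u : M → F}
    {x : EuclideanSpace ℝ (Fin n)} (hx : x ∈ e.target)
    (hu : DifferentiableAt ℝ (fun y ↦ u (e.symm y)) x) :
    MDifferentiableAt (𝓡 n) 𝓘(ℝ, F) u (e.symm x) := by
  have h1 : MDifferentiableAt (𝓡 n) 𝓘(ℝ, F) (fun y ↦ u (e.symm y)) (e (e.symm x)) := by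
    rw [e.right_inv hx]
    exact mdifferentiableAt_iff_differentiableAt.2 hu
  have h2 := h1.comp (e.symm x)
    ((mdifferentiable_of_mem_maximalAtlas he).mdifferentiableAt (e.map_target hx))
  refine h2.congr_of_eventuallyEq ?_
  filter_upwards [e.open_source.mem_nhds (e.map_target hx)] with q hq
  simp [e.left_inv hq]

theorem pushField_coordField (he : e ∈ IsManifold.maximalAtlas (𝓡 n) ∞ M)
    (hi : ContMDiff (𝓡 n) 𝓘(ℝ, V) ∞ i) {x : EuclideanSpace ℝ (Fin n)} (hx : x ∈ e.target)
    (j : Fin n) : pushField i (coordField e j) (e.symm x) = pd j (fun y ↦ i (e.symm y)) x :=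
  mfderiv_coordField he hx (hi.mdifferentiable (by simp) _) j

theorem flatDeriv_pushField_coordField (he : e ∈ IsManifold.maximalAtlas (𝓡 n) ∞ M)
    (hi : ContMDiff (𝓡 n) 𝓘(ℝ, V) ∞ i) {x : EuclideanSpace ℝ (Fin n)} (hx : x ∈ e.target)
    (j k : Fin n) :
    flatDeriv (pushField i (coordField e k)) (e.symm x) (coordField e j (e.symm x)) =
      pd j (pd k (fun y ↦ i (e.symm y))) x := by
  have h1 : ∀ y ∈ e.target, pushField i (coordField e k) (e.symm y) =
      pd k (fun y ↦ i (e.symm y)) y := fun y hy ↦ pushField_coordField he hi hy k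
  have h2 := contDiffOn_pd (contDiffOn_comp_symm he hi) e.open_target k
  refine (mfderiv_coordField he hx (mdifferentiableAt_of_comp_symm he hx ?_) j).trans
    (pd_congr e.open_target h1 hx j)
  exact differentiableAt_of_contDiffOn (h2.congr h1) e.open_target hx

theorem isAdaptedFrame (hi : IsHypersurfaceImmersion n i) (hξ : IsTransversal n i ξ)
    (he : e ∈ IsManifold.maximalAtlas (𝓡 n) ∞ M) :
    IsAdaptedFrame e.target (fun y ↦ i (e.symm y)) (fun y ↦ ξ (e.symm y)) where
  isOpen := e.open_target
  finrank_eq := hi.finrank_eq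
  contDiffOn_map := contDiffOn_comp_symm he hi.smooth
  contDiffOn_transversal := contDiffOn_comp_symm he hξ.1
  indep := by
    intro x hx c t h
    set X : TangentSpace (𝓡 n) (e.symm x) := ∑ k, c k • coordField e k (e.symm x) with hX
    have h1 : mvfderiv (𝓡 n) i (e.symm x) X + t • ξ (e.symm x) = 0 := by
      rw [hX, map_sum]
      simpa only [map_smul, mvfderiv_coordField he hx (hi.smooth.mdifferentiable (by simp) _)]
        using h
    have ht : t = 0 := by
      by_contra ht
      refine hξ.2 (e.symm x) ⟨-(t⁻¹ • X), ?_⟩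
      change mvfderiv (𝓡 n) i (e.symm x) (-(t⁻¹ • X)) = _
      rw [map_neg, map_smul, eq_neg_of_add_eq_zero_left h1, smul_neg, neg_neg, inv_smul_smul₀ ht]
    refine ⟨?_, ht⟩
    rw [ht, zero_smul, add_zero] at h1
    have h2 : X = 0 := hi.injective (e.symm x) (h1.trans (map_zero _).symm)
    funext k
    rw [← coordComponent_sum he (e.map_target hx) c k, ← hX, h2]
    simp [coordComponent]
    rfl

variable [IsManifold (𝓡 n) ∞ M]

theorem det_components_ne_zero (he : e ∈ IsManifold.maximalAtlas (𝓡 n) ∞ M)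
    (h : PseudoMetric n M) {x : EuclideanSpace ℝ (Fin n)} (hx : x ∈ e.target) :
    (h.components e x).det ≠ 0 := by
  intro hdet
  obtain ⟨v, hv, hv0⟩ := Matrix.exists_mulVec_eq_zero_iff.2 hdet
  apply hv
  have hX : ∑ k, v k • coordField e k (e.symm x) = 0 := by
    refine h.nondegenerate _ _ fun Y ↦ ?_
    rw [← sum_coordComponent he (e.map_target hx) Y]
    rw [map_sum]
    refine Finset.sum_eq_zero fun j _ ↦ ?_
    rw [map_smul, h.symm, map_sum]
    have := congrFun hv0 j
    simp only [Matrix.mulVec, dotProduct, PseudoMetric.components] at this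
    simp only [map_smul, smul_eq_mul, mul_comm (v _), this, mul_zero, Pi.zero_apply]
  funext k
  rw [← coordComponent_sum he (e.map_target hx) v k, hX]
  simp [coordComponent]
  rfl

/-- In any chart, the connection and metric induced by a transversal satisfy the structure
equations, for a suitable shape operator and transversal connection form. -/
theorem Induces.exists_gaussWeingarten {D : TorsionFreeConnection n M} {h : PseudoMetric n M}
    (hi : IsHypersurfaceImmersion n i) (H : Induces i ξ D h)
    (he : e ∈ IsManifold.maximalAtlas (𝓡 n) ∞ M) :
    ∃ (S : EuclideanSpace ℝ (Fin n) → Matrix (Fin n) (Fin n) ℝ)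
      (τ : EuclideanSpace ℝ (Fin n) → Fin n → ℝ),
      GaussWeingarten e.target (fun y ↦ i (e.symm y)) (fun y ↦ ξ (e.symm y))
        (D.christoffel e) (h.components e) S τ := by
  have hF := isAdaptedFrame hi H.1 he
  choose c t _ _ hct using fun j ↦
    hF.exists_coeff (contDiffOn_pd hF.contDiffOn_transversal hF.isOpen j)
  refine ⟨fun x j k ↦ -c j x k, fun x j ↦ t j x, hF, ?_, ?_,
    fun x hx ↦ det_components_ne_zero he h hx⟩
  · intro x hx j k
    rw [← flatDeriv_pushField_coordField he hi.smooth hx,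
      H.2 _ _ (isDifferentiableAt_coordField he (e.map_target hx) k)]
    congr 1
    conv_lhs => rw [← sum_coordComponent he (e.map_target hx)
      (D.conn (coordField e k) (e.symm x) (coordField e j (e.symm x)))]
    refine (map_sum _ _ _).trans (Finset.sum_congr rfl fun l _ ↦ ?_)
    refine (map_smul _ _ _).trans ?_
    exact congrArg (_ • ·) (pushField_coordField he hi.smooth hx l)
  · intro x hx j
    rw [hct j x hx]
    simp

theorem mdifferentiableAt_pushField (hi : ContMDiff (𝓡 n) 𝓘(ℝ, V) ∞ i)
    {Y : ∀ p : M, TangentSpace (𝓡 n) p} {p : M} (hY : IsDifferentiableAt Y p) :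
    MDifferentiableAt (𝓡 n) 𝓘(ℝ, V) (pushField i Y) p := by
  have h1 : ContMDiff (𝓡 n).tangent 𝓘(ℝ, V).tangent 1 (tangentMap (𝓡 n) 𝓘(ℝ, V) i) :=
    hi.contMDiff_tangentMap (WithTop.coe_le_coe.2 (le_top : (1 + 1 : ℕ∞) ≤ ⊤))
  have h2 := (contMDiff_snd_tangentBundle_modelSpace (n := 1) V 𝓘(ℝ, V)).comp h1
  exact (h2.mdifferentiable (by simp) _).comp p hY

theorem contMDiff_pushField (hi : ContMDiff (𝓡 n) 𝓘(ℝ, V) ∞ i)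
    {Y : ∀ p : M, TangentSpace (𝓡 n) p}
    (hY : ContMDiff (𝓡 n) (𝓡 n).tangent ∞ (fun q ↦ (⟨q, Y q⟩ : TangentBundle (𝓡 n) M))) :
    ContMDiff (𝓡 n) 𝓘(ℝ, V) ∞ (pushField i Y) := by
  have h1 : ContMDiff (𝓡 n).tangent 𝓘(ℝ, V).tangent ∞ (tangentMap (𝓡 n) 𝓘(ℝ, V) i) :=
    hi.contMDiff_tangentMap (by simp)
  exact ((contMDiff_snd_tangentBundle_modelSpace (n := ∞) V 𝓘(ℝ, V)).comp h1).comp hY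

end Structure

/-! ### Smoothness of tensor fields from their components -/

section TensorSmoothness

variable {n : ℕ} {M : Type*} [TopologicalSpace M]
  [ChartedSpace (EuclideanSpace ℝ (Fin n)) M]

theorem clm_eq_sum {F : Type*} [NormedAddCommGroup F] [NormedSpace ℝ F]
    (L : EuclideanSpace ℝ (Fin n) →L[ℝ] F) :
    L = ∑ k, (EuclideanSpace.proj (𝕜 := ℝ) k).smulRight (L (EuclideanSpace.single k 1)) := by
  ext v
  rw [map_eq_sum_single L v]
  simp

theorem contMDiffAt_clm_of_apply_single {F : Type*} [NormedAddCommGroup F] [NormedSpace ℝ F]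
    {L : M → EuclideanSpace ℝ (Fin n) →L[ℝ] F} {p : M}
    (h : ∀ k, ContMDiffAt (𝓡 n) 𝓘(ℝ, F) ∞ (fun q ↦ L q (EuclideanSpace.single k 1)) p) :
    ContMDiffAt (𝓡 n) 𝓘(ℝ, EuclideanSpace ℝ (Fin n) →L[ℝ] F) ∞ L p := by
  have h1 : L = fun q ↦ ∑ k,
      ContinuousLinearMap.smulRightL ℝ (EuclideanSpace ℝ (Fin n)) F
        (EuclideanSpace.proj (𝕜 := ℝ) k) (L q (EuclideanSpace.single k 1)) := by
    funext q
    exact clm_eq_sum (L q)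
  rw [h1]
  refine ContMDiffAt.sum fun k _ ↦ ?_
  exact (ContinuousLinearMap.contMDiff
    (ContinuousLinearMap.smulRightL ℝ (EuclideanSpace ℝ (Fin n)) F
      (EuclideanSpace.proj (𝕜 := ℝ) k))).contMDiffAt.comp p (h k)

theorem contMDiffAt_of_comp_symm {F : Type*} [NormedAddCommGroup F] [NormedSpace ℝ F]
    {e : OpenPartialHomeomorph M (EuclideanSpace ℝ (Fin n))}
    (he : e ∈ IsManifold.maximalAtlas (𝓡 n) ∞ M) {u : M → F} {p : M} (hp : p ∈ e.source)
    (hu : ContDiffOn ℝ ∞ (fun y ↦ u (e.symm y)) e.target) :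
    ContMDiffAt (𝓡 n) 𝓘(ℝ, F) ∞ u p := by
  have h1 : ContMDiffOn (𝓡 n) 𝓘(ℝ, F) ∞ (fun q ↦ u (e.symm (e q))) e.source :=
    ((contMDiffOn_iff_contDiffOn.2 hu).comp (contMDiffOn_of_mem_maximalAtlas he)
      fun q hq ↦ e.map_source hq)
  exact (h1.congr fun q hq ↦ by rw [e.left_inv hq]).contMDiffAt (e.open_source.mem_nhds hp)

variable [IsManifold (𝓡 n) ∞ M]

/-- The trivialization of the tangent bundle at `p` is the derivative of the preferred chart. -/
theorem continuousLinearMapAt_eq {p q : M}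
    (hq : q ∈ (chartAt (EuclideanSpace ℝ (Fin n)) p).source) (X : TangentSpace (𝓡 n) q) :
    (trivializationAt (EuclideanSpace ℝ (Fin n))
      (TangentSpace (𝓡 n) : M → Type _) p).continuousLinearMapAt ℝ q X =
      mfderiv (𝓡 n) (𝓡 n) (chartAt (EuclideanSpace ℝ (Fin n)) p) q X := by
  rw [TangentBundle.continuousLinearMapAt_trivializationAt hq]
  rfl

/-- The preferred local trivialization sends the standard basis to the coordinate fields. -/
theorem trivializationAt_symm_single {p q : M}
    (hq : q ∈ (chartAt (EuclideanSpace ℝ (Fin n)) p).source) (k : Fin n) :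
    (trivializationAt (EuclideanSpace ℝ (Fin n)) (TangentSpace (𝓡 n) : M → Type _) p).symm q
      (EuclideanSpace.single k 1) =
      coordField (chartAt (EuclideanSpace ℝ (Fin n)) p) k q := by
  set T := trivializationAt (EuclideanSpace ℝ (Fin n)) (TangentSpace (𝓡 n) : M → Type _) p with hT
  set e := chartAt (EuclideanSpace ℝ (Fin n)) p with he
  have hem : e ∈ IsManifold.maximalAtlas (𝓡 n) ∞ M := IsManifold.chart_mem_maximalAtlas p
  have hb : q ∈ T.baseSet := hq
  rw [← T.symmL_apply (R := ℝ) hb]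
  have h1 := T.symmL_continuousLinearMapAt (R := ℝ) hb (coordField e k q)
  rw [← h1]
  congr 1
  rw [continuousLinearMapAt_eq hq, coordField_eq hem hq]
  have := mfderiv_comp_symm hem (e.map_source hq) (EuclideanSpace.single k 1)
  rw [e.left_inv hq] at this
  exact this.symm

/-- A field of bilinear forms with smooth components is smooth. -/
theorem contMDiff_bilin_of_components
    {φ : ∀ p : M, TangentSpace (𝓡 n) p →L[ℝ] TangentSpace (𝓡 n) p →L[ℝ] ℝ}
    (h : ∀ e ∈ IsManifold.maximalAtlas (𝓡 n) ∞ M, ∀ j k, ContDiffOn ℝ ∞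
      (fun x ↦ φ (e.symm x) (coordField e j (e.symm x)) (coordField e k (e.symm x))) e.target) :
    ContMDiff (𝓡 n)
      ((𝓡 n).prod 𝓘(ℝ, EuclideanSpace ℝ (Fin n) →L[ℝ] EuclideanSpace ℝ (Fin n) →L[ℝ] ℝ)) ∞
      (fun p ↦ Bundle.TotalSpace.mk'
        (EuclideanSpace ℝ (Fin n) →L[ℝ] EuclideanSpace ℝ (Fin n) →L[ℝ] ℝ)
        (E := fun p : M ↦ TangentSpace (𝓡 n) p →L[ℝ] TangentSpace (𝓡 n) p →L[ℝ] ℝ) p (φ p)) := by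
  intro p
  rw [contMDiffAt_hom_bundle]
  refine ⟨contMDiffAt_id, ?_⟩
  set e := chartAt (EuclideanSpace ℝ (Fin n)) p with he
  have hem : e ∈ IsManifold.maximalAtlas (𝓡 n) ∞ M := IsManifold.chart_mem_maximalAtlas p
  have hp : p ∈ e.source := mem_chart_source _ p
  refine contMDiffAt_clm_of_apply_single fun j ↦ contMDiffAt_clm_of_apply_single fun k ↦ ?_
  have h1 : ContMDiffAt (𝓡 n) 𝓘(ℝ, ℝ) ∞
      (fun q ↦ φ q (coordField e j q) (coordField e k q)) p :=
    contMDiffAt_of_comp_symm hem hp (h e hem j k)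
  refine h1.congr_of_eventuallyEq ?_
  filter_upwards [e.open_source.mem_nhds hp] with q hq
  refine (inCoordinates_apply_eq₂ (E₃ := Bundle.Trivial M ℝ)
    hq hq (by simp)).trans ?_
  rw [trivializationAt_symm_single hq, trivializationAt_symm_single hq]
  simp
  rfl

/-- A field of endomorphisms of the tangent spaces with smooth components is smooth. -/
theorem contMDiff_endo_of_components
    {φ : ∀ p : M, TangentSpace (𝓡 n) p →L[ℝ] TangentSpace (𝓡 n) p}
    (h : ∀ e ∈ IsManifold.maximalAtlas (𝓡 n) ∞ M, ∀ j k, ContDiffOn ℝ ∞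
      (fun x ↦ coordComponent e (e.symm x) (φ (e.symm x) (coordField e j (e.symm x))) k)
      e.target) :
    ContMDiff (𝓡 n) ((𝓡 n).prod 𝓘(ℝ, EuclideanSpace ℝ (Fin n) →L[ℝ] EuclideanSpace ℝ (Fin n))) ∞
      (fun p ↦ Bundle.TotalSpace.mk' (EuclideanSpace ℝ (Fin n) →L[ℝ] EuclideanSpace ℝ (Fin n))
        (E := fun p : M ↦ TangentSpace (𝓡 n) p →L[ℝ] TangentSpace (𝓡 n) p) p (φ p)) := by
  intro p
  rw [contMDiffAt_hom_bundle]
  refine ⟨contMDiffAt_id, ?_⟩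
  set e := chartAt (EuclideanSpace ℝ (Fin n)) p with he
  have hem : e ∈ IsManifold.maximalAtlas (𝓡 n) ∞ M := IsManifold.chart_mem_maximalAtlas p
  have hp : p ∈ e.source := mem_chart_source _ p
  refine contMDiffAt_clm_of_apply_single fun j ↦ ?_
  have h0 : ContDiffOn ℝ ∞ (fun x ↦ WithLp.toLp 2 fun k ↦
      coordComponent e (e.symm x) (φ (e.symm x) (coordField e j (e.symm x))) k) e.target := by
    rw [contDiffOn_euclidean]
    exact fun k ↦ h e hem j k
  have h1 : ContMDiffAt (𝓡 n) 𝓘(ℝ, EuclideanSpace ℝ (Fin n)) ∞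
      (fun q ↦ WithLp.toLp 2 fun k ↦ coordComponent e q (φ q (coordField e j q)) k) p :=
    contMDiffAt_of_comp_symm hem hp h0
  refine h1.congr_of_eventuallyEq ?_
  filter_upwards [e.open_source.mem_nhds hp] with q hq
  rw [ContinuousLinearMap.inCoordinates]
  change (trivializationAt (EuclideanSpace ℝ (Fin n)) (TangentSpace (𝓡 n) : M → Type _)
    p).continuousLinearMapAt ℝ q (φ q ((trivializationAt (EuclideanSpace ℝ (Fin n))
      (TangentSpace (𝓡 n) : M → Type _) p).symmL ℝ q (EuclideanSpace.single j 1))) = _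
  have hb : q ∈ (trivializationAt (EuclideanSpace ℝ (Fin n)) (TangentSpace (𝓡 n) : M → Type _)
    p).baseSet := hq
  rw [Bundle.Trivialization.symmL_apply _ hb, trivializationAt_symm_single hq,
    continuousLinearMapAt_eq hq]
  rfl

end TensorSmoothness

/-! ### The connection and the metric induced by a transversal -/

section InducedStructures

variable {n : ℕ} {M : Type*} [TopologicalSpace M]
  [ChartedSpace (EuclideanSpace ℝ (Fin n)) M]
  {V : Type*} [NormedAddCommGroup V] [NormedSpace ℝ V] {i : M → V}

/-- The second fundamental form evaluated on a conormal field: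
`h(X, Y) = -(d_X ϑ)(Ti(Y))`, which is tensorial in both arguments by construction. -/
def conormalForm (i : M → V) (ϑ : M → V →L[ℝ] ℝ) (p : M) :
    TangentSpace (𝓡 n) p →L[ℝ] TangentSpace (𝓡 n) p →L[ℝ] ℝ :=
  -(ContinuousLinearMap.precomp ℝ (mvfderiv (𝓡 n) i p)).comp (mvfderiv (𝓡 n) ϑ p)

theorem conormalForm_apply (i : M → V) (ϑ : M → V →L[ℝ] ℝ) (p : M)
    (X Y : TangentSpace (𝓡 n) p) :
    conormalForm i ϑ p X Y = -mvfderiv (𝓡 n) ϑ p X (mvfderiv (𝓡 n) i p Y) := rfl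

theorem Coorientation.conormal_mvfderiv (ν : Coorientation n i) (p : M)
    (X : TangentSpace (𝓡 n) p) : ν.conormal p (mvfderiv (𝓡 n) i p X) = 0 := by
  have : mvfderiv (𝓡 n) i p X ∈ LinearMap.ker (ν.conormal p).toLinearMap := by
    rw [ν.ker_eq]
    exact ⟨X, rfl⟩
  exact this

theorem Coorientation.exists_of_conormal_eq_zero (ν : Coorientation n i) {p : M} {v : V}
    (hv : ν.conormal p v = 0) : ∃ X : TangentSpace (𝓡 n) p, mvfderiv (𝓡 n) i p X = v := by
  have : v ∈ LinearMap.ker (ν.conormal p).toLinearMap := hv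
  rw [ν.ker_eq] at this
  exact this

variable {e : OpenPartialHomeomorph M (EuclideanSpace ℝ (Fin n))}

theorem conormalForm_coordField (hi : IsHypersurfaceImmersion n i) (ν : Coorientation n i)
    (he : e ∈ IsManifold.maximalAtlas (𝓡 n) ∞ M) {x : EuclideanSpace ℝ (Fin n)} (hx : x ∈ e.target)
    (j k : Fin n) :
    conormalForm i ν.conormal (e.symm x) (coordField e j (e.symm x)) (coordField e k (e.symm x)) =
      -pd j (fun y ↦ ν.conormal (e.symm y)) x (pd k (fun y ↦ i (e.symm y)) x) := by
  rw [conormalForm_apply, mvfderiv_coordField he hx (ν.smooth.mdifferentiable (by simp) _),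
    mvfderiv_coordField he hx (hi.smooth.mdifferentiable (by simp) _)]

/-- Differentiating `ϑ(Ti(Y)) = 0` shows that the conormal form is the conormal component of the
derivative of `Ti(Y)`. -/
theorem conormal_mvfderiv_pushField [IsManifold (𝓡 n) ∞ M] (hi : IsHypersurfaceImmersion n i)
    (ν : Coorientation n i) {Y : ∀ p : M, TangentSpace (𝓡 n) p} {p : M}
    (hY : IsDifferentiableAt Y p) (X : TangentSpace (𝓡 n) p) :
    ν.conormal p (mvfderiv (𝓡 n) (pushField i Y) p X) =
      conormalForm i ν.conormal p X (Y p) := by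
  set e := chartAt (EuclideanSpace ℝ (Fin n)) p with hedef
  have he : e ∈ IsManifold.maximalAtlas (𝓡 n) ∞ M := IsManifold.chart_mem_maximalAtlas p
  obtain ⟨x, hx, hxp⟩ : ∃ x ∈ e.target, e.symm x = p :=
    ⟨e p, e.map_source (mem_chart_source _ p), e.left_inv (mem_chart_source _ p)⟩
  clear_value e
  subst hxp
  have hP := mdifferentiableAt_pushField hi.smooth hY
  have hν := ν.smooth.mdifferentiable (by simp) (e.symm x)
  have key : ∀ j, ν.conormal (e.symm x)
      (mvfderiv (𝓡 n) (pushField i Y) (e.symm x) (coordField e j (e.symm x))) =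
      conormalForm i ν.conormal (e.symm x) (coordField e j (e.symm x)) (Y (e.symm x)) := by
    intro j
    have hsymm := (mdifferentiable_of_mem_maximalAtlas he).mdifferentiableAt_symm hx
    have d1 : DifferentiableAt ℝ (fun y ↦ ν.conormal (e.symm y)) x :=
      mdifferentiableAt_iff_differentiableAt.1 (hν.comp x hsymm)
    have d2 : DifferentiableAt ℝ (fun y ↦ pushField i Y (e.symm y)) x :=
      mdifferentiableAt_iff_differentiableAt.1 (hP.comp x hsymm)
    have h0 : pd j (fun y ↦ ν.conormal (e.symm y) (pushField i Y (e.symm y))) x = 0 := by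
      have : (fun y ↦ ν.conormal (e.symm y) (pushField i Y (e.symm y))) = fun _ ↦ (0 : ℝ) := by
        funext y
        exact ν.conormal_mvfderiv _ _
      rw [this, pd_const]
    rw [pd_clm_apply d1 d2] at h0
    rw [conormalForm_apply, mvfderiv_coordField he hx hP, mvfderiv_coordField he hx hν,
      ← pushField_eq_mvfderiv]
    linarith
  rw [← sum_coordComponent he (e.map_target hx) X]
  simp only [map_sum, map_smul, sum_apply, smul_apply, key]

theorem Coorientation.isTransversal_of_eq_one (ν : Coorientation n i) {ξ : M → V}
    (hξ : ContMDiff (𝓡 n) 𝓘(ℝ, V) ∞ ξ) (h1 : ∀ p, ν.conormal p (ξ p) = 1) :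
    IsTransversal n i ξ := by
  refine ⟨hξ, fun p hp ↦ ?_⟩
  rw [← ν.ker_eq] at hp
  have : ν.conormal p (ξ p) = 0 := hp
  rw [h1] at this
  exact one_ne_zero this

/-- The projection of `V` onto the tangent space along the transversal. -/
theorem exists_tangent_projection (hi : IsHypersurfaceImmersion n i) (ν : Coorientation n i)
    {ξ : M → V} (h1 : ∀ p, ν.conormal p (ξ p) = 1) (p : M) :
    ∃ P : V →L[ℝ] TangentSpace (𝓡 n) p,
      ∀ v, mvfderiv (𝓡 n) i p (P v) = v - ν.conormal p v • ξ p := by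
  have hfd : FiniteDimensional ℝ V := Module.finite_of_finrank_pos (by rw [hi.finrank_eq]; omega)
  have hinj : Function.Injective (mvfderiv (𝓡 n) i p) := hi.injective p
  obtain ⟨g, hg⟩ := LinearMap.exists_leftInverse_of_injective
    (mvfderiv (𝓡 n) i p).toLinearMap (LinearMap.ker_eq_bot.2 hinj)
  refine ⟨(LinearMap.toContinuousLinearMap g).comp
    (ContinuousLinearMap.id ℝ V - (ν.conormal p).smulRight (ξ p)), fun v ↦ ?_⟩
  obtain ⟨X, hX⟩ := ν.exists_of_conormal_eq_zero (p := p) (v := v - ν.conormal p v • ξ p)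
    (by simp [h1])
  have hgX : g (mvfderiv (𝓡 n) i p X) = X := congrArg (fun L ↦ L X) hg
  change mvfderiv (𝓡 n) i p (g (v - ν.conormal p v • ξ p)) = _
  rw [← hX, hgX]

variable [IsManifold (𝓡 n) ∞ M]

theorem conormalForm_symm (hi : IsHypersurfaceImmersion n i) (ν : Coorientation n i) (p : M)
    (X Y : TangentSpace (𝓡 n) p) :
    conormalForm i ν.conormal p X Y = conormalForm i ν.conormal p Y X := by
  set e := chartAt (EuclideanSpace ℝ (Fin n)) p with hedef
  have he : e ∈ IsManifold.maximalAtlas (𝓡 n) ∞ M := IsManifold.chart_mem_maximalAtlas p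
  obtain ⟨x, hx, hxp⟩ : ∃ x ∈ e.target, e.symm x = p :=
    ⟨e p, e.map_source (mem_chart_source _ p), e.left_inv (mem_chart_source _ p)⟩
  clear_value e
  subst hxp
  have key : ∀ j k, conormalForm i ν.conormal (e.symm x) (coordField e j (e.symm x))
      (coordField e k (e.symm x)) =
      ν.conormal (e.symm x) (pd j (pd k (fun y ↦ i (e.symm y))) x) := by
    intro j k
    rw [← conormal_mvfderiv_pushField hi ν (isDifferentiableAt_coordField he (e.map_target hx) k),
      ← flatDeriv_eq_mvfderiv, flatDeriv_pushField_coordField he hi.smooth hx]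
  rw [← sum_coordComponent he (e.map_target hx) X, ← sum_coordComponent he (e.map_target hx) Y]
  simp only [map_sum, map_smul, sum_apply, smul_apply, key, smul_eq_mul, Finset.mul_sum]
  rw [Finset.sum_comm]
  refine Finset.sum_congr rfl fun k _ ↦ Finset.sum_congr rfl fun j _ ↦ ?_
  rw [pd_comm (contDiffOn_comp_symm he hi.smooth) e.open_target hx]
  ring

/-- The pseudo-Riemannian metric determined by a conormal field of a non-degenerate
hypersurface. -/
def conormalMetric (hi : IsHypersurfaceImmersion n i) (hnd : IsNondegenerate n i)
    (ν : Coorientation n i) : PseudoMetric n M where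
  val := conormalForm i ν.conormal
  symm := conormalForm_symm hi ν
  nondegenerate := by
    intro p X hX
    refine hnd p X fun Y hY ↦ ?_
    rw [secondFundamentalForm, Submodule.Quotient.mk_eq_zero, ← ν.ker_eq]
    exact (conormal_mvfderiv_pushField hi ν hY X).trans (hX _)
  smooth := by
    refine contMDiff_bilin_of_components fun e he j k ↦ ?_
    have h1 := contDiffOn_pd (contDiffOn_comp_symm he ν.smooth) e.open_target j
    have h2 := contDiffOn_pd (contDiffOn_comp_symm he hi.smooth) e.open_target k
    exact (h1.clm_apply h2).neg.congr fun x hx ↦ conormalForm_coordField hi ν he hx j k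

/-- The connection induced by a transversal `ξ` with `ϑ(ξ) = 1`: the derivative of `Ti(Y)` is
projected to the tangent space along `ξ`. -/
def inducedCovariantDerivative (hi : IsHypersurfaceImmersion n i) (ν : Coorientation n i)
    {ξ : M → V} (h1 : ∀ p, ν.conormal p (ξ p) = 1) :
    CovariantDerivative (𝓡 n) (EuclideanSpace ℝ (Fin n)) (TangentSpace (𝓡 n) : M → Type _) where
  toFun Y p := ((exists_tangent_projection hi ν h1 p).choose).comp
    (mvfderiv (𝓡 n) (pushField i Y) p)
  isCovariantDerivativeOnUniv :=
    { add := by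
        intro σ σ' p hσ hσ' _
        have h2 : pushField i (σ + σ') = pushField i σ + pushField i σ' := by
          funext q
          exact map_add (mvfderiv (𝓡 n) i q) _ _
        rw [h2, mvfderiv_add (mdifferentiableAt_pushField hi.smooth hσ)
          (mdifferentiableAt_pushField hi.smooth hσ'), ContinuousLinearMap.comp_add]
      leibniz := by
        intro σ g p hσ hg _
        have h2 : pushField i (g • σ) = g • pushField i σ := by
          funext q
          exact map_smul (mvfderiv (𝓡 n) i q) _ _
        rw [h2, mvfderiv_smul hg (mdifferentiableAt_pushField hi.smooth hσ)]
        set P := (exists_tangent_projection hi ν h1 p).choose with hP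
        have h3 : P (pushField i σ p) = σ p := by
          have := (exists_tangent_projection hi ν h1 p).choose_spec (pushField i σ p)
          rw [pushField_eq_mvfderiv, ν.conormal_mvfderiv, zero_smul, sub_zero] at this
          exact hi.injective p this
        ext X
        simp [h3] }

end InducedStructures

section InducedConnection

variable {n : ℕ} {M : Type*} [TopologicalSpace M]
  [ChartedSpace (EuclideanSpace ℝ (Fin n)) M] [IsManifold (𝓡 n) ∞ M]
  {V : Type*} [NormedAddCommGroup V] [NormedSpace ℝ V] {i ξ : M → V}

theorem mvfderiv_inducedCovariantDerivative (hi : IsHypersurfaceImmersion n i)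
    (ν : Coorientation n i) (h1 : ∀ p, ν.conormal p (ξ p) = 1)
    (Y : ∀ p : M, TangentSpace (𝓡 n) p) (p : M) (X : TangentSpace (𝓡 n) p) :
    mvfderiv (𝓡 n) i p (inducedCovariantDerivative hi ν h1 Y p X) =
      mvfderiv (𝓡 n) (pushField i Y) p X -
        ν.conormal p (mvfderiv (𝓡 n) (pushField i Y) p X) • ξ p :=
  (exists_tangent_projection hi ν h1 p).choose_spec _

theorem torsion_inducedCovariantDerivative (hi : IsHypersurfaceImmersion n i)
    (ν : Coorientation n i) (h1 : ∀ p, ν.conormal p (ξ p) = 1) :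
    (inducedCovariantDerivative hi ν h1).torsion = 0 := by
  funext p
  set e := chartAt (EuclideanSpace ℝ (Fin n)) p with hedef
  have he : e ∈ IsManifold.maximalAtlas (𝓡 n) ∞ M := IsManifold.chart_mem_maximalAtlas p
  obtain ⟨x, hx, hxp⟩ : ∃ x ∈ e.target, e.symm x = p :=
    ⟨e p, e.map_source (mem_chart_source _ p), e.left_inv (mem_chart_source _ p)⟩
  clear_value e
  subst hxp
  have hs := e.map_target hx
  have key : ∀ j k, (inducedCovariantDerivative hi ν h1).torsion (e.symm x)
      (coordField e j (e.symm x)) (coordField e k (e.symm x)) = 0 := by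
    intro j k
    rw [CovariantDerivative.torsion_apply _ (isDifferentiableAt_coordField he hs j)
      (isDifferentiableAt_coordField he hs k), mlieBracket_coordField he hs, sub_zero, sub_eq_zero]
    refine hi.injective (e.symm x) ?_
    change mvfderiv (𝓡 n) i _ _ = mvfderiv (𝓡 n) i _ _
    rw [mvfderiv_inducedCovariantDerivative, mvfderiv_inducedCovariantDerivative]
    simp only [← flatDeriv_eq_mvfderiv, flatDeriv_pushField_coordField he hi.smooth hx]
    rw [pd_comm (contDiffOn_comp_symm he hi.smooth) e.open_target hx]
  ext1 X
  ext1 Y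
  rw [← sum_coordComponent he hs X, ← sum_coordComponent he hs Y]
  simp only [map_sum, map_smul, sum_apply, smul_apply, key, smul_zero, Finset.sum_const_zero]
  simp

theorem contMDiff_inducedCovariantDerivative (hi : IsHypersurfaceImmersion n i)
    (ν : Coorientation n i) (hξ : ContMDiff (𝓡 n) 𝓘(ℝ, V) ∞ ξ)
    (h1 : ∀ p, ν.conormal p (ξ p) = 1) :
    CovariantDerivative.ContMDiffCovariantDerivative (inducedCovariantDerivative hi ν h1) ∞ := by
  refine ⟨⟨fun {σ} hσ ↦ ?_⟩⟩
  rw [contMDiffOn_univ] at hσ ⊢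
  have hσ' : ContMDiff (𝓡 n) (𝓡 n).tangent ∞ (fun q ↦ (⟨q, σ q⟩ : TangentBundle (𝓡 n) M)) := hσ
  have hu := contMDiff_pushField hi.smooth hσ'
  refine contMDiff_endo_of_components fun e he j k ↦ ?_
  have hF := isAdaptedFrame hi (ν.isTransversal_of_eq_one hξ h1) he
  refine (hF.contDiffOn_coeff (contDiffOn_pd (contDiffOn_comp_symm he hu) e.open_target j)
    (c := fun x k ↦ coordComponent e (e.symm x)
      (inducedCovariantDerivative hi ν h1 σ (e.symm x) (coordField e j (e.symm x))) k)
    (t := fun x ↦ ν.conormal (e.symm x) (pd j (fun y ↦ pushField i σ (e.symm y)) x))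
    fun x hx ↦ ?_).1 k
  have h2 := mvfderiv_inducedCovariantDerivative hi ν h1 σ (e.symm x) (coordField e j (e.symm x))
  rw [← sum_coordComponent he (e.map_target hx)
      (inducedCovariantDerivative hi ν h1 σ (e.symm x) (coordField e j (e.symm x))), map_sum] at h2
  simp only [map_smul, mvfderiv_coordField he hx (hi.smooth.mdifferentiable (by simp) _)] at h2
  rw [h2, mvfderiv_coordField he hx (hu.mdifferentiable (by simp) _), sub_add_cancel]

/-- The torsion-free connection induced by a transversal `ξ` with `ϑ(ξ) = 1`. -/
def inducedConnection (hi : IsHypersurfaceImmersion n i)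
    (ν : Coorientation n i) (hξ : ContMDiff (𝓡 n) 𝓘(ℝ, V) ∞ ξ)
    (h1 : ∀ p, ν.conormal p (ξ p) = 1) : TorsionFreeConnection n M where
  conn := inducedCovariantDerivative hi ν h1
  smooth := contMDiff_inducedCovariantDerivative hi ν hξ h1
  torsion_eq_zero := torsion_inducedCovariantDerivative hi ν h1

theorem induces_inducedConnection (hi : IsHypersurfaceImmersion n i)
    (hnd : IsNondegenerate n i)
    (ν : Coorientation n i) (hξ : ContMDiff (𝓡 n) 𝓘(ℝ, V) ∞ ξ)
    (h1 : ∀ p, ν.conormal p (ξ p) = 1) :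
    Induces i ξ (inducedConnection hi ν hξ h1) (conormalMetric hi hnd ν) := by
  refine ⟨ν.isTransversal_of_eq_one hξ h1, fun Y p hY X ↦ ?_⟩
  have h2 := mvfderiv_inducedCovariantDerivative hi ν h1 Y p X
  rw [conormal_mvfderiv_pushField hi ν hY] at h2
  exact (eq_add_of_sub_eq h2.symm)

end InducedConnection

/-! ### Normalization of the conormal -/

section Normalization

/-- The determinant of a frame whose first `n` vectors are changed by `A` among themselves and
whose last vector is changed to `∑ aⱼ vⱼ + c w`. -/
theorem det_toMatrix_comb {n : ℕ} {V : Type*} [AddCommGroup V] [Module ℝ V]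
    (b : Module.Basis (Fin n ⊕ Unit) ℝ V) (v : Fin n → V) (w : V)
    (A : Matrix (Fin n) (Fin n) ℝ) (a : Fin n → ℝ) (c : ℝ) :
    (b.toMatrix (Sum.elim (fun k ↦ ∑ j, A j k • v j)
      (fun _ : Unit ↦ ∑ j, a j • v j + c • w))).det =
      (b.toMatrix (Sum.elim v (fun _ ↦ w))).det * (A.det * c) := by
  have h1 : b.toMatrix (Sum.elim (fun k ↦ ∑ j, A j k • v j)
        (fun _ : Unit ↦ ∑ j, a j • v j + c • w)) =
      b.toMatrix (Sum.elim v (fun _ : Unit ↦ w)) *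
        Matrix.fromBlocks A (Matrix.of fun j (_ : Unit) ↦ a j) (0 : Matrix Unit (Fin n) ℝ)
          (Matrix.of fun (_ _ : Unit) ↦ c) := by
    ext p q
    rw [Matrix.mul_apply, Fintype.sum_sum_type]
    rcases q with k | u
    · simp [Module.Basis.toMatrix_apply, mul_comm]
    · simp [Module.Basis.toMatrix_apply, mul_comm]
  rw [h1, Matrix.det_mul, Matrix.det_fromBlocks_zero₂₁]
  simp

variable {n : ℕ} {M : Type*} [TopologicalSpace M]
  [ChartedSpace (EuclideanSpace ℝ (Fin n)) M]
  {V : Type*} [NormedAddCommGroup V] [NormedSpace ℝ V] {i : M → V}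

theorem Coorientation.conormal_ne_zero (hi : IsHypersurfaceImmersion n i)
    (ν : Coorientation n i) (p : M) : ν.conormal p ≠ 0 := by
  intro h0
  have hfd : FiniteDimensional ℝ V := Module.finite_of_finrank_pos (by rw [hi.finrank_eq]; omega)
  have hfd' : FiniteDimensional ℝ (TangentSpace (𝓡 n) p) :=
    inferInstanceAs (FiniteDimensional ℝ (EuclideanSpace ℝ (Fin n)))
  have h1 : tangentImage n i p = ⊤ := by
    rw [← ν.ker_eq, h0]
    exact LinearMap.ker_zero
  have h2 : Module.finrank ℝ (tangentImage n i p) ≤ n :=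
    (LinearMap.finrank_range_le (mvfderiv (𝓡 n) i p).toLinearMap).trans
      (finrank_euclideanSpace_fin (𝕜 := ℝ) (n := n)).le
  rw [h1, finrank_top, hi.finrank_eq] at h2
  omega

/-- A smooth section of `V` on which the conormal takes the value `1`: the dual vector of the
conormal with respect to a Euclidean structure, divided by its squared length. -/
theorem Coorientation.exists_section [IsManifold (𝓡 n) ∞ M] (hi : IsHypersurfaceImmersion n i)
    (ν : Coorientation n i) : ∃ ζ : M → V, ContMDiff (𝓡 n) 𝓘(ℝ, V) ∞ ζ ∧
      ∀ p, ν.conormal p (ζ p) = 1 := by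
  obtain ⟨b⟩ := exists_basis_of_finrank_eq hi.finrank_eq
  have hq : ∀ p, ∑ a, ν.conormal p (b a) * ν.conormal p (b a) ≠ 0 := by
    intro p h0
    have h1 := (Finset.sum_eq_zero_iff_of_nonneg fun a _ ↦ mul_self_nonneg _).1 h0
    refine ν.conormal_ne_zero hi p (ContinuousLinearMap.coe_injective (b.ext fun a ↦ ?_))
    exact mul_self_eq_zero.1 (h1 a (Finset.mem_univ a))
  refine ⟨fun p ↦ (∑ a, ν.conormal p (b a) * ν.conormal p (b a))⁻¹ •
    ∑ a, ν.conormal p (b a) • b a, ?_, fun p ↦ ?_⟩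
  · refine contMDiff_of_contDiffOn_comp_symm fun e he ↦ ?_
    have h1 : ∀ a, ContDiffOn ℝ ∞ (fun x ↦ ν.conormal (e.symm x) (b a)) e.target := fun a ↦
      (contDiffOn_comp_symm he ν.smooth).clm_apply contDiffOn_const
    exact (ContDiffOn.inv (ContDiffOn.sum fun a _ ↦ (h1 a).mul (h1 a)) fun x _ ↦ hq _).smul
      (ContDiffOn.sum fun a _ ↦ (h1 a).smul contDiffOn_const)
  · simp only [map_smul, map_sum, smul_eq_mul]
    exact inv_mul_cancel₀ (hq p)

variable {e : OpenPartialHomeomorph M (EuclideanSpace ℝ (Fin n))}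

/-- The matrix of the conormal form in a chart. -/
def conormalComponents (i : M → V) (ϑ : M → V →L[ℝ] ℝ)
    (e : OpenPartialHomeomorph M (EuclideanSpace ℝ (Fin n))) (x : EuclideanSpace ℝ (Fin n)) :
    Matrix (Fin n) (Fin n) ℝ :=
  fun j k ↦ conormalForm i ϑ (e.symm x) (coordField e j (e.symm x)) (coordField e k (e.symm x))

theorem contDiffOn_conormalComponents (hi : IsHypersurfaceImmersion n i) (ν : Coorientation n i)
    (he : e ∈ IsManifold.maximalAtlas (𝓡 n) ∞ M) (j k : Fin n) :
    ContDiffOn ℝ ∞ (fun x ↦ conormalComponents i ν.conormal e x j k) e.target := by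
  have h1 := contDiffOn_pd (contDiffOn_comp_symm he ν.smooth) e.open_target j
  have h2 := contDiffOn_pd (contDiffOn_comp_symm he hi.smooth) e.open_target k
  exact (h1.clm_apply h2).neg.congr fun x hx ↦ conormalForm_coordField hi ν he hx j k

/-- A conormal field is normalized if the volume form that it induces on the hypersurface from a
constant volume form of `V` is the volume of the metric that it determines. In coordinates:
`det(∂₁f, …, ∂ₙf, v)⁴ = (det hⱼₖ)²` whenever `ϑ(v) = 1`; even powers avoid orientations. -/
def Coorientation.IsNormalized (ν : Coorientation n i) (b : Module.Basis (Fin n ⊕ Unit) ℝ V) :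
    Prop :=
  ∀ e ∈ IsManifold.maximalAtlas (𝓡 n) ∞ M, ∀ x ∈ e.target, ∀ v : V,
    ν.conormal (e.symm x) v = 1 →
      (b.toMatrix (Sum.elim (fun k ↦ pd k (fun y ↦ i (e.symm y)) x) (fun _ ↦ v))).det ^ 4 =
        (conormalComponents i ν.conormal e x).det ^ 2

/-- The determinant of the tangent vectors and a further vector `v` is a multiple of `ϑ(v)`. -/
theorem det_toMatrix_eq_mul (hi : IsHypersurfaceImmersion n i) (ν : Coorientation n i)
    (b : Module.Basis (Fin n ⊕ Unit) ℝ V)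
    (he : e ∈ IsManifold.maximalAtlas (𝓡 n) ∞ M) {x : EuclideanSpace ℝ (Fin n)}
    (hx : x ∈ e.target) {w : V} (hw : ν.conormal (e.symm x) w = 1) (v : V) :
    (b.toMatrix (Sum.elim (fun k ↦ pd k (fun y ↦ i (e.symm y)) x) (fun _ ↦ v))).det =
      (b.toMatrix (Sum.elim (fun k ↦ pd k (fun y ↦ i (e.symm y)) x) (fun _ ↦ w))).det *
        ν.conormal (e.symm x) v := by
  obtain ⟨X, hX⟩ := ν.exists_of_conormal_eq_zero (p := e.symm x)
    (v := v - ν.conormal (e.symm x) v • w) (by simp [hw])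
  rw [← sum_coordComponent he (e.map_target hx) X, map_sum] at hX
  simp only [map_smul, mvfderiv_coordField he hx (hi.smooth.mdifferentiable (by simp) _)] at hX
  have h1 := det_toMatrix_comb b (fun k ↦ pd k (fun y ↦ i (e.symm y)) x) w 1
    (coordComponent e (e.symm x) X) (ν.conormal (e.symm x) v)
  rw [hX, sub_add_cancel] at h1
  simpa [Matrix.one_apply] using h1

/-- Rescaling a conormal field by a positive function. -/
def Coorientation.rescale (ν : Coorientation n i) (φ : M → ℝ)
    (hφ : ContMDiff (𝓡 n) 𝓘(ℝ, ℝ) ∞ φ) (hpos : ∀ p, 0 < φ p) : Coorientation n i where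
  conormal p := φ p • ν.conormal p
  smooth := hφ.smul ν.smooth
  ker_eq p := by
    rw [← ν.ker_eq]
    ext v
    simp [(hpos p).ne']

theorem conormalForm_rescale (ν : Coorientation n i) (φ : M → ℝ)
    (hφ : ContMDiff (𝓡 n) 𝓘(ℝ, ℝ) ∞ φ) (p : M) (X Y : TangentSpace (𝓡 n) p) :
    conormalForm i (fun p ↦ φ p • ν.conormal p) p X Y = φ p * conormalForm i ν.conormal p X Y := by
  have h1 : mvfderiv (𝓡 n) (fun p ↦ φ p • ν.conormal p) p = _ :=
    mvfderiv_smul (hφ.mdifferentiable (by simp) p) (ν.smooth.mdifferentiable (by simp) p)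
  rw [conormalForm_apply, conormalForm_apply, h1]
  simp [ν.conormal_mvfderiv]

/-- Under a change of the frame of the tangent space by a matrix of determinant `a`, the frame
determinant is multiplied by `a` and the determinant of the conormal form by `a²`. The quotient of
the fourth power of the former by the square of the latter is therefore independent of charts. -/
theorem det_pow_mul_eq (hi : IsHypersurfaceImmersion n i) (ν : Coorientation n i)
    (b : Module.Basis (Fin n ⊕ Unit) ℝ V)
    (he : e ∈ IsManifold.maximalAtlas (𝓡 n) ∞ M) {x : EuclideanSpace ℝ (Fin n)}
    (hx : x ∈ e.target) (w : V) (ε : Fin n → TangentSpace (𝓡 n) (e.symm x))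
    (hε : ∀ X : TangentSpace (𝓡 n) (e.symm x), ∃ c : Fin n → ℝ, X = ∑ j, c j • ε j) :
    ∃ a : ℝ, a ≠ 0 ∧
      (b.toMatrix (Sum.elim (fun k ↦ pd k (fun y ↦ i (e.symm y)) x) (fun _ ↦ w))).det =
        (b.toMatrix (Sum.elim (fun k ↦ mvfderiv (𝓡 n) i (e.symm x) (ε k)) (fun _ ↦ w))).det * a ∧
      (conormalComponents i ν.conormal e x).det =
        (Matrix.of fun j k ↦ conormalForm i ν.conormal (e.symm x) (ε j) (ε k)).det * a ^ 2 := by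
  choose A hA using fun k ↦ hε (coordField e k (e.symm x))
  have hdet : (Matrix.of fun j k ↦ A k j).det ≠ 0 := by
    intro h0
    obtain ⟨c, hc, hc0⟩ := Matrix.exists_mulVec_eq_zero_iff.2 h0
    refine hc (funext fun k ↦ ?_)
    rw [← coordComponent_sum he (e.map_target hx) c k]
    have : ∑ j, c j • coordField e j (e.symm x) = 0 := by
      have h1 : ∀ l, ∑ j, c j * A j l = 0 := by
        intro l
        have := congrFun hc0 l
        simpa [Matrix.mulVec, dotProduct, mul_comm] using this
      calc ∑ j, c j • coordField e j (e.symm x)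
          = ∑ j, ∑ l, (c j * A j l) • ε l := by
            refine Finset.sum_congr rfl fun j _ ↦ ?_
            rw [hA j, Finset.smul_sum]
            simp only [smul_smul]
        _ = ∑ l, (∑ j, c j * A j l) • ε l := by
            rw [Finset.sum_comm]
            simp only [Finset.sum_smul]
        _ = 0 := by simp [h1]
    rw [this]
    simp [coordComponent]
    rfl
  refine ⟨_, hdet, ?_, ?_⟩
  · have h1 := det_toMatrix_comb b (fun k ↦ mvfderiv (𝓡 n) i (e.symm x) (ε k)) w
      (Matrix.of fun j k ↦ A k j) 0 1
    simp only [Pi.zero_apply, zero_smul, Finset.sum_const_zero, zero_add, one_smul, mul_one,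
      Matrix.of_apply] at h1
    rw [← h1]
    congr 3
    funext k
    rw [← mvfderiv_coordField he hx (hi.smooth.mdifferentiable (by simp) _), hA k, map_sum]
    simp only [map_smul]
  · have h1 : conormalComponents i ν.conormal e x =
        (Matrix.of fun j k ↦ A k j).transpose *
          (Matrix.of fun j k ↦ conormalForm i ν.conormal (e.symm x) (ε j) (ε k)) *
          (Matrix.of fun j k ↦ A k j) := by
      ext j k
      rw [conormalComponents, hA j, hA k]
      simp only [map_sum, map_smul, sum_apply, smul_apply, smul_eq_mul, Matrix.mul_apply,
        Matrix.of_apply, Matrix.transpose_apply, mul_comm (A k _)]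
    rw [h1, Matrix.det_mul, Matrix.det_mul, Matrix.det_transpose]
    ring

variable [IsManifold (𝓡 n) ∞ M]

theorem det_conormalComponents_ne_zero (hi : IsHypersurfaceImmersion n i)
    (hnd : IsNondegenerate n i) (ν : Coorientation n i)
    (he : e ∈ IsManifold.maximalAtlas (𝓡 n) ∞ M) {x : EuclideanSpace ℝ (Fin n)}
    (hx : x ∈ e.target) : (conormalComponents i ν.conormal e x).det ≠ 0 :=
  det_components_ne_zero he (conormalMetric hi hnd ν) hx

/-- Every co-orientation contains a normalized conormal field. -/
theorem Coorientation.exists_isNormalized (hi : IsHypersurfaceImmersion n i)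
    (hnd : IsNondegenerate n i) (ν : Coorientation n i)
    (b : Module.Basis (Fin n ⊕ Unit) ℝ V) :
    ∃ (μ : Coorientation n i) (φ : M → ℝ), μ.IsNormalized b ∧ (∀ p, 0 < φ p) ∧
      ∀ p, μ.conormal p = φ p • ν.conormal p := by
  obtain ⟨ζ, hζ, hζ1⟩ := ν.exists_section hi
  have hζt := ν.isTransversal_of_eq_one hζ hζ1
  -- Each tangent space is definitionally `ℝⁿ`; its standard basis `ε` depends on `p` in no smooth
  -- way, but the quotient `Φ` does not depend on the choice of a basis.
  set ε : Fin n → EuclideanSpace ℝ (Fin n) := fun k ↦ EuclideanSpace.single k 1 with hε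
  set Φ : M → ℝ := fun p ↦
    (b.toMatrix (Sum.elim (fun k ↦ mvfderiv (𝓡 n) i p (ε k)) (fun _ ↦ ζ p))).det ^ 4 /
      (Matrix.of fun j k ↦ conormalForm i ν.conormal p (ε j) (ε k)).det ^ 2 with hΦ
  have hchart : ∀ e ∈ IsManifold.maximalAtlas (𝓡 n) ∞ M, ∀ x ∈ e.target, Φ (e.symm x) =
      frameDet b (fun y ↦ i (e.symm y)) (fun y ↦ ζ (e.symm y)) x ^ 4 /
        (conormalComponents i ν.conormal e x).det ^ 2 := by
    intro e he x hx
    obtain ⟨a, ha, h1, h2⟩ := det_pow_mul_eq hi ν b he hx (ζ (e.symm x)) ε (fun X ↦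
      ⟨fun j ↦ EuclideanSpace.proj (𝕜 := ℝ) j X,
        map_eq_sum_single (ContinuousLinearMap.id ℝ (EuclideanSpace ℝ (Fin n))) X⟩)
    rw [frameDet, frameVec, h1, h2, mul_pow, mul_pow, ← pow_mul]
    exact (mul_div_mul_right _ _ (pow_ne_zero 4 ha)).symm
  have hpos : ∀ p, 0 < Φ p := by
    intro p
    set e := chartAt (EuclideanSpace ℝ (Fin n)) p with hedef
    have he : e ∈ IsManifold.maximalAtlas (𝓡 n) ∞ M := IsManifold.chart_mem_maximalAtlas p
    have hp := mem_chart_source (EuclideanSpace ℝ (Fin n)) p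
    rw [← e.left_inv hp, hchart e he _ (e.map_source hp)]
    have h1 := (isAdaptedFrame hi hζt he).det_ne_zero b (e.map_source hp)
    have h2 := det_conormalComponents_ne_zero hi hnd ν he (e.map_source hp)
    exact div_pos (Even.pow_pos (by decide) h1) (Even.pow_pos (by decide) h2)
  -- Rescaling the conormal by `φ` multiplies `det(…, v)⁴` by `φ⁻⁴`, because `v` is divided by `φ`,
  -- and `(det h)²` by `φ²ⁿ`; the normalization therefore requires `φ²ⁿ⁺⁴ = Φ`.
  have hsmooth : ContMDiff (𝓡 n) 𝓘(ℝ, ℝ) ∞ fun p ↦ Φ p ^ (1 / (2 * n + 4 : ℝ)) := by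
    refine contMDiff_of_contDiffOn_comp_symm fun e he ↦ ?_
    refine ContDiffOn.rpow_const_of_ne ?_ fun x _ ↦ (hpos _).ne'
    have h1 := contDiffOn_det ((isAdaptedFrame hi hζt he).contDiffOn_toMatrix b)
    have h2 := contDiffOn_det (contDiffOn_conormalComponents hi ν he)
    exact ((h1.pow 4).div (h2.pow 2) fun x hx ↦
      pow_ne_zero 2 (det_conormalComponents_ne_zero hi hnd ν he hx)).congr fun x hx ↦
        hchart e he x hx
  have hφpos : ∀ p, 0 < Φ p ^ (1 / (2 * n + 4 : ℝ)) := fun p ↦ Real.rpow_pos_of_pos (hpos p) _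
  refine ⟨ν.rescale _ hsmooth hφpos, _, ?_, hφpos, fun p ↦ rfl⟩
  intro e he x hx v hv
  set φ : ℝ := Φ (e.symm x) ^ (1 / (2 * n + 4 : ℝ)) with hφ
  have hφ0 : 0 < φ := hφpos _
  have hv' : φ * ν.conormal (e.symm x) v = 1 := hv
  have hpow : φ ^ (2 * n + 4) = Φ (e.symm x) := by
    rw [hφ, ← Real.rpow_natCast, ← Real.rpow_mul (hpos _).le]
    have h0 : (2 * n + 4 : ℝ) ≠ 0 := by positivity
    push_cast
    rw [one_div_mul_cancel h0, Real.rpow_one]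
  have h3 : conormalComponents i (ν.rescale _ hsmooth hφpos).conormal e x =
      φ • conormalComponents i ν.conormal e x := by
    ext j k
    exact conormalForm_rescale ν _ hsmooth _ _ _
  have h4 := (det_conormalComponents_ne_zero hi hnd ν he hx)
  rw [h3, Matrix.det_smul, Fintype.card_fin, det_toMatrix_eq_mul hi ν b he hx (hζ1 _) v]
  rw [hchart e he x hx, eq_div_iff (pow_ne_zero 2 h4), frameDet, frameVec] at hpow
  rw [mul_pow, ← hpow, mul_pow, ← pow_mul]
  have h5 : φ ^ (2 * n + 4) * ν.conormal (e.symm x) v ^ 4 = φ ^ (n * 2) := by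
    rw [pow_add, mul_assoc, ← mul_pow, hv', one_pow, mul_one, mul_comm 2 n]
  rw [← h5]
  ring

end Normalization

/-! ### The equiaffine transversal of a conormal field -/

section EquiaffineTransversal

variable {n : ℕ} {M : Type*} [TopologicalSpace M]
  [ChartedSpace (EuclideanSpace ℝ (Fin n)) M]
  {V : Type*} [NormedAddCommGroup V] [NormedSpace ℝ V] {i ξ : M → V}
  {e : OpenPartialHomeomorph M (EuclideanSpace ℝ (Fin n))}

theorem mvfderiv_conormal_eq_zero_of_coordField
    (he : e ∈ IsManifold.maximalAtlas (𝓡 n) ∞ M) (μ : Coorientation n i)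
    {x : EuclideanSpace ℝ (Fin n)} (hx : x ∈ e.target) {v : V}
    (h1 : ∀ k, pd k (fun y ↦ μ.conormal (e.symm y)) x v = 0)
    (X : TangentSpace (𝓡 n) (e.symm x)) :
    mvfderiv (𝓡 n) μ.conormal (e.symm x) X v = 0 := by
  rw [← sum_coordComponent he (e.map_target hx) X]
  simp only [map_sum, map_smul, sum_apply, smul_apply,
    mvfderiv_coordField he hx (μ.smooth.mdifferentiable (by simp) _), h1, smul_zero,
    Finset.sum_const_zero]

variable [IsManifold (𝓡 n) ∞ M]

theorem exists_chart (p : M) : ∃ e ∈ IsManifold.maximalAtlas (𝓡 n) ∞ M, ∃ x ∈ e.target,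
    p = e.symm x :=
  ⟨chartAt _ p, IsManifold.chart_mem_maximalAtlas p, _,
    (chartAt _ p).map_source (mem_chart_source _ p),
    ((chartAt (EuclideanSpace ℝ (Fin n)) p).left_inv (mem_chart_source _ p)).symm⟩

/-- The transversal `ξ` is the equiaffine transversal of the conormal field `ϑ`: `ϑ(ξ) = 1` and
`(dϑ)(ξ) = 0`. -/
structure Coorientation.IsEquiaffine (μ : Coorientation n i) (ξ : M → V) : Prop where
  eq_one : ∀ p, μ.conormal p (ξ p) = 1
  mvfderiv_eq_zero : ∀ (p : M) (X : TangentSpace (𝓡 n) p),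
    mvfderiv (𝓡 n) μ.conormal p X (ξ p) = 0

/-- For a non-degenerate hypersurface a vector is determined by the values of `ϑ` and `dϑ` on it:
if `ϑ` vanishes on it, it is tangent, and on tangent vectors `-dϑ` is the metric. -/
theorem eq_zero_of_conormal_eq_zero (hi : IsHypersurfaceImmersion n i)
    (hnd : IsNondegenerate n i) (μ : Coorientation n i) {p : M} {v : V}
    (h0 : μ.conormal p v = 0) (h1 : ∀ X, mvfderiv (𝓡 n) μ.conormal p X v = 0) : v = 0 := by
  obtain ⟨Y, rfl⟩ := μ.exists_of_conormal_eq_zero h0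
  have : Y = 0 := (conormalMetric hi hnd μ).nondegenerate p Y fun X ↦ by
    rw [(conormalMetric hi hnd μ).symm]
    exact (conormalForm_apply i μ.conormal p X Y).trans (by rw [h1, neg_zero])
  rw [this, map_zero]

/-- The equiaffine transversal exists: its defining equations are linear, uniquely solvable because
the hypersurface is non-degenerate, and solved smoothly by Cramer's rule. -/
theorem Coorientation.exists_isEquiaffine (hi : IsHypersurfaceImmersion n i)
    (hnd : IsNondegenerate n i) (μ : Coorientation n i) :
    ∃ ξ : M → V, ContMDiff (𝓡 n) 𝓘(ℝ, V) ∞ ξ ∧ μ.IsEquiaffine ξ := by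
  obtain ⟨b⟩ := exists_basis_of_finrank_eq hi.finrank_eq
  -- the functionals `∂ₖϑ` and `ϑ` on the basis vectors
  set A : OpenPartialHomeomorph M (EuclideanSpace ℝ (Fin n)) → EuclideanSpace ℝ (Fin n) →
      Matrix (Fin n ⊕ Unit) (Fin n ⊕ Unit) ℝ := fun e x ↦ Matrix.of fun r q ↦
    Sum.elim (fun k ↦ pd k (fun y ↦ μ.conormal (e.symm y)) x (b q))
      (fun _ ↦ μ.conormal (e.symm x) (b q)) r with hA
  have hcomb : ∀ e x (c : Fin n ⊕ Unit → ℝ),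
      (∀ k, (A e x).mulVec c (Sum.inl k) =
        pd k (fun y ↦ μ.conormal (e.symm y)) x (∑ q, c q • b q)) ∧
      (A e x).mulVec c (Sum.inr ()) = μ.conormal (e.symm x) (∑ q, c q • b q) := by
    intro e x c
    constructor
    · intro k
      simp only [Matrix.mulVec, dotProduct, hA, Matrix.of_apply, Sum.elim_inl, map_sum, map_smul,
        smul_eq_mul, mul_comm]
    · simp only [Matrix.mulVec, dotProduct, hA, Matrix.of_apply, Sum.elim_inr, map_sum, map_smul,
        smul_eq_mul, mul_comm]
  have hdet : ∀ e ∈ IsManifold.maximalAtlas (𝓡 n) ∞ M, ∀ x ∈ e.target, (A e x).det ≠ 0 := by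
    intro e he x hx h0
    obtain ⟨c, hc, hc0⟩ := Matrix.exists_mulVec_eq_zero_iff.2 h0
    have h1 := hcomb e x c
    rw [hc0] at h1
    have h2 := eq_zero_of_conormal_eq_zero hi hnd μ h1.2.symm
      (mvfderiv_conormal_eq_zero_of_coordField he μ hx fun k ↦ (h1.1 k).symm)
    exact hc (funext fun q ↦ Fintype.linearIndependent_iff.1 b.linearIndependent c h2 q)
  set sol : OpenPartialHomeomorph M (EuclideanSpace ℝ (Fin n)) → EuclideanSpace ℝ (Fin n) → V :=
    fun e x ↦ ∑ q, (A e x)⁻¹ q (Sum.inr ()) • b q with hsol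
  have hsol' : ∀ e ∈ IsManifold.maximalAtlas (𝓡 n) ∞ M, ∀ x ∈ e.target,
      μ.conormal (e.symm x) (sol e x) = 1 ∧
        ∀ X, mvfderiv (𝓡 n) μ.conormal (e.symm x) X (sol e x) = 0 := by
    intro e he x hx
    have h1 := hcomb e x fun q ↦ (A e x)⁻¹ q (Sum.inr ())
    have h2 : (A e x).mulVec (fun q ↦ (A e x)⁻¹ q (Sum.inr ())) =
        fun r ↦ (1 : Matrix (Fin n ⊕ Unit) (Fin n ⊕ Unit) ℝ) r (Sum.inr ()) := by
      rw [← Matrix.mul_nonsing_inv _ (hdet e he x hx).isUnit]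
      rfl
    rw [h2] at h1
    exact ⟨h1.2.symm.trans (Matrix.one_apply_eq _),
      mvfderiv_conormal_eq_zero_of_coordField he μ hx fun k ↦
        (h1.1 k).symm.trans (Matrix.one_apply_ne Sum.inl_ne_inr)⟩
  have hex : ∀ p : M, ∃ v, μ.conormal p v = 1 ∧
      ∀ X, mvfderiv (𝓡 n) μ.conormal p X v = 0 := by
    intro p
    obtain ⟨e, he, x, hx, rfl⟩ := exists_chart (n := n) p
    exact ⟨_, hsol' e he x hx⟩
  choose ξ hξ1 hξ2 using hex
  refine ⟨ξ, contMDiff_of_contDiffOn_comp_symm fun e he ↦ ?_, hξ1, hξ2⟩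
  have hsm : ContDiffOn ℝ ∞ (sol e) e.target := by
    refine ContDiffOn.sum fun q _ ↦ ContDiffOn.smul ?_ contDiffOn_const
    refine contDiffOn_matrix_inv (fun r q ↦ ?_) (hdet e he) _ _
    have hθ := contDiffOn_comp_symm he μ.smooth
    rcases r with k | u
    · exact (contDiffOn_pd hθ e.open_target k).clm_apply contDiffOn_const
    · exact hθ.clm_apply contDiffOn_const
  refine hsm.congr fun x hx ↦ ?_
  refine sub_eq_zero.1 (eq_zero_of_conormal_eq_zero hi hnd μ (p := e.symm x) ?_ fun X ↦ ?_)
  · rw [map_sub, hξ1, (hsol' e he x hx).1, sub_self]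
  · rw [map_sub, hξ2, (hsol' e he x hx).2, sub_self]

/-- The logarithmic derivative of `W⁴ = aᵐ d²`. -/
theorem logarithmic_pd_eq {U : Set (EuclideanSpace ℝ (Fin n))} (hU : IsOpen U)
    {x : EuclideanSpace ℝ (Fin n)} (hx : x ∈ U) {W a d : EuclideanSpace ℝ (Fin n) → ℝ} {m : ℕ}
    (h : ∀ y ∈ U, W y ^ 4 = a y ^ m * d y ^ 2)
    (hW : DifferentiableAt ℝ W x) (ha : DifferentiableAt ℝ a x) (hd : DifferentiableAt ℝ d x)
    (hW0 : W x ≠ 0) (ha0 : a x ≠ 0) (hd0 : d x ≠ 0) (j : Fin n) :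
    4 * (pd j W x / W x) = m * (pd j a x / a x) + 2 * (pd j d x / d x) := by
  have hcont := ha.continuousAt.eventually_ne ha0
  have h1 : pd j (fun y ↦ 4 * Real.log (W y)) x =
      pd j (fun y ↦ m * Real.log (a y) + 2 * Real.log (d y)) x := by
    rw [pd, pd, Filter.EventuallyEq.fderiv_eq]
    filter_upwards [hU.mem_nhds hx, hcont, hd.continuousAt.eventually_ne hd0] with y hy hay hdy
    have := congrArg Real.log (h y hy)
    rw [Real.log_mul (pow_ne_zero _ hay) (pow_ne_zero _ hdy), Real.log_pow, Real.log_pow,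
      Real.log_pow] at this
    exact_mod_cast this
  have dW := hW.log hW0
  have da := ha.log ha0
  have dd := hd.log hd0
  rw [pd_add (da.const_mul _) (dd.const_mul _), pd_mul (differentiableAt_const _) dW,
    pd_mul (differentiableAt_const _) da, pd_mul (differentiableAt_const _) dd, pd_log hW hW0,
    pd_log ha ha0, pd_log hd hd0, pd_const, pd_const, pd_const] at h1
  linarith

/-- For a normalized conormal field `ϑ`, the connection and the metric induced by a transversal `ξ`
are aligned exactly if `(dϑ)(ξ) = 0`. Indeed `a = ϑ(ξ)` satisfies `da = a τ + (dϑ)(ξ)`, and the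
normalization reads `W ^ 4 = a ^ (2 n + 4) (det h) ^ 2` for the determinant `W` of the frame, so
that `alignedAt_iff_log` becomes `(n + 2) τ = (n + 2) da / a`. -/
theorem alignedAt_iff_pd_conormal (hn : 1 < n) (hi : IsHypersurfaceImmersion n i)
    {μ : Coorientation n i} {b : Module.Basis (Fin n ⊕ Unit) ℝ V} (hμ : μ.IsNormalized b)
    {D : TorsionFreeConnection n M} {h : PseudoMetric n M} (H : Induces i ξ D h)
    (he : e ∈ IsManifold.maximalAtlas (𝓡 n) ∞ M) {x : EuclideanSpace ℝ (Fin n)}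
    (hx : x ∈ e.target) :
    AlignedAt (D.christoffel e) (h.components e) x ↔
      ∀ j, pd j (fun y ↦ μ.conormal (e.symm y)) x (ξ (e.symm x)) = 0 := by
  obtain ⟨S, τ, G⟩ := H.exists_gaussWeingarten hi he
  have hfd : FiniteDimensional ℝ V := b.finiteDimensional_of_finite
  set θ : EuclideanSpace ℝ (Fin n) → V →L[ℝ] ℝ := fun y ↦ μ.conormal (e.symm y) with hθ
  set a : EuclideanSpace ℝ (Fin n) → ℝ := fun y ↦ θ y (ξ (e.symm y)) with ha
  have hθs : ContDiffOn ℝ ∞ θ e.target := contDiffOn_comp_symm he μ.smooth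
  have has : ContDiffOn ℝ ∞ a e.target := hθs.clm_apply G.contDiffOn_transversal
  have ha0 : ∀ y, a y ≠ 0 := by
    intro y h0
    apply H.1.2 (e.symm y)
    rw [← μ.ker_eq]
    exact h0
  have htan : ∀ y ∈ e.target, ∀ k, θ y (pd k (fun y ↦ i (e.symm y)) y) = 0 := by
    intro y hy k
    rw [← mvfderiv_coordField he hy (hi.smooth.mdifferentiable (by simp) _)]
    exact μ.conormal_mvfderiv _ _
  have hda : ∀ j, pd j a x = τ x j * a x + pd j θ x (ξ (e.symm x)) := by
    intro j
    rw [ha, pd_clm_apply (differentiableAt_of_contDiffOn hθs e.open_target hx)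
      (differentiableAt_of_contDiffOn G.contDiffOn_transversal e.open_target hx),
      G.weingarten x hx]
    simp only [map_add, map_sum, map_smul, htan x hx, smul_eq_mul, mul_zero,
      Finset.sum_const_zero, zero_add]
  have hcomp : ∀ y ∈ e.target, conormalComponents i μ.conormal e y = a y • h.components e y := by
    intro y hy
    ext j k
    have h0 := pd_clm_apply (differentiableAt_of_contDiffOn hθs e.open_target hy)
      (differentiableAt_of_contDiffOn (contDiffOn_pd G.contDiffOn_map e.open_target k)
        e.open_target hy) j
    rw [pd_congr e.open_target (g := fun _ ↦ (0 : ℝ)) (fun z hz ↦ htan z hz k) hy, pd_const,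
      G.gauss y hy] at h0
    simp only [map_add, map_sum, map_smul, htan y hy, smul_eq_mul, mul_zero,
      Finset.sum_const_zero, zero_add] at h0
    rw [conormalComponents, conormalForm_coordField hi μ he hy, Matrix.smul_apply, smul_eq_mul]
    linarith
  have hpow : ∀ y ∈ e.target, frameDet b (fun y ↦ i (e.symm y)) (fun y ↦ ξ (e.symm y)) y ^ 4 =
      a y ^ (2 * n + 4) * (h.components e y).det ^ 2 := by
    intro y hy
    have hw : μ.conormal (e.symm y) ((a y)⁻¹ • ξ (e.symm y)) = 1 := by
      rw [map_smul, smul_eq_mul]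
      exact inv_mul_cancel₀ (ha0 y)
    have h0 := hμ e he y hy _ hw
    rw [frameDet, frameVec, det_toMatrix_eq_mul hi μ b he hy hw, mul_pow, h0, hcomp y hy,
      Matrix.det_smul, Fintype.card_fin]
    change (a y ^ n * _) ^ 2 * a y ^ 4 = _
    ring
  have hW0 : frameDet b (fun y ↦ i (e.symm y)) (fun y ↦ ξ (e.symm y)) x ≠ 0 :=
    G.toIsAdaptedFrame.det_ne_zero b hx
  have hlog := logarithmic_pd_eq e.open_target hx hpow
    (differentiableAt_of_contDiffOn (contDiffOn_det (G.contDiffOn_toMatrix b)) e.open_target hx)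
    (differentiableAt_of_contDiffOn has e.open_target hx)
    (differentiableAt_of_contDiffOn (contDiffOn_det G.contDiffOn_metric) e.open_target hx)
    hW0 (ha0 x) (G.det_ne_zero x hx)
  rw [G.alignedAt_iff_log b hn hx]
  refine forall_congr' fun j ↦ ?_
  have h1 := hlog j
  rw [hda j, add_div, mul_div_cancel_right₀ _ (ha0 x)] at h1
  push_cast at h1
  have hn0 : (n + 2 : ℝ) ≠ 0 := by positivity
  constructor
  · intro h2
    have h3 : (n + 2 : ℝ) * (pd j θ x (ξ (e.symm x)) / a x) = 0 := by linarith
    exact (div_eq_zero_iff.1 ((mul_eq_zero.1 h3).resolve_left hn0)).resolve_right (ha0 x)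
  · intro h2
    rw [h2, zero_div] at h1
    linarith

theorem isAligned_iff_mvfderiv_conormal (hn : 1 < n) (hi : IsHypersurfaceImmersion n i)
    {μ : Coorientation n i} {b : Module.Basis (Fin n ⊕ Unit) ℝ V} (hμ : μ.IsNormalized b)
    {D : TorsionFreeConnection n M} {h : PseudoMetric n M} (H : Induces i ξ D h) :
    IsAligned D h ↔ ∀ (p : M) (X : TangentSpace (𝓡 n) p),
      mvfderiv (𝓡 n) μ.conormal p X (ξ p) = 0 := by
  constructor
  · intro h1 p
    obtain ⟨e, he, x, hx, rfl⟩ := exists_chart (n := n) p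
    exact mvfderiv_conormal_eq_zero_of_coordField he μ hx
      ((alignedAt_iff_pd_conormal hn hi hμ H he hx).1 (h1 e he x hx))
  · intro h1 e he x hx
    refine (alignedAt_iff_pd_conormal hn hi hμ H he hx).2 fun j ↦ ?_
    rw [← mvfderiv_coordField he hx (μ.smooth.mdifferentiable (by simp) _)]
    exact h1 _ _

/-- A transversal for which the induced connection is aligned with the induced metric is a
multiple of the equiaffine transversal of a normalized conormal field. -/
theorem eq_smul_of_isAligned (hn : 1 < n) (hi : IsHypersurfaceImmersion n i)
    (hnd : IsNondegenerate n i)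
    {μ : Coorientation n i} {b : Module.Basis (Fin n ⊕ Unit) ℝ V} (hμ : μ.IsNormalized b)
    {ζ : M → V} (hζ : μ.IsEquiaffine ζ)
    {D : TorsionFreeConnection n M} {h : PseudoMetric n M} (H : Induces i ξ D h)
    (ha : IsAligned D h) (p : M) : ξ p = μ.conormal p (ξ p) • ζ p := by
  have h1 := (isAligned_iff_mvfderiv_conormal hn hi hμ H).1 ha
  refine sub_eq_zero.1 (eq_zero_of_conormal_eq_zero hi hnd μ (p := p) ?_ fun X ↦ ?_)
  · rw [map_sub, map_smul, hζ.eq_one, smul_eq_mul, mul_one, sub_self]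
  · rw [map_sub, map_smul, hζ.mvfderiv_eq_zero, h1, smul_zero, sub_zero]

/-- The shape operator of the equiaffine transversal: there is no transversal component. -/
theorem Coorientation.IsEquiaffine.exists_gaussWeingarten {μ : Coorientation n i}
    (hi : IsHypersurfaceImmersion n i) (hξ : μ.IsEquiaffine ξ)
    {D : TorsionFreeConnection n M} {h : PseudoMetric n M} (H : Induces i ξ D h)
    (he : e ∈ IsManifold.maximalAtlas (𝓡 n) ∞ M) :
    ∃ S : EuclideanSpace ℝ (Fin n) → Matrix (Fin n) (Fin n) ℝ,
      GaussWeingarten e.target (fun y ↦ i (e.symm y)) (fun y ↦ ξ (e.symm y))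
        (D.christoffel e) (h.components e) S 0 := by
  obtain ⟨S, τ, G⟩ := H.exists_gaussWeingarten hi he
  refine ⟨S, { G with weingarten := fun x hx j ↦ ?_ }⟩
  have hν := contDiffOn_comp_symm he μ.smooth
  have h0 := pd_clm_apply (differentiableAt_of_contDiffOn hν e.open_target hx)
    (differentiableAt_of_contDiffOn G.contDiffOn_transversal e.open_target hx) j
  have h1 : (fun y ↦ μ.conormal (e.symm y) (ξ (e.symm y))) = fun _ ↦ 1 :=
    funext fun y ↦ hξ.eq_one _
  have htan : ∀ k, μ.conormal (e.symm x) (pd k (fun y ↦ i (e.symm y)) x) = 0 := by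
    intro k
    rw [← mvfderiv_coordField he hx (hi.smooth.mdifferentiable (by simp) _)]
    exact μ.conormal_mvfderiv _ _
  rw [h1, pd_const, ← mvfderiv_coordField he hx (μ.smooth.mdifferentiable (by simp) _),
    hξ.mvfderiv_eq_zero, add_zero, G.weingarten x hx] at h0
  simp only [map_add, map_sum, map_smul, htan, smul_eq_mul, mul_zero,
    Finset.sum_const_zero, zero_add, hξ.eq_one, mul_one] at h0
  rw [G.weingarten x hx, ← h0]
  rfl

end EquiaffineTransversal

/-! ### The aligned representative of a projective structure -/

section AlignedRepresentative

variable {n : ℕ}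

theorem sum_sum_inv_mul_left {h : Matrix (Fin n) (Fin n) ℝ} (hd : h.det ≠ 0) (c : Fin n → ℝ)
    (i : Fin n) : ∑ p, ∑ q, h⁻¹ p q * (c p * h q i) = c i := by
  simp only [mul_left_comm _ (c _), ← Finset.mul_sum, sum_inv_mul hd]
  simp

theorem sum_sum_inv_mul_right {h : Matrix (Fin n) (Fin n) ℝ} (hd : h.det ≠ 0)
    (hs : ∀ i j, h i j = h j i) (c : Fin n → ℝ) (i : Fin n) :
    ∑ p, ∑ q, h⁻¹ p q * (c q * h p i) = c i := by
  rw [Finset.sum_comm, ← sum_sum_inv_mul_left hd c i]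
  exact Finset.sum_congr rfl fun q _ ↦ Finset.sum_congr rfl fun p _ ↦ by rw [inv_symm_of_symm hs]

variable {Γ Γ' : EuclideanSpace ℝ (Fin n) → Fin n → Fin n → Fin n → ℝ}
  {h h' : EuclideanSpace ℝ (Fin n) → Matrix (Fin n) (Fin n) ℝ}
  {f : EuclideanSpace ℝ (Fin n) → ℝ} {α : Fin n → ℝ}
  {U : Set (EuclideanSpace ℝ (Fin n))} {x : EuclideanSpace ℝ (Fin n)}

theorem covDerivTwoTensor_of_projective_conformal (hU : IsOpen U) (hx : x ∈ U)
    (hΓ : ∀ i j k, Γ' x i j k =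
      Γ x i j k + ((if j = k then α i else 0) + (if i = k then α j else 0)))
    (hh : ∀ y ∈ U, h' y = f y • h y) (hf : DifferentiableAt ℝ f x)
    (hd : ∀ j k, DifferentiableAt ℝ (fun y ↦ h y j k) x) (i j k : Fin n) :
    covDerivTwoTensor Γ' 0 h' x i j k =
      f x * covDerivTwoTensor Γ 0 h x i j k -
        f x * (2 * (α i * h x j k) + α j * h x i k + α k * h x j i) + pd i f x * h x j k := by
  have e1 : pd i (fun y ↦ h' y j k) x = f x * pd i (fun y ↦ h y j k) x + pd i f x * h x j k := by
    rw [pd_congr hU (g := fun y ↦ f y * h y j k) (fun y hy ↦ by simp [hh y hy]) hx,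
      pd_mul hf (hd j k)]
  simp only [covDerivTwoTensor, partialDeriv_eq_pd, e1, hΓ, hh x hx, Matrix.smul_apply,
    smul_eq_mul, add_mul, ite_mul, zero_mul, Finset.sum_add_distrib, Finset.sum_ite_eq,
    Finset.mem_univ, if_true, sub_zero, mul_left_comm _ (f x), ← Finset.mul_sum]
  ring

/-- A change of the connection by a one-form `α` within its projective class changes the alignment
condition by `(n + 2)(n - 1) α`, whereas the choice of a metric in its conformal class does not
matter. -/
theorem eq_zero_of_alignedAt (hn : 1 < n) (hU : IsOpen U) (hx : x ∈ U)
    (hΓ : ∀ i j k, Γ' x i j k =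
      Γ x i j k + ((if j = k then α i else 0) + (if i = k then α j else 0)))
    (hh : ∀ y ∈ U, h' y = f y • h y) (hf : DifferentiableAt ℝ f x) (hf0 : f x ≠ 0)
    (hd : ∀ j k, DifferentiableAt ℝ (fun y ↦ h y j k) x) (hdet : (h x).det ≠ 0)
    (hs : ∀ j k, h x j k = h x k j)
    (ha : AlignedAt Γ h x) (ha' : AlignedAt Γ' h' x) : α = 0 := by
  funext i
  have h1 := ha i
  have h2 := ha' i
  have hinv : (h' x)⁻¹ = (f x)⁻¹ • (h x)⁻¹ := by rw [hh x hx, matrix_inv_smul hf0 hdet]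
  have e0 := sum_sum_inv_self hdet hs
  have e1 := sum_sum_inv_mul_left hdet α i
  have e2 := sum_sum_inv_mul_right hdet hs α i
  have e3 := sum_sum_inv_mul_left hdet (fun p ↦ pd p f x) i
  set g := (h x)⁻¹ with hg
  set T := covDerivTwoTensor Γ 0 h x with hT
  have a1 : ∑ p, ∑ q, (h' x)⁻¹ p q * covDerivTwoTensor Γ' 0 h' x i p q =
      ∑ p, ∑ q, g p q * T i p q - (2 * n + 2) * α i + n * ((f x)⁻¹ * pd i f x) := by
    have : ∀ p q, (h' x)⁻¹ p q * covDerivTwoTensor Γ' 0 h' x i p q =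
        g p q * T i p q - 2 * α i * (g p q * h x p q) - g p q * (α p * h x q i) -
          g p q * (α q * h x p i) + ((f x)⁻¹ * pd i f x) * (g p q * h x p q) := by
      intro p q
      rw [covDerivTwoTensor_of_projective_conformal hU hx hΓ hh hf hd, hinv, Matrix.smul_apply,
        smul_eq_mul, hs i q]
      field_simp
      ring
    simp only [this, Finset.sum_add_distrib, Finset.sum_sub_distrib, ← Finset.mul_sum, e0, e1, e2]
    ring
  have a2 : ∑ p, ∑ q, (h' x)⁻¹ p q * covDerivTwoTensor Γ' 0 h' x p q i =
      ∑ p, ∑ q, g p q * T p q i - (n + 3) * α i + (f x)⁻¹ * pd i f x := by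
    have : ∀ p q, (h' x)⁻¹ p q * covDerivTwoTensor Γ' 0 h' x p q i =
        g p q * T p q i - 2 * (g p q * (α p * h x q i)) - g p q * (α q * h x p i) -
          α i * (g p q * h x p q) + (f x)⁻¹ * (g p q * (pd p f x * h x q i)) := by
      intro p q
      rw [covDerivTwoTensor_of_projective_conformal hU hx hΓ hh hf hd, hinv, Matrix.smul_apply,
        smul_eq_mul, hs q p]
      field_simp
      ring
    simp only [this, Finset.sum_add_distrib, Finset.sum_sub_distrib, ← Finset.mul_sum, e0, e1, e2,
      e3]
    ring
  rw [a1, a2, h1] at h2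
  have hn1 : (1 : ℝ) < n := by exact_mod_cast hn
  have h3 : ((n : ℝ) + 2) * (n - 1) * α i = 0 := by linarith
  have h4 : ((n : ℝ) + 2) * (n - 1) ≠ 0 := mul_ne_zero (by positivity) (by linarith)
  exact (mul_eq_zero.1 h3).resolve_left h4

variable {M : Type*} [TopologicalSpace M]
  [ChartedSpace (EuclideanSpace ℝ (Fin n)) M] [IsManifold (𝓡 n) ∞ M]
  {e : OpenPartialHomeomorph M (EuclideanSpace ℝ (Fin n))}

theorem PseudoMetric.contDiffOn_components (h : PseudoMetric n M)
    (he : e ∈ IsManifold.maximalAtlas (𝓡 n) ∞ M) (j k : Fin n) :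
    ContDiffOn ℝ ∞ (fun x ↦ h.components e x j k) e.target := by
  have h1 : ContMDiffOn (𝓡 n) 𝓘(ℝ, ℝ) ∞
      (fun q ↦ h.val q (coordField e j q) (coordField e k q)) e.source := by
    intro q hq
    refine ContMDiffAt.contMDiffWithinAt ?_
    have h2 : ContMDiffAt (𝓡 n) ((𝓡 n).prod 𝓘(ℝ)) ∞
        (fun m ↦ Bundle.TotalSpace.mk' ℝ (E := Bundle.Trivial M ℝ) m
          (h.val m (coordField e j m) (coordField e k m))) q := by
      apply ContMDiffAt.clm_bundle_apply₂ (F₁ := EuclideanSpace ℝ (Fin n))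
        (F₂ := EuclideanSpace ℝ (Fin n))
      · exact h.smooth q
      · exact contMDiffAt_coordField he hq j
      · exact contMDiffAt_coordField he hq k
    exact ((Bundle.contMDiffAt_totalSpace).1 h2).2
  rw [← contMDiffOn_iff_contDiffOn]
  exact h1.comp (contMDiffOn_symm_of_mem_maximalAtlas he) fun x hx ↦ e.map_target hx

theorem PseudoMetric.components_symm (h : PseudoMetric n M) (x : EuclideanSpace ℝ (Fin n))
    (j k : Fin n) : h.components e x j k = h.components e x k j :=
  h.symm _ _ _

theorem christoffel_of_projectivelyEquivalent {D D' : TorsionFreeConnection n M}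
    (H : ProjectivelyEquivalent D D') (he : e ∈ IsManifold.maximalAtlas (𝓡 n) ∞ M) :
    ∃ α : EuclideanSpace ℝ (Fin n) → Fin n → ℝ, ∀ x ∈ e.target, ∀ i j k,
      D'.christoffel e x i j k = D.christoffel e x i j k +
        ((if j = k then α x i else 0) + (if i = k then α x j else 0)) := by
  obtain ⟨α, hα⟩ := H
  refine ⟨fun x i ↦ α (e.symm x) (coordField e i (e.symm x)), fun x hx i j k ↦ ?_⟩
  have hs := e.map_target hx
  set L : TangentSpace (𝓡 n) (e.symm x) →L[ℝ] ℝ :=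
    (EuclideanSpace.proj (𝕜 := ℝ) k).comp (mfderiv (𝓡 n) (𝓡 n) e (e.symm x)) with hL
  have h1 : ∀ X, coordComponent e (e.symm x) X k = L X := fun X ↦ rfl
  have h2 : ∀ j, L (coordField e j (e.symm x)) = if j = k then 1 else 0 := fun j ↦
    coordComponent_coordField he hs j k
  rw [TorsionFreeConnection.christoffel, TorsionFreeConnection.christoffel,
    hα _ _ (isDifferentiableAt_coordField he hs j), h1, h1]
  simp only [map_add, map_smul, h2, smul_eq_mul, mul_ite, mul_one, mul_zero]

theorem components_of_conformallyEquivalent {h h' : PseudoMetric n M}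
    (H : ConformallyEquivalent h h') :
    ∃ f : M → ℝ, (∀ p, 0 < f p) ∧
      ∀ (e : OpenPartialHomeomorph M (EuclideanSpace ℝ (Fin n))) (x : EuclideanSpace ℝ (Fin n)),
        h'.components e x = f (e.symm x) • h.components e x := by
  obtain ⟨f, hf, hh⟩ := H
  refine ⟨f, hf, fun e x ↦ ?_⟩
  ext j k
  simp only [PseudoMetric.components, hh]
  rfl

/-- The aligned representative of a projective structure is unique. -/
theorem christoffel_eq_of_isAligned (hn : 1 < n) {D D' : TorsionFreeConnection n M}
    {h h' : PseudoMetric n M} (HD : ProjectivelyEquivalent D D')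
    (Hh : ConformallyEquivalent h h') (ha : IsAligned D h) (ha' : IsAligned D' h')
    (he : e ∈ IsManifold.maximalAtlas (𝓡 n) ∞ M) {x : EuclideanSpace ℝ (Fin n)}
    (hx : x ∈ e.target) : D'.christoffel e x = D.christoffel e x := by
  obtain ⟨α, hα⟩ := christoffel_of_projectivelyEquivalent HD he
  obtain ⟨f, hf, hfh⟩ := components_of_conformallyEquivalent Hh
  have hn0 : (n : ℝ) ≠ 0 := by
    have : n ≠ 0 := by omega
    exact_mod_cast this
  -- the conformal factor is smooth because it is a trace
  have hfs : ContDiffOn ℝ ∞ (fun y ↦ f (e.symm y)) e.target := by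
    have h1 : ContDiffOn ℝ ∞ (fun y ↦ (n : ℝ)⁻¹ *
        ∑ p, ∑ q, (h.components e y)⁻¹ p q * h'.components e y p q) e.target :=
      contDiffOn_const.mul (ContDiffOn.sum fun p _ ↦ ContDiffOn.sum fun q _ ↦
        (contDiffOn_matrix_inv (h.contDiffOn_components he)
          (fun y hy ↦ det_components_ne_zero he h hy) p q).mul (h'.contDiffOn_components he p q))
    refine h1.congr fun y hy ↦ ?_
    have h2 := sum_sum_inv_self (det_components_ne_zero he h hy) (h.components_symm y)
    simp only [hfh, Matrix.smul_apply, smul_eq_mul, mul_left_comm _ (f _), ← Finset.mul_sum, h2]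
    field_simp
  have h0 : α x = 0 := eq_zero_of_alignedAt hn e.open_target hx (hα x hx) (fun y _ ↦ hfh e y)
    (differentiableAt_of_contDiffOn hfs e.open_target hx) (hf _).ne'
    (fun j k ↦ differentiableAt_of_contDiffOn (h.contDiffOn_components he j k) e.open_target hx)
    (det_components_ne_zero he h hx) (h.components_symm x) (ha e he x hx) (ha' e he x hx)
  funext i j k
  simp [hα x hx, h0]

theorem ricci_congr {Γ Γ' : EuclideanSpace ℝ (Fin n) → Fin n → Fin n → Fin n → ℝ}
    (hU : IsOpen U) (hx : x ∈ U) (h : ∀ y ∈ U, Γ y = Γ' y) : ricci Γ x = ricci Γ' x := by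
  have : curvature Γ x = curvature Γ' x := by
    funext i j k l
    have h1 : ∀ m a b c, pd m (fun y ↦ Γ y a b c) x = pd m (fun y ↦ Γ' y a b c) x :=
      fun m a b c ↦ pd_congr hU (fun y hy ↦ by rw [h y hy]) hx m
    simp only [curvature, partialDeriv_eq_pd, h x hx, h1]
  ext i j
  simp only [ricci, this]

end AlignedRepresentative

/-! ### The induced AH structure -/

section InducedAHStructure

variable {n : ℕ} {M : Type*} [TopologicalSpace M]
  [ChartedSpace (EuclideanSpace ℝ (Fin n)) M] [IsManifold (𝓡 n) ∞ M]
  {V : Type*} [NormedAddCommGroup V] [NormedSpace ℝ V] {i ξ ζ : M → V}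
  {D D' : TorsionFreeConnection n M} {h h' : PseudoMetric n M}

/-- Proportional transversals induce the same connection and proportional metrics. -/
theorem Induces.eq_of_smul (hi : IsHypersurfaceImmersion n i) (H : Induces i ξ D h)
    (H' : Induces i ζ D' h') {a : M → ℝ} (ha : ∀ p, ξ p = a p • ζ p) :
    (∀ (Y : ∀ p : M, TangentSpace (𝓡 n) p) (p : M), IsDifferentiableAt Y p →
      ∀ X, D.conn Y p X = D'.conn Y p X) ∧ ∀ p, h'.val p = a p • h.val p := by
  have key : ∀ (Y : ∀ p : M, TangentSpace (𝓡 n) p) (p : M), IsDifferentiableAt Y p →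
      ∀ X, D.conn Y p X = D'.conn Y p X ∧ h'.val p X (Y p) = a p * h.val p X (Y p) := by
    intro Y p hY X
    have h1 : mvfderiv (𝓡 n) i p (D.conn Y p X) + h.val p X (Y p) • a p • ζ p =
        mvfderiv (𝓡 n) i p (D'.conn Y p X) + h'.val p X (Y p) • ζ p := by
      rw [← ha]
      exact (H.2 Y p hY X).symm.trans (H'.2 Y p hY X)
    have h2 : mvfderiv (𝓡 n) i p (D.conn Y p X - D'.conn Y p X) =
        (h'.val p X (Y p) - a p * h.val p X (Y p)) • ζ p := by
      rw [map_sub, sub_smul, mul_comm, mul_smul, sub_eq_sub_iff_add_eq_add, h1, add_comm]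
    have h3 : h'.val p X (Y p) - a p * h.val p X (Y p) = 0 := by
      by_contra h0
      apply H'.1.2 p
      rw [← inv_smul_smul₀ h0 (ζ p), ← h2]
      exact Submodule.smul_mem _ _ ⟨_, rfl⟩
    rw [h3, zero_smul] at h2
    exact ⟨sub_eq_zero.1 (hi.injective p (h2.trans (map_zero (mvfderiv (𝓡 n) i p)).symm)),
      sub_eq_zero.1 h3⟩
  refine ⟨fun Y p hY X ↦ (key Y p hY X).1, fun p ↦ ?_⟩
  ext X Y
  obtain ⟨e, he, x, hx, rfl⟩ := exists_chart (n := n) p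
  have hs := e.map_target hx
  rw [← sum_coordComponent he hs Y]
  simp only [map_sum, map_smul, smul_apply, smul_eq_mul,
    fun k ↦ (key _ _ (isDifferentiableAt_coordField he hs k) X).2]

/-- The data of the affine normal of a co-oriented non-degenerate hypersurface: a conormal field
`μ` representing the co-orientation, the transversal `ζ` with `μ(ζ) = 1` and `(dμ)(ζ) = 0`, and the
induced connection and metric, which are aligned. The last field is the uniqueness of the affine
normal bundle. -/
structure IsAffineNormalData (i : M → V) (ν μ : Coorientation n i) (ζ : M → V)
    (D : TorsionFreeConnection n M) (h : PseudoMetric n M) : Prop where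
  exists_pos : ∃ φ : M → ℝ, (∀ p, 0 < φ p) ∧ ∀ p, μ.conormal p = φ p • ν.conormal p
  isEquiaffine : μ.IsEquiaffine ζ
  induces : Induces i ζ D h
  isAligned : IsAligned D h
  eq_smul : ∀ {ξ : M → V} {D' : TorsionFreeConnection n M} {h' : PseudoMetric n M},
    Induces i ξ D' h' → IsAligned D' h' → ∀ p, ξ p = μ.conormal p (ξ p) • ζ p

theorem exists_isAffineNormalData (hn : 1 < n) (hi : IsHypersurfaceImmersion n i)
    (hnd : IsNondegenerate n i) (ν : Coorientation n i) :
    ∃ (μ : Coorientation n i) (ζ : M → V) (D : TorsionFreeConnection n M) (h : PseudoMetric n M),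
      IsAffineNormalData i ν μ ζ D h := by
  obtain ⟨b⟩ := exists_basis_of_finrank_eq hi.finrank_eq
  obtain ⟨μ, φ, hμ, hφ, hφν⟩ := ν.exists_isNormalized hi hnd b
  obtain ⟨ζ, hζs, hζ⟩ := μ.exists_isEquiaffine hi hnd
  have H := induces_inducedConnection hi hnd μ hζs hζ.eq_one
  exact ⟨μ, ζ, _, _, ⟨φ, hφ, hφν⟩, hζ, H,
    (isAligned_iff_mvfderiv_conormal hn hi hμ H).2 hζ.mvfderiv_eq_zero,
    fun H' ha' ↦ eq_smul_of_isAligned hn hi hnd hμ hζ H' ha'⟩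

namespace IsAffineNormalData

variable {ν μ : Coorientation n i}

theorem exists_isInduced (hn : 1 < n) (hi : IsHypersurfaceImmersion n i)
    (N : IsAffineNormalData i ν μ ζ D h) :
    ∃ A : AHStructure n M, A.proj = D.projClass ∧ A.conf = h.confClass ∧
      IsInducedAHStructure i ν A := by
  refine ⟨⟨D.projClass, h.confClass, D, h, rfl, rfl, N.isAligned, fun e he x hx j k l ↦ ?_⟩,
    rfl, rfl, ζ, D, h, N.induces, fun p ↦ ?_, N.isAligned, rfl, rfl⟩
  · obtain ⟨S, G⟩ := N.isEquiaffine.exists_gaussWeingarten hi N.induces he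
    exact G.covDeriv_normalized_symm hn hx (N.isAligned e he x hx) j k l
  · obtain ⟨φ, hφ, hφν⟩ := N.exists_pos
    have h1 : φ p * ν.conormal p (ζ p) = 1 := by
      have := N.isEquiaffine.eq_one p
      rwa [hφν] at this
    exact pos_of_mul_pos_right (by rw [h1]; exact one_pos) (hφ p).le

theorem eq_of_isInduced (hi : IsHypersurfaceImmersion n i)
    (N : IsAffineNormalData i ν μ ζ D h) {A : AHStructure n M} (hA : IsInducedAHStructure i ν A) :
    A.proj = D.projClass ∧ A.conf = h.confClass := by
  obtain ⟨ξ, D', h', H, hpos, ha, hD, hh⟩ := hA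
  obtain ⟨φ, hφ, hφν⟩ := N.exists_pos
  obtain ⟨h1, h2⟩ := Induces.eq_of_smul hi H N.induces (N.eq_smul H ha)
  rw [← hD, ← hh]
  refine ⟨Quotient.sound ⟨fun _ ↦ 0, fun Y p hY X ↦ ?_⟩, Quotient.sound ⟨_, fun p ↦ ?_, h2⟩⟩
  · rw [h1 Y p hY X]
    simp
  · rw [hφν]
    exact mul_pos (hφ p) (hpos p)

end IsAffineNormalData

end InducedAHStructure

/-! ### Umbilic hypersurfaces -/

section Umbilic

variable {n : ℕ} {M : Type*} [TopologicalSpace M]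
  [ChartedSpace (EuclideanSpace ℝ (Fin n)) M]
  {V : Type*} [NormedAddCommGroup V] [NormedSpace ℝ V] {i ζ : M → V}
  {e : OpenPartialHomeomorph M (EuclideanSpace ℝ (Fin n))}

/-- The hypersurface is umbilic with respect to the transversal `ζ`: the shape operator is a
multiple of the identity at every point, `dζ = -s di`. -/
def IsUmbilic (n : ℕ) {M : Type*} [TopologicalSpace M] [ChartedSpace (EuclideanSpace ℝ (Fin n)) M]
    {V : Type*} [NormedAddCommGroup V] [NormedSpace ℝ V] (i ζ : M → V) : Prop :=
  ∀ p : M, ∃ s : ℝ, ∀ X : TangentSpace (𝓡 n) p,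
    mvfderiv (𝓡 n) ζ p X = -s • mvfderiv (𝓡 n) i p X

theorem shape_eq_smul_one_iff {Γ : EuclideanSpace ℝ (Fin n) → Fin n → Fin n → Fin n → ℝ}
    {h S : EuclideanSpace ℝ (Fin n) → Matrix (Fin n) (Fin n) ℝ}
    (hi : IsHypersurfaceImmersion n i) (hζ : ContMDiff (𝓡 n) 𝓘(ℝ, V) ∞ ζ)
    (he : e ∈ IsManifold.maximalAtlas (𝓡 n) ∞ M)
    (G : GaussWeingarten e.target (fun y ↦ i (e.symm y)) (fun y ↦ ζ (e.symm y)) Γ h S 0)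
    {x : EuclideanSpace ℝ (Fin n)} (hx : x ∈ e.target) (s : ℝ) :
    S x = s • 1 ↔ ∀ X : TangentSpace (𝓡 n) (e.symm x),
      mvfderiv (𝓡 n) ζ (e.symm x) X = -s • mvfderiv (𝓡 n) i (e.symm x) X := by
  have hf : ∀ k, mvfderiv (𝓡 n) i (e.symm x) (coordField e k (e.symm x)) = _ :=
    mvfderiv_coordField he hx (hi.smooth.mdifferentiable (by simp) _)
  have hz : ∀ k, mvfderiv (𝓡 n) ζ (e.symm x) (coordField e k (e.symm x)) = _ :=
    mvfderiv_coordField he hx (hζ.mdifferentiable (by simp) _)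
  constructor
  · intro hS X
    have h1 : ∀ k, pd k (fun y ↦ ζ (e.symm y)) x = -s • pd k (fun y ↦ i (e.symm y)) x := by
      intro k
      rw [G.weingarten x hx, hS]
      simp [Matrix.one_apply]
    rw [← sum_coordComponent he (e.map_target hx) X]
    simp only [map_sum, map_smul, hf, hz, h1, Finset.smul_sum, smul_comm (-s)]
  · intro h1
    ext k l
    have h2 := h1 (coordField e k (e.symm x))
    rw [hf, hz, G.weingarten x hx] at h2
    have h3 := (G.coeff_ext hx (c' := fun l ↦ if k = l then -s else 0) (t' := 0)
      (h2.trans (by simp))).1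
    have h4 := congrFun h3 l
    rw [Matrix.smul_apply, Matrix.one_apply, smul_eq_mul, ← neg_inj, h4]
    split_ifs <;> simp

/-- If `a - ε f = g ξ` with constants `a` and `ε`, then the shape operator of `ξ` satisfies
`g S = ε`. -/
theorem GaussWeingarten.mul_shape_eq {U : Set (EuclideanSpace ℝ (Fin n))}
    {f ξ : EuclideanSpace ℝ (Fin n) → V}
    {Γ : EuclideanSpace ℝ (Fin n) → Fin n → Fin n → Fin n → ℝ}
    {h S : EuclideanSpace ℝ (Fin n) → Matrix (Fin n) (Fin n) ℝ}
    (G : GaussWeingarten U f ξ Γ h S 0) {x : EuclideanSpace ℝ (Fin n)} (hx : x ∈ U)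
    {a : V} {ε : ℝ} {g : EuclideanSpace ℝ (Fin n) → ℝ} (hg : ∀ y ∈ U, a - ε • f y = g y • ξ y)
    (hd : DifferentiableAt ℝ g x) (k l : Fin n) :
    g x * S x k l = ε * if k = l then 1 else 0 := by
  have df := differentiableAt_of_contDiffOn G.contDiffOn_map G.isOpen hx
  have dξ := differentiableAt_of_contDiffOn G.contDiffOn_transversal G.isOpen hx
  have h1 := pd_congr G.isOpen hg hx k
  rw [pd_sub (differentiableAt_const _)
    (df.fun_const_smul ε),
    pd_smul (differentiableAt_const _) df, pd_smul hd dξ, pd_const, pd_const,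
    G.weingarten x hx] at h1
  have h2 := (G.coeff_ext hx (c := fun l ↦ ε * if k = l then 1 else 0) (t := 0)
    (c' := fun l ↦ g x * S x k l) (t' := -pd k g x) (by
      have h3 := congrArg Neg.neg h1
      simp only [Pi.zero_apply, zero_smul, add_zero, zero_sub, neg_neg, neg_add, neg_smul,
        Finset.sum_neg_distrib, smul_neg] at h3
      rw [neg_smul]
      simp only [mul_smul, ← Finset.smul_sum]
      rw [← h3]
      simp)).1
  exact (congrFun h2 l).symm

variable [IsManifold (𝓡 n) ∞ M]

/-- On a connected manifold a map with vanishing partial derivatives is constant. -/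
theorem exists_eq_const_of_pd_eq_zero [PreconnectedSpace M] {F : Type*} [NormedAddCommGroup F]
    [NormedSpace ℝ F] (u : M → F)
    (hd : ∀ e ∈ IsManifold.maximalAtlas (𝓡 n) ∞ M,
      DifferentiableOn ℝ (fun y ↦ u (e.symm y)) e.target)
    (h0 : ∀ e ∈ IsManifold.maximalAtlas (𝓡 n) ∞ M, ∀ x ∈ e.target, ∀ k,
      pd k (fun y ↦ u (e.symm y)) x = 0) (p q : M) : u p = u q := by
  refine IsLocallyConstant.apply_eq_of_preconnectedSpace
    ((IsLocallyConstant.iff_exists_open u).2 fun p ↦ ?_) p q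
  obtain ⟨e, he, x, hx, rfl⟩ := exists_chart (n := n) p
  have h1 := e.open_target.isOpen_inter_preimage_of_fderiv_eq_zero (hd e he) (fun y hy ↦ by
    ext v
    rw [fderiv_apply_eq_sum_pd]
    simp [h0 e he y hy]) {u (e.symm x)}
  refine ⟨_, e.symm.isOpen_image_of_subset_source h1 Set.inter_subset_left,
    ⟨x, ⟨hx, rfl⟩, rfl⟩, ?_⟩
  rintro _ ⟨y, ⟨_, hy⟩, rfl⟩
  exact hy

namespace IsAffineNormalData

variable {ν μ : Coorientation n i} {D : TorsionFreeConnection n M} {h : PseudoMetric n M}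

/-- The shape operator of an umbilic hypersurface is a constant multiple of the identity. -/
theorem exists_eq_const_of_isUmbilic [PreconnectedSpace M] (hn : 1 < n)
    (hi : IsHypersurfaceImmersion n i) (N : IsAffineNormalData i ν μ ζ D h)
    (hU : IsUmbilic n i ζ) : ∃ (s : ℝ) (K : V), ∀ p, ζ p + s • i p = K := by
  rcases isEmpty_or_nonempty M with hM | ⟨⟨p₀⟩⟩
  · exact ⟨0, 0, fun p ↦ hM.elim p⟩
  have hζ := N.induces.1.1
  choose s hs using hU
  have hsc : ∀ p, s p = s p₀ := by
    have key : ∀ e ∈ IsManifold.maximalAtlas (𝓡 n) ∞ M,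
        DifferentiableOn ℝ (fun y ↦ s (e.symm y)) e.target ∧
          ∀ x ∈ e.target, ∀ k, pd k (fun y ↦ s (e.symm y)) x = 0 := by
      intro e he
      obtain ⟨S, G⟩ := N.isEquiaffine.exists_gaussWeingarten hi N.induces he
      have hS : ∀ y ∈ e.target, S y = s (e.symm y) • 1 := fun y hy ↦
        (shape_eq_smul_one_iff hi hζ he G hy _).2 (hs _)
      refine ⟨?_, fun x hx k ↦ G.pd_eq_zero_of_shape_eq hn hS hx k⟩
      have hk : 0 < n := by omega
      refine ((G.contDiffOn_shape ⟨0, hk⟩ ⟨0, hk⟩).differentiableOn (by simp)).congr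
        fun y hy ↦ ?_
      rw [hS y hy]
      simp
    exact fun p ↦ exists_eq_const_of_pd_eq_zero s (fun e he ↦ (key e he).1)
      (fun e he ↦ (key e he).2) p p₀
  refine ⟨s p₀, ζ p₀ + s p₀ • i p₀, fun p ↦ ?_⟩
  refine exists_eq_const_of_pd_eq_zero (n := n) (fun p ↦ ζ p + s p₀ • i p) (fun e he ↦ ?_)
    (fun e he x hx k ↦ ?_) p p₀
  · exact ((contDiffOn_comp_symm he hζ).add
      ((contDiffOn_comp_symm he hi.smooth).const_smul (s p₀))).differentiableOn (by simp)
  · have d1 := differentiableAt_of_contDiffOn (contDiffOn_comp_symm he hζ) e.open_target hx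
    have d2 := differentiableAt_of_contDiffOn (contDiffOn_comp_symm he hi.smooth) e.open_target hx
    have h1 := hs (e.symm x) (coordField e k (e.symm x))
    rw [mvfderiv_coordField he hx (hi.smooth.mdifferentiable (by simp) _),
      mvfderiv_coordField he hx (hζ.mdifferentiable (by simp) _), hsc] at h1
    rw [pd_add d1 (d2.fun_const_smul (s p₀)),
      pd_smul (differentiableAt_const _) d2, pd_const, h1]
    simp

/-- The affine normal lines of an umbilic hypersurface are concurrent or parallel. -/
theorem isAffineHypersphere_of_eq_const (N : IsAffineNormalData i ν μ ζ D h) {s : ℝ} {K : V}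
    (hK : ∀ p, ζ p + s • i p = K) : IsAffineHypersphere n i := by
  refine ⟨fun p ↦ Submodule.span ℝ {ζ p}, ⟨ζ, D, h, N.induces, N.isAligned, fun p ↦ rfl⟩, ?_⟩
  by_cases hs : s = 0
  · refine Or.inr fun p q ↦ ?_
    have : ζ p = ζ q := by simpa [hs] using (hK p).trans (hK q).symm
    exact congrArg (fun v ↦ Submodule.span ℝ {v}) this
  · refine Or.inl ⟨s⁻¹ • K, fun p ↦ ?_⟩
    rw [AffineSubspace.mem_mk', vsub_eq_sub, ← hK p, smul_add, inv_smul_smul₀ hs,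
      add_sub_cancel_right]
    exact Submodule.smul_mem _ _ (Submodule.mem_span_singleton_self _)

/-- Concurrent or parallel affine normal lines make the hypersurface umbilic. -/
theorem isUmbilic_of_isAffineHypersphere (hn : 1 < n) (hi : IsHypersurfaceImmersion n i)
    (N : IsAffineNormalData i ν μ ζ D h) (H : IsAffineHypersphere n i) : IsUmbilic n i ζ := by
  obtain ⟨W, ⟨ξ, D', h', HI, ha, hW⟩, H⟩ := H
  have hζ := N.induces.1.1
  have hsmul := N.eq_smul HI ha
  have hmem : ∀ {p v}, v ∈ W p → v = μ.conormal p v • ζ p := by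
    intro p v hv
    rw [hW p] at hv
    obtain ⟨c, rfl⟩ := Submodule.mem_span_singleton.1 hv
    rw [map_smul, smul_assoc, ← hsmul p]
  intro p
  obtain ⟨e, he, x, hx, rfl⟩ := exists_chart (n := n) p
  obtain ⟨S, G⟩ := N.isEquiaffine.exists_gaussWeingarten hi N.induces he
  suffices ∃ s : ℝ, S x = s • 1 by
    obtain ⟨s, hs⟩ := this
    exact ⟨s, (shape_eq_smul_one_iff hi hζ he G hx s).1 hs⟩
  have hθ := contDiffOn_comp_symm he μ.smooth
  rcases H with ⟨c, hc⟩ | H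
  · have h1 : ∀ y ∈ e.target, c - (1 : ℝ) • i (e.symm y) =
        μ.conormal (e.symm y) (c - i (e.symm y)) • ζ (e.symm y) := fun y _ ↦ by
      rw [one_smul]
      exact hmem (AffineSubspace.mem_mk'.1 (hc (e.symm y)))
    have h2 := G.mul_shape_eq hx h1 (differentiableAt_of_contDiffOn
      (hθ.clm_apply (contDiffOn_const.sub G.contDiffOn_map)) e.open_target hx)
    set g := μ.conormal (e.symm x) (c - i (e.symm x)) with hg
    have hk : 0 < n := by omega
    have hg0 : g ≠ 0 := by
      intro h0
      have := h2 ⟨0, hk⟩ ⟨0, hk⟩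
      simp [h0] at this
    refine ⟨g⁻¹, ?_⟩
    ext k l
    rw [Matrix.smul_apply, Matrix.one_apply, smul_eq_mul, ← one_mul (ite _ _ _), ← h2 k l,
      inv_mul_cancel_left₀ hg0]
  · have hξ : ∀ q, ξ (e.symm x) ∈ W q := fun q ↦ by
      rw [H q (e.symm x), hW]
      exact Submodule.mem_span_singleton_self _
    have h1 : ∀ y ∈ e.target, ξ (e.symm x) - (0 : ℝ) • i (e.symm y) =
        μ.conormal (e.symm y) (ξ (e.symm x)) • ζ (e.symm y) := fun y _ ↦ by
      rw [zero_smul, sub_zero]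
      exact hmem (hξ _)
    have h2 := G.mul_shape_eq hx h1 (differentiableAt_of_contDiffOn
      (hθ.clm_apply contDiffOn_const) e.open_target hx)
    have hg0 : μ.conormal (e.symm x) (ξ (e.symm x)) ≠ 0 := by
      intro h0
      refine HI.1.2 (e.symm x) ?_
      rw [← μ.ker_eq]
      exact h0
    refine ⟨0, ?_⟩
    ext k l
    have := h2 k l
    simpa [hg0] using this

end IsAffineNormalData

end Umbilic

/-! ### Projectively flat charts of umbilic hypersurfaces -/

section FlatCharts

variable {n : ℕ} {V : Type*} [NormedAddCommGroup V] [NormedSpace ℝ V]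

/-- The coordinates `x = T(f - c) / ℓ`, `ℓ = η(ξ)`, obtained by central or parallel projection along
the transversal are projectively flat, with `σ = d log ℓ`: the second fundamental form cancels
between the components `T` and `η` of the Gauss equation. -/
theorem GaussWeingarten.christoffel_eq_of_projection {U : Set (EuclideanSpace ℝ (Fin n))}
    {f ξ : EuclideanSpace ℝ (Fin n) → V}
    {Γ : EuclideanSpace ℝ (Fin n) → Fin n → Fin n → Fin n → ℝ}
    {h S : EuclideanSpace ℝ (Fin n) → Matrix (Fin n) (Fin n) ℝ}
    (G : GaussWeingarten U f ξ Γ h S 0) {s : ℝ}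
    (hs : ∀ y ∈ U, ∀ k, pd k ξ y = -s • pd k f y)
    (T : V →L[ℝ] EuclideanSpace ℝ (Fin n)) (η : V →L[ℝ] ℝ) {c : V}
    (hη : ∀ y ∈ U, η (ξ y) ≠ 0)
    (hT : ∀ y ∈ U, T (f y - c) = η (ξ y) • y) (hTξ : ∀ y ∈ U, T (ξ y) = -s • T (f y - c))
    {x : EuclideanSpace ℝ (Fin n)} (hx : x ∈ U) (i j k : Fin n) :
    Γ x i j k = (if j = k then pd i (fun y ↦ η (ξ y)) x / η (ξ x) else 0) +
      (if i = k then pd j (fun y ↦ η (ξ y)) x / η (ξ x) else 0) := by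
  set ℓ : EuclideanSpace ℝ (Fin n) → ℝ := fun y ↦ η (ξ y) with hℓ
  have hf := G.contDiffOn_map
  have dd : ∀ {g : EuclideanSpace ℝ (Fin n) → V}, ContDiffOn ℝ ∞ g U → ∀ {y}, y ∈ U →
      DifferentiableAt ℝ g y := fun hg _ hy ↦ differentiableAt_of_contDiffOn hg G.isOpen hy
  have dr : ∀ {g : EuclideanSpace ℝ (Fin n) → ℝ}, ContDiffOn ℝ ∞ g U → ∀ {y}, y ∈ U →
      DifferentiableAt ℝ g y := fun hg _ hy ↦ differentiableAt_of_contDiffOn hg G.isOpen hy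
  have hℓs : ContDiffOn ℝ ∞ ℓ U := η.contDiff.comp_contDiffOn G.contDiffOn_transversal
  have hdℓ : ∀ y ∈ U, ∀ k, pd k ℓ y = -s * η (pd k f y) := by
    intro y hy k
    rw [hℓ, pd_clm_comp η (dd G.contDiffOn_transversal hy), hs y hy, map_smul, smul_eq_mul]
  have hid : ∀ (k : Fin n) (y : EuclideanSpace ℝ (Fin n)),
      pd k (fun z : EuclideanSpace ℝ (Fin n) ↦ z) y = EuclideanSpace.single k 1 := by
    intro k y
    simp [pd]
  have h1 : ∀ y ∈ U, ∀ k, T (pd k f y) = ℓ y • EuclideanSpace.single k 1 + pd k ℓ y • y := by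
    intro y hy k
    have := pd_congr G.isOpen hT hy k
    rw [pd_clm_comp T ((dd hf hy).sub_const c), pd_sub (dd hf hy) (differentiableAt_const _),
      pd_const, sub_zero, pd_smul (dr hℓs hy) differentiableAt_fun_id, hid] at this
    exact this
  have h2 : T (pd i (pd j f) x) = pd i ℓ x • EuclideanSpace.single j 1 +
      (pd j ℓ x • EuclideanSpace.single i 1 + pd i (pd j ℓ) x • x) := by
    have := pd_congr G.isOpen (fun y hy ↦ h1 y hy j) hx i
    rw [pd_clm_comp T (dd (contDiffOn_pd hf G.isOpen j) hx),
      pd_add ((dr hℓs hx).smul_const _)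
        ((dr (contDiffOn_pd hℓs G.isOpen j) hx).fun_smul differentiableAt_fun_id),
      pd_smul (dr hℓs hx) (differentiableAt_const _),
      pd_smul (dr (contDiffOn_pd hℓs G.isOpen j) hx) differentiableAt_fun_id, hid, pd_const,
      smul_zero, zero_add] at this
    exact this
  have h3 : pd i (pd j ℓ) x = ∑ k, Γ x i j k * pd k ℓ x - s * h x i j * ℓ x := by
    have hd : DifferentiableAt ℝ (fun y ↦ η (pd j f y)) x :=
      η.differentiableAt.comp x (dd (contDiffOn_pd hf G.isOpen j) hx)
    rw [pd_congr G.isOpen (fun y hy ↦ hdℓ y hy j) hx i, pd_mul (differentiableAt_const _) hd,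
      pd_clm_comp η (dd (contDiffOn_pd hf G.isOpen j) hx), pd_const, G.gauss x hx]
    simp only [map_add, map_sum, map_smul, smul_eq_mul, hdℓ x hx, mul_add, Finset.mul_sum,
      mul_left_comm (-s)]
    ring
  rw [G.gauss x hx, map_add, map_sum, map_smul, hTξ x hx, hT x hx, h3] at h2
  simp only [map_smul, h1 x hx] at h2
  have h4 := congrArg (fun v : EuclideanSpace ℝ (Fin n) ↦ v k) h2
  have hsingle : ∀ m : Fin n,
      (EuclideanSpace.single m (1 : ℝ) : EuclideanSpace ℝ (Fin n)) k = if m = k then 1 else 0 := by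
    intro m
    simp [eq_comm]
  have hsum : (∑ m, Γ x i j m • (ℓ x • EuclideanSpace.single m (1 : ℝ) + pd m ℓ x • x)) k =
      ℓ x * Γ x i j k + (∑ m, Γ x i j m * pd m ℓ x) * x k := by
    simp only [smul_add, Finset.sum_add_distrib, smul_smul, ← Finset.sum_smul, PiLp.add_apply,
      PiLp.smul_apply, smul_eq_mul]
    congr 1
    simp [Pi.single_apply, mul_comm]
  simp only [PiLp.add_apply, PiLp.smul_apply, smul_eq_mul, hsum, hsingle] at h4
  have hℓ0 : ℓ x ≠ 0 := hη x hx
  have h5 : ℓ x * Γ x i j k =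
      pd i ℓ x * (if j = k then 1 else 0) + pd j ℓ x * (if i = k then 1 else 0) := by
    linarith
  refine mul_left_cancel₀ hℓ0 (h5.trans ?_)
  change _ = ℓ x * ((if j = k then pd i ℓ x / ℓ x else 0) + if i = k then pd j ℓ x / ℓ x else 0)
  simp only [mul_add, mul_ite, mul_div_cancel₀ _ hℓ0, mul_one, mul_zero]

variable {M : Type*} [TopologicalSpace M]
  [ChartedSpace (EuclideanSpace ℝ (Fin n)) M] [IsManifold (𝓡 n) ∞ M]

/-- The inverse function theorem provides a chart with a prescribed coordinate map. -/
theorem exists_chart_of_injective_fderiv {e : OpenPartialHomeomorph M (EuclideanSpace ℝ (Fin n))}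
    (he : e ∈ IsManifold.maximalAtlas (𝓡 n) ∞ M) (u : M → EuclideanSpace ℝ (Fin n))
    {x : EuclideanSpace ℝ (Fin n)} {U : Set (EuclideanSpace ℝ (Fin n))} (hU : IsOpen U)
    (hUe : U ⊆ e.target) (hx : x ∈ U)
    (hu : ContDiffOn ℝ ∞ (fun y ↦ u (e.symm y)) U)
    (hinj : Function.Injective (fderiv ℝ (fun y ↦ u (e.symm y)) x)) :
    ∃ e' ∈ IsManifold.maximalAtlas (𝓡 n) ∞ M, e.symm x ∈ e'.source ∧
      e'.source ⊆ e.symm '' U ∧ ∀ q ∈ e'.source, e' q = u q := by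
  set g : EuclideanSpace ℝ (Fin n) → EuclideanSpace ℝ (Fin n) := fun y ↦ u (e.symm y) with hg
  have hgat : ∀ y ∈ U, ContDiffAt ℝ ∞ g y := fun y hy ↦ hu.contDiffAt (hU.mem_nhds hy)
  have hdat : ∀ y ∈ U, DifferentiableAt ℝ g y := fun y hy ↦ differentiableAt_of_contDiffOn hu hU hy
  set A := (LinearEquiv.ofInjectiveEndo (fderiv ℝ g x).toLinearMap hinj).toContinuousLinearEquiv
    with hA
  have hA' : (A : EuclideanSpace ℝ (Fin n) →L[ℝ] EuclideanSpace ℝ (Fin n)) = fderiv ℝ g x := by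
    ext v
    rfl
  -- the open set on which the derivative is invertible
  set O : Set (EuclideanSpace ℝ (Fin n)) := U ∩ fderiv ℝ g ⁻¹'
    Set.range ((↑) : (EuclideanSpace ℝ (Fin n) ≃L[ℝ] EuclideanSpace ℝ (Fin n)) →
      EuclideanSpace ℝ (Fin n) →L[ℝ] EuclideanSpace ℝ (Fin n)) with hO
  have hOo : IsOpen O := (hu.continuousOn_fderiv_of_isOpen hU (by simp)).isOpen_inter_preimage hU
    ContinuousLinearEquiv.isOpen
  have hxO : x ∈ O := ⟨hx, A, hA'⟩
  have hstrict : HasFDerivAt g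
      (A : EuclideanSpace ℝ (Fin n) →L[ℝ] EuclideanSpace ℝ (Fin n)) x := by
    rw [hA']
    exact (hdat x hx).hasFDerivAt
  set ψ := ((hgat x hx).toOpenPartialHomeomorph g hstrict (by simp)).restrOpen O hOo with hψ
  have hψc : ∀ y, ψ y = g y := fun y ↦ rfl
  have hxψ : x ∈ ψ.source :=
    ⟨(hgat x hx).mem_toOpenPartialHomeomorph_source hstrict (by simp), hxO⟩
  have hψO : ψ.source ⊆ O := fun y hy ↦ hy.2
  have hψs : ContDiffOn ℝ ∞ ψ ψ.source := fun y hy ↦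
    (hgat y (hψO hy).1).contDiffWithinAt
  have hψt : ContDiffOn ℝ ∞ ψ.symm ψ.target := by
    intro z hz
    have hy := hψO (ψ.map_target hz)
    obtain ⟨B, hB⟩ := hy.2
    refine (ψ.contDiffAt_symm (f₀' := B) hz ?_ (hgat _ hy.1)).contDiffWithinAt
    rw [hB]
    exact (hdat _ hy.1).hasFDerivAt
  refine ⟨e.trans ψ, OpenPartialHomeomorph.mem_maximalAtlas_of_contMDiffOn _ ?_ ?_, ?_, ?_, ?_⟩
  · rw [OpenPartialHomeomorph.trans_source]
    exact (contMDiffOn_iff_contDiffOn.2 hψs).comp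
      ((contMDiffOn_of_mem_maximalAtlas he).mono Set.inter_subset_left) fun q hq ↦ hq.2
  · rw [OpenPartialHomeomorph.trans_target]
    exact (contMDiffOn_symm_of_mem_maximalAtlas he).comp
      ((contMDiffOn_iff_contDiffOn.2 hψt).mono Set.inter_subset_left) fun q hq ↦ hq.2
  · rw [OpenPartialHomeomorph.trans_source]
    refine ⟨e.map_target (hUe hx), ?_⟩
    change e (e.symm x) ∈ ψ.source
    rwa [e.right_inv (hUe hx)]
  · intro q hq
    rw [OpenPartialHomeomorph.trans_source] at hq
    exact ⟨e q, (hψO hq.2).1, e.left_inv hq.1⟩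
  · intro q hq
    rw [OpenPartialHomeomorph.trans_source] at hq
    change u (e.symm (e q)) = u q
    rw [e.left_inv hq.1]

end FlatCharts

/-! ### Einstein and projectively flat induced structures -/

section Equivalence

variable {n : ℕ} {M : Type*} [TopologicalSpace M]
  [ChartedSpace (EuclideanSpace ℝ (Fin n)) M] [IsManifold (𝓡 n) ∞ M]
  {V : Type*} [NormedAddCommGroup V] [NormedSpace ℝ V] {i ζ : M → V}
  {ν μ : Coorientation n i} {D : TorsionFreeConnection n M} {h : PseudoMetric n M}
  {A : AHStructure n M}

theorem abs_det_components_rpow_ne_zero (h : PseudoMetric n M)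
    {e : OpenPartialHomeomorph M (EuclideanSpace ℝ (Fin n))}
    (he : e ∈ IsManifold.maximalAtlas (𝓡 n) ∞ M) {x : EuclideanSpace ℝ (Fin n)}
    (hx : x ∈ e.target) :
    |(h.components e x).det| ^ (-(1 / (n : ℝ))) ≠ 0 :=
  (Real.rpow_pos_of_pos (abs_pos.2 (det_components_ne_zero he h hx)) _).ne'

namespace IsAffineNormalData

/-- It suffices to verify that the shape operator is a multiple of the identity in one chart around
each point. -/
theorem isUmbilic_of_forall_chart (hi : IsHypersurfaceImmersion n i)
    (N : IsAffineNormalData i ν μ ζ D h)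
    (H : ∀ p : M, ∃ e ∈ IsManifold.maximalAtlas (𝓡 n) ∞ M, ∃ x ∈ e.target, p = e.symm x ∧
      ∀ S : EuclideanSpace ℝ (Fin n) → Matrix (Fin n) (Fin n) ℝ,
        GaussWeingarten e.target (fun y ↦ i (e.symm y)) (fun y ↦ ζ (e.symm y))
          (D.christoffel e) (h.components e) S 0 → ∃ s : ℝ, S x = s • 1) : IsUmbilic n i ζ := by
  intro p
  obtain ⟨e, he, x, hx, rfl, H⟩ := H p
  obtain ⟨S, G⟩ := N.isEquiaffine.exists_gaussWeingarten hi N.induces he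
  obtain ⟨s, hs⟩ := H S G
  exact ⟨s, (shape_eq_smul_one_iff hi N.induces.1.1 he G hx s).1 hs⟩

theorem isUmbilic_of_isEinstein (hn : 1 < n) (hi : IsHypersurfaceImmersion n i)
    (N : IsAffineNormalData i ν μ ζ D h) (hproj : A.proj = D.projClass)
    (hconf : A.conf = h.confClass) (H : A.IsEinstein) : IsUmbilic n i ζ := by
  obtain ⟨D', h', hD, hh, ha, hE, -⟩ := H
  have hD' : ProjectivelyEquivalent D D' := Quotient.exact (hproj.symm.trans hD.symm)
  have hh' : ConformallyEquivalent h h' := Quotient.exact (hconf.symm.trans hh.symm)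
  refine N.isUmbilic_of_forall_chart hi fun p ↦ ?_
  obtain ⟨e, he, x, hx, hp⟩ := exists_chart (n := n) p
  refine ⟨e, he, x, hx, hp, fun S G ↦ ?_⟩
  obtain ⟨f, hf, hfh⟩ := components_of_conformallyEquivalent hh'
  have h1 := (hE e he x hx).1
  rw [ricci_congr e.open_target hx fun y hy ↦
    christoffel_eq_of_isAligned hn hD' hh' N.isAligned ha he hy, PseudoMetric.normalized,
    hfh e x, smul_smul, ← hfh e x] at h1
  exact G.exists_shape_eq_of_traceFreeSymm hn hx
    (mul_ne_zero (abs_det_components_rpow_ne_zero h' he hx) (hf _).ne') h1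

theorem isEinstein_of_isUmbilic (hn : 1 < n) (hi : IsHypersurfaceImmersion n i)
    (N : IsAffineNormalData i ν μ ζ D h) (hproj : A.proj = D.projClass)
    (hconf : A.conf = h.confClass) (H : IsUmbilic n i ζ) : A.IsEinstein := by
  choose s hs using H
  have key : ∀ e ∈ IsManifold.maximalAtlas (𝓡 n) ∞ M,
      ∃ S : EuclideanSpace ℝ (Fin n) → Matrix (Fin n) (Fin n) ℝ,
        GaussWeingarten e.target (fun y ↦ i (e.symm y)) (fun y ↦ ζ (e.symm y))
          (D.christoffel e) (h.components e) S 0 ∧ ∀ y ∈ e.target, S y = s (e.symm y) • 1 := by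
    intro e he
    obtain ⟨S, G⟩ := N.isEquiaffine.exists_gaussWeingarten hi N.induces he
    exact ⟨S, G, fun y hy ↦ (shape_eq_smul_one_iff hi N.induces.1.1 he G hy _).2 (hs _)⟩
  refine ⟨D, h, hproj.symm, hconf.symm, N.isAligned, fun e he x hx ↦ ?_, fun e he x hx j ↦ ?_⟩
  · obtain ⟨S, G, hS⟩ := key e he
    exact G.naiveEinstein_of_shape_eq hn hx (abs_det_components_rpow_ne_zero h he hx) rfl (hS x hx)
  · obtain ⟨S, G, hS⟩ := key e he
    exact G.conservation_of_shape_eq hn hx (N.isAligned e he x hx) hS j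

theorem isUmbilic_of_isProjectivelyFlat (hn : 2 < n) (hi : IsHypersurfaceImmersion n i)
    (N : IsAffineNormalData i ν μ ζ D h) (hproj : A.proj = D.projClass)
    (H : A.IsProjectivelyFlat) : IsUmbilic n i ζ := by
  obtain ⟨D', hD, H⟩ := H
  have hD' : ProjectivelyEquivalent D' D := Quotient.exact (hD.trans hproj)
  refine N.isUmbilic_of_forall_chart hi fun p ↦ ?_
  obtain ⟨e, he, hp, σ, hσ⟩ := H p
  refine ⟨e, he, e p, e.map_source hp, (e.left_inv hp).symm, fun S G ↦ ?_⟩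
  obtain ⟨α, hα⟩ := christoffel_of_projectivelyEquivalent hD' he
  refine G.exists_shape_eq_of_projectivelyFlat hn (e.map_source hp)
    (σ := fun y j ↦ σ y j + α y j) fun y hy j k l ↦ ?_
  rw [hα y hy, hσ y hy]
  split_ifs <;> ring

/-- If `ζ + s i` is constant, then the projection of the hypersurface to its tangent space at `p₀`,
central or parallel along the affine normals, is a projectively flat chart near `p₀`. -/
theorem isProjectivelyFlat_of_eq_const (hi : IsHypersurfaceImmersion n i)
    (N : IsAffineNormalData i ν μ ζ D h) (hproj : A.proj = D.projClass) {s : ℝ} {K : V}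
    (hK : ∀ p, ζ p + s • i p = K) : A.IsProjectivelyFlat := by
  refine ⟨D, hproj.symm, fun p₀ ↦ ?_⟩
  obtain ⟨e, he, x₀, hx₀, rfl⟩ := exists_chart (n := n) p₀
  have hζ := N.induces.1.1
  set η := μ.conormal (e.symm x₀) with hη
  have hη1 : η (ζ (e.symm x₀)) = 1 := N.isEquiaffine.eq_one _
  obtain ⟨P, hP⟩ := exists_tangent_projection hi μ N.isEquiaffine.eq_one (e.symm x₀)
  have hPi : ∀ X, P (mvfderiv (𝓡 n) i (e.symm x₀) X) = X := fun X ↦ by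
    refine hi.injective (e.symm x₀) ((hP _).trans ?_)
    rw [μ.conormal_mvfderiv, zero_smul, sub_zero]
    rfl
  have hPζ : P (ζ (e.symm x₀)) = 0 := by
    refine hi.injective (e.symm x₀) ((hP _).trans ?_)
    rw [← hη, hη1, one_smul, sub_self]
    exact (map_zero (mvfderiv (𝓡 n) i (e.symm x₀))).symm
  -- `T` is the projection to the tangent space at `p₀` along the affine normal. Since `ζ` and
  -- `ζ(p₀)` differ by a multiple of `i - i(p₀)`, the map `u` is the projection along the affine
  -- normals, and its derivative at `p₀` is the identity because `i - i(p₀)` vanishes there.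
  set T : V →L[ℝ] EuclideanSpace ℝ (Fin n) := P with hT
  set u : M → EuclideanSpace ℝ (Fin n) := fun q ↦
    (η (ζ q))⁻¹ • T (i q - i (e.symm x₀)) with hu
  have hfs := contDiffOn_comp_symm he hi.smooth
  have hζs := contDiffOn_comp_symm he hζ
  have hℓs : ContDiffOn ℝ ∞ (fun y ↦ η (ζ (e.symm y))) e.target :=
    η.contDiff.comp_contDiffOn hζs
  set U : Set (EuclideanSpace ℝ (Fin n)) :=
    e.target ∩ (fun y ↦ η (ζ (e.symm y))) ⁻¹' {0}ᶜ with hU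
  have hUo : IsOpen U := hℓs.continuousOn.isOpen_inter_preimage e.open_target isOpen_compl_singleton
  have hxU : x₀ ∈ U := ⟨hx₀, by simp [hη1]⟩
  have hws : ContDiffOn ℝ ∞ (fun y ↦ T (i (e.symm y) - i (e.symm x₀))) e.target :=
    T.contDiff.comp_contDiffOn (hfs.sub contDiffOn_const)
  have hinv : ContDiffOn ℝ ∞ (fun y ↦ (η (ζ (e.symm y)))⁻¹) U :=
    (hℓs.mono Set.inter_subset_left).inv fun y hy ↦ hy.2
  have hus : ContDiffOn ℝ ∞ (fun y ↦ u (e.symm y)) U := hinv.smul (hws.mono Set.inter_subset_left)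
  have hpd : ∀ k, pd k (fun y ↦ u (e.symm y)) x₀ = T (pd k (fun y ↦ i (e.symm y)) x₀) := by
    intro k
    have d1 := differentiableAt_of_contDiffOn hfs e.open_target hx₀
    rw [hu, pd_smul (differentiableAt_of_contDiffOn hinv hUo hxU)
      (differentiableAt_of_contDiffOn hws e.open_target hx₀), pd_clm_comp T (d1.sub_const _),
      pd_sub d1 (differentiableAt_const _), pd_const, hη1]
    simp
  have hinj : Function.Injective (fderiv ℝ (fun y ↦ u (e.symm y)) x₀) := by
    refine (injective_iff_map_eq_zero _).2 fun v hv ↦ ?_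
    rw [fderiv_apply_eq_sum_pd] at hv
    have h1 : ∑ k, v k • coordField e k (e.symm x₀) = 0 := by
      rw [← hPi (∑ k, v k • coordField e k (e.symm x₀))]
      rw [map_sum, map_sum]
      simp only [map_smul, mvfderiv_coordField he hx₀ (hi.smooth.mdifferentiable (by simp) _)]
      simp only [hpd] at hv
      exact hv
    ext k
    rw [← coordComponent_sum he (e.map_target hx₀) v k, h1]
    simp [coordComponent]
    rfl
  obtain ⟨e', he', hp', hsub, heu⟩ :=
    exists_chart_of_injective_fderiv he u hUo Set.inter_subset_left hxU hus hinj
  obtain ⟨S, G⟩ := N.isEquiaffine.exists_gaussWeingarten hi N.induces he'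
  have hη0 : ∀ y ∈ e'.target, η (ζ (e'.symm y)) ≠ 0 := by
    intro y hy
    obtain ⟨z, hz, hzy⟩ := hsub (e'.map_target hy)
    rw [← hzy]
    exact hz.2
  refine ⟨e', he', hp', fun y j ↦ pd j (fun y ↦ η (ζ (e'.symm y))) y / η (ζ (e'.symm y)),
    fun x hx j k l ↦ ?_⟩
  refine G.christoffel_eq_of_projection (s := s) (fun y hy k ↦ ?_) T η
    (c := i (e.symm x₀)) hη0 (fun y hy ↦ ?_) (fun y hy ↦ ?_) hx j k l
  · have h1 : (fun y ↦ ζ (e'.symm y)) = fun y ↦ K - s • i (e'.symm y) :=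
      funext fun y ↦ eq_sub_of_add_eq (hK _)
    have d1 := differentiableAt_of_contDiffOn (contDiffOn_comp_symm he' hi.smooth) e'.open_target hy
    rw [h1, pd_sub (differentiableAt_const _) (d1.fun_const_smul s),
      pd_smul (differentiableAt_const _) d1, pd_const, pd_const]
    simp
  · have h1 := heu _ (e'.map_target hy)
    rw [e'.right_inv hy] at h1
    exact (smul_inv_smul₀ (hη0 y hy) (T (i (e'.symm y) - i (e.symm x₀)))).symm.trans
      (congrArg (fun z ↦ η (ζ (e'.symm y)) • z) h1.symm)
  · have h1 : ζ (e'.symm y) = ζ (e.symm x₀) + -s • (i (e'.symm y) - i (e.symm x₀)) := by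
      rw [eq_sub_of_add_eq (hK (e'.symm y)), ← hK (e.symm x₀)]
      module
    have h2 : T (ζ (e.symm x₀)) = 0 := hPζ
    rw [h1, map_add, map_smul, h2, zero_add]

end IsAffineNormalData

end Equivalence

end AHGeometry

end

theorem mainTheorem6 {n : ℕ} (hn : 2 < n)
    {M : Type*} [TopologicalSpace M] [T2Space M] [SecondCountableTopology M]
    [PreconnectedSpace M] [ChartedSpace (EuclideanSpace ℝ (Fin n)) M] [IsManifold (𝓡 n) ∞ M]
    {V : Type*} [NormedAddCommGroup V] [NormedSpace ℝ V]
    (i : M → V) (hi : AHGeometry.IsHypersurfaceImmersion n i)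
    (hnd : AHGeometry.IsNondegenerate n i) (ν : AHGeometry.Coorientation n i) :
    (∃! A : AHGeometry.AHStructure n M, AHGeometry.IsInducedAHStructure i ν A) ∧
      ∀ A : AHGeometry.AHStructure n M, AHGeometry.IsInducedAHStructure i ν A →
        [AHGeometry.IsAffineHypersphere n i, A.IsEinstein, A.IsProjectivelyFlat].TFAE := by
  obtain ⟨μ, ζ, D, h, N⟩ := AHGeometry.exists_isAffineNormalData (by omega) hi hnd ν
  constructor
  · obtain ⟨A, hproj, hconf, hA⟩ := N.exists_isInduced (by omega) hi
    refine ⟨A, hA, fun B hB ↦ ?_⟩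
    obtain ⟨h1, h2⟩ := N.eq_of_isInduced hi hB
    exact AHGeometry.AHStructure.ext (h1.trans hproj.symm) (h2.trans hconf.symm)
  · intro A hA
    obtain ⟨hproj, hconf⟩ := N.eq_of_isInduced hi hA
    have hconst := N.exists_eq_const_of_isUmbilic (by omega) hi
    tfae_have 1 → 2 := fun H ↦
      N.isEinstein_of_isUmbilic (by omega) hi hproj hconf
        (N.isUmbilic_of_isAffineHypersphere (by omega) hi H)
    tfae_have 2 → 3 := fun H ↦ by
      obtain ⟨s, K, hK⟩ := hconst (N.isUmbilic_of_isEinstein (by omega) hi hproj hconf H)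
      exact N.isProjectivelyFlat_of_eq_const hi hproj hK
    tfae_have 3 → 1 := fun H ↦ by
      obtain ⟨s, K, hK⟩ := hconst (N.isUmbilic_of_isProjectivelyFlat hn hi hproj H)
      exact N.isAffineHypersphere_of_eq_const hK
    tfae_finish
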